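/- Let $\Lambda\subset\mathbb{C}^2$ be a lattice (a discrete subgroup spanning $\mathbb{C}^2$ over $\mathbb{R}$), $T=\mathbb{C}^2/\Lambda$ the associated complex torus, $T[2]$ its group of $2$-torsion points, and $Y=T/\{\pm1\}$ the associated singular Kummer surface, with quotient map $q:T\to Y$. Let $\Sigma$ be a nonempty set of singular points of $Y$, let $X$ be the blowup of the complex space $Y$ at the points of $\Sigma$ (and at no other point), and let $X_{\mathrm{reg}}$ be the set of points of $X$ that have a neighbourhood isomorphic to an open subset of some $\mathbb{C}^n$. Let $p\in\Sigma$ be arbitrary. Then $q$ restricts to a bijection from $T[2]\cong(\mathbb{Z}/2)^4$ onto the set $\mathrm{Sing}(Y)$ of singular points, so that $Y$ has exactly $16$ singular points. Hence there are bijections $e:(\mathbb{Z}/2)^4\to\mathrm{Sing}(Y)$ with $e(0)=p$ of the form $e(v)=q(t_0+\psi(v))$, where $\psi:(\mathbb{Z}/2)^4\to T[2]$ is a group isomorphism and $t_0\in T[2]$. Use any such $e$ to regard $\mathrm{Sing}(Y)$ as the group $(\mathbb{Z}/2)^4$ with identity element $p$, and let $\langle\Sigma\rangle$ be the subgroup generated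 by $\Sigma$, that is, by $e^{-1}(\Sigma)$. Then $X_{\mathrm{reg}}$ is path connected and, for every base point, $$\pi_1(X_{\mathrm{reg}})\cong(\mathbb{Z}/2)^4/\langle\Sigma\rangle .$$ -/

import Mathlib

open Filter Topology

noncomputable section

/-- A reduced complex space structure on `X`, encoded as a sheaf of `ℂ`-algebras of continuous
complex-valued functions through its stalks: `hol x` consists of the functions `X → ℂ` that are
holomorphic on a neighbourhood of `x` (their values far from `x` are irrelevant).  The sections
over an open set `U` are the functions that belong to `hol x` for every `x ∈ U`. -/
structure HolStructure (X : Type*) [TopologicalSpace X] where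
  hol : X → Subalgebra ℂ (X → ℂ)
  congr : ∀ {x : X} {f g : X → ℂ}, f =ᶠ[𝓝 x] g → f ∈ hol x → g ∈ hol x
  eventually : ∀ {x : X} {f : X → ℂ}, f ∈ hol x → ∀ᶠ y in 𝓝 x, f ∈ hol y
  continuousAt : ∀ {x : X} {f : X → ℂ}, f ∈ hol x → ContinuousAt f x

namespace HolStructure

/-- The usual holomorphic functions on a complex normed space. -/
def ofNormed (E : Type*) [NormedAddCommGroup E] [NormedSpace ℂ E] : HolStructure E where
  hol x :=
    { carrier := {f | AnalyticAt ℂ f x}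
      mul_mem' := fun hf hg => AnalyticAt.mul hf hg
      add_mem' := fun hf hg => AnalyticAt.add hf hg
      algebraMap_mem' := fun c => (analyticAt_const : AnalyticAt ℂ (fun _ : E => c) x) }
  congr h hf := AnalyticAt.congr hf h
  eventually hf := AnalyticAt.eventually_analyticAt hf
  continuousAt hf := AnalyticAt.continuousAt hf

/-- The quotient structure along a quotient map `q : X → Y`: a function on an open subset `U` of
`Y` is holomorphic iff its composition with `q` is holomorphic on `q ⁻¹' U`. -/
def quotient {X Y : Type*} [TopologicalSpace X] [TopologicalSpace Y] (H : HolStructure X)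
    (q : X → Y) (hq : IsQuotientMap q) : HolStructure Y where
  hol y :=
    { carrier := {f | ∀ᶠ y' in 𝓝 y, ∀ x, q x = y' → f ∘ q ∈ H.hol x}
      mul_mem' := fun hf hg => by
        filter_upwards [hf, hg] with y' h1 h2 x hx using mul_mem (h1 x hx) (h2 x hx)
      add_mem' := fun hf hg => by
        filter_upwards [hf, hg] with y' h1 h2 x hx using add_mem (h1 x hx) (h2 x hx)
      algebraMap_mem' := fun c =>
        Eventually.of_forall fun _ x _ => (H.hol x).algebraMap_mem c }
  congr {y f g} h hf := by
    filter_upwards [hf, h.eventually_nhds] with y' h1 h2 x hx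
    subst hx
    exact H.congr (hq.continuous.continuousAt.eventually h2) (h1 x rfl)
  eventually hf := eventually_eventually_nhds.2 hf
  continuousAt {y f} hf := by
    obtain ⟨V, hV, hVo, hyV⟩ := eventually_nhds_iff.1 hf
    have h : ContinuousOn f V := by
      rw [hq.continuousOn_isOpen_iff hVo]
      intro x hx
      exact (H.continuousAt (hV (q x) hx x rfl)).continuousWithinAt
    exact h.continuousAt (hVo.mem_nhds hyV)

/-- The structure whose holomorphic functions near `x` are the analytic expressions in finitely
many functions from a given set `C x` of local coordinate functions. -/
def generated {X : Type*} [TopologicalSpace X] (C : X → Set (X → ℂ))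
    (hC : ∀ {x f}, f ∈ C x → ContinuousAt f x)
    (hC' : ∀ {x f}, f ∈ C x → ∀ᶠ y in 𝓝 x, f ∈ C y) : HolStructure X where
  hol x :=
    { carrier := {h | ∃ (n : ℕ) (G : Fin n → X → ℂ) (F : (Fin n → ℂ) → ℂ), (∀ i, G i ∈ C x) ∧
        AnalyticAt ℂ F (fun i => G i x) ∧ h =ᶠ[𝓝 x] fun y => F (fun i => G i y)}
      mul_mem' := by
        rintro a b ⟨n, G, F, hG, hF, h⟩ ⟨n', G', F', hG', hF', h'⟩
        refine ⟨n + n', Fin.append G G', fun v => F (fun i => v (Fin.castAdd n' i)) *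
          F' (fun i => v (Fin.natAdd n i)), fun i => ?_, ?_, ?_⟩
        · refine Fin.addCases (fun i => ?_) (fun i => ?_) i <;> simp [hG, hG']
        · refine AnalyticAt.mul ?_ ?_
          · refine AnalyticAt.fun_comp (g := F) (by simpa using hF) ?_
            exact AnalyticAt.pi fun i =>
              (ContinuousLinearMap.proj (R := ℂ) (φ := fun _ : Fin (n + n') => ℂ)
                (Fin.castAdd n' i)).analyticAt _
          · refine AnalyticAt.fun_comp (g := F') (by simpa using hF') ?_
            exact AnalyticAt.pi fun i =>
              (ContinuousLinearMap.proj (R := ℂ) (φ := fun _ : Fin (n + n') => ℂ)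
                (Fin.natAdd n i)).analyticAt _
        · filter_upwards [h, h'] with y h1 h2
          simp [h1, h2]
      add_mem' := by
        rintro a b ⟨n, G, F, hG, hF, h⟩ ⟨n', G', F', hG', hF', h'⟩
        refine ⟨n + n', Fin.append G G', fun v => F (fun i => v (Fin.castAdd n' i)) +
          F' (fun i => v (Fin.natAdd n i)), fun i => ?_, ?_, ?_⟩
        · refine Fin.addCases (fun i => ?_) (fun i => ?_) i <;> simp [hG, hG']
        · refine AnalyticAt.add ?_ ?_
          · refine AnalyticAt.fun_comp (g := F) (by simpa using hF) ?_
            exact AnalyticAt.pi fun i =>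
              (ContinuousLinearMap.proj (R := ℂ) (φ := fun _ : Fin (n + n') => ℂ)
                (Fin.castAdd n' i)).analyticAt _
          · refine AnalyticAt.fun_comp (g := F') (by simpa using hF') ?_
            exact AnalyticAt.pi fun i =>
              (ContinuousLinearMap.proj (R := ℂ) (φ := fun _ : Fin (n + n') => ℂ)
                (Fin.natAdd n i)).analyticAt _
        · filter_upwards [h, h'] with y h1 h2
          simp [h1, h2]
      algebraMap_mem' := fun c =>
        ⟨0, Fin.elim0, fun _ => c, fun i => i.elim0, analyticAt_const, EventuallyEq.rfl⟩ }
  congr := by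
    rintro x f g h ⟨n, G, F, hG, hF, h'⟩
    exact ⟨n, G, F, hG, hF, h.symm.trans h'⟩
  eventually := by
    rintro x f ⟨n, G, F, hG, hF, h⟩
    have hc : ContinuousAt (fun y => fun i => G i y) x := continuousAt_pi.2 fun i => hC (hG i)
    filter_upwards [h.eventually_nhds, eventually_all.2 fun i => hC' (hG i),
      hc.eventually hF.eventually_analyticAt] with y h1 h2 h3
    exact ⟨n, G, F, h2, h3, h1⟩
  continuousAt := by
    rintro x f ⟨n, G, F, hG, hF, h⟩
    have hc : ContinuousAt (fun y => fun i => G i y) x := continuousAt_pi.2 fun i => hC (hG i)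
    exact (ContinuousAt.comp (f := fun y => fun i => G i y) (g := F) hF.continuousAt hc).congr
      h.symm

section

variable {X : Type*} [TopologicalSpace X] (H : HolStructure X)

/-- The regular points: those with an open neighbourhood isomorphic, together with its holomorphic
functions, to an open subset of some `ℂⁿ`. -/
def regularLocus : Set X :=
  {x | ∃ (n : ℕ) (e : OpenPartialHomeomorph X (Fin n → ℂ)), x ∈ e.source ∧
    ∀ y ∈ e.source, ∀ f : X → ℂ, f ∈ H.hol y ↔ AnalyticAt ℂ (f ∘ e.symm) (e y)}

def singularLocus : Set X := H.regularLocusᶜ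

variable (S : Set X)

/-- The stalk at `x` of the ideal sheaf `𝓘` of holomorphic functions vanishing on `S`. -/
def idealAt (x : X) : Submodule ℂ (X → ℂ) where
  carrier := {f | f ∈ H.hol x ∧ ∀ᶠ y in 𝓝 x, y ∈ S → f y = 0}
  add_mem' := fun hf hg => ⟨add_mem hf.1 hg.1, by
    filter_upwards [hf.2, hg.2] with y h1 h2 hy; simp [h1 hy, h2 hy]⟩
  zero_mem' := ⟨zero_mem _, by simp⟩
  smul_mem' := fun c f hf => ⟨Subalgebra.smul_mem _ hf.1 c, by
    filter_upwards [hf.2] with y h1 hy; simp [h1 hy]⟩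

variable {H S} in
lemma mul_mem_idealAt {x : X} {g f : X → ℂ} (hg : g ∈ H.hol x) (hf : f ∈ H.idealAt S x) :
    g * f ∈ H.idealAt S x :=
  ⟨mul_mem hg hf.1, by filter_upwards [hf.2] with y h1 hy; simp [h1 hy]⟩

variable {H S} in
lemma idealAt_eventually {x : X} {f : X → ℂ} (hf : f ∈ H.idealAt S x) :
    ∀ᶠ y in 𝓝 x, f ∈ H.idealAt S y := by
  filter_upwards [H.eventually hf.1, eventually_eventually_nhds.2 hf.2] with y h1 h2
  exact ⟨h1, h2⟩

/-- The dual of the fibre `𝓘_x / 𝔪_x 𝓘_x`: linear forms on the ideal stalk at `x` that are linear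
over the holomorphic functions, which act on `ℂ` through their value at `x`. -/
def fibreDual (x : X) : Submodule ℂ (Module.Dual ℂ (H.idealAt S x)) where
  carrier := {φ | ∀ (g : X → ℂ) (hg : g ∈ H.hol x) (f : H.idealAt S x),
    φ ⟨g * f, mul_mem_idealAt hg f.2⟩ = g x * φ f}
  add_mem' := fun h1 h2 g hg f => by simp [h1 g hg f, h2 g hg f, mul_add]
  zero_mem' := fun g hg f => by simp
  smul_mem' := fun c φ h g hg f => by simp [h g hg f]; ring

/-- The projective fibre space `ℙ(𝓘)` of the ideal sheaf `𝓘` of `S`: a point is a point `base` of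
`X` with a line of linear forms on the fibre of `𝓘` at `base`.  If `f₁, …, fₙ` generate `𝓘` over
an open set `U`, then `(x, [φ]) ↦ (x, [φ(f₁) : ⋯ : φ(fₙ)])` embeds the part over `U` in
`U × ℙⁿ⁻¹`, and for `x ∉ S` the only point over `x` is sent to `[f₁(x) : ⋯ : fₙ(x)]`. -/
@[ext]
structure IdealProj where
  base : X
  line : Projectivization ℂ (H.fibreDual S base)

namespace IdealProj

variable {H S}

open Classical in
/-- The homogeneous coordinate `φ(f)` of `(x, [φ])` (up to a common scalar). -/
def coord (f : X → ℂ) (P : H.IdealProj S) : ℂ :=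
  if hf : f ∈ H.idealAt S P.base then P.line.rep.1 ⟨f, hf⟩ else 0

/-- The affine coordinate `φ(g) / φ(f)`, well defined where `φ(f) ≠ 0`. -/
def ratio (g f : X → ℂ) (P : H.IdealProj S) : ℂ := P.coord g / P.coord f

/-- The coarsest topology for which the projection to `X` is continuous and, for all sections
`f, g` of the ideal sheaf over an open `U`, the locus `φ(f) ≠ 0` over `U` is open and
`φ(g) / φ(f)` is continuous on it. -/
instance : TopologicalSpace (H.IdealProj S) :=
  TopologicalSpace.generateFrom
    ({A | ∃ U : Set X, IsOpen U ∧ A = base ⁻¹' U} ∪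
      {A | ∃ (U : Set X) (f g : X → ℂ) (W : Set ℂ), IsOpen U ∧ IsOpen W ∧
        (∀ x ∈ U, f ∈ H.idealAt S x ∧ g ∈ H.idealAt S x) ∧
        A = {P | P.base ∈ U ∧ P.coord f ≠ 0 ∧ P.ratio g f ∈ W}})

lemma continuous_base : Continuous (base : H.IdealProj S → X) :=
  continuous_def.2 fun U hU =>
    TopologicalSpace.isOpen_generateFrom_of_mem (Or.inl ⟨U, hU, rfl⟩)

lemma eventually_ratio {P : H.IdealProj S} {f g : X → ℂ} (hf : f ∈ H.idealAt S P.base)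
    (hg : g ∈ H.idealAt S P.base) (h0 : P.coord f ≠ 0) {W : Set ℂ} (hW : IsOpen W)
    (hPW : P.ratio g f ∈ W) : ∀ᶠ Q in 𝓝 P, Q.coord f ≠ 0 ∧ Q.ratio g f ∈ W := by
  obtain ⟨U, hU, hUo, hPU⟩ :=
    eventually_nhds_iff.1 ((idealAt_eventually hf).and (idealAt_eventually hg))
  have ho : IsOpen {Q : H.IdealProj S | Q.base ∈ U ∧ Q.coord f ≠ 0 ∧ Q.ratio g f ∈ W} :=
    TopologicalSpace.isOpen_generateFrom_of_mem (Or.inr ⟨U, f, g, W, hUo, hW, hU, rfl⟩)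
  filter_upwards [ho.mem_nhds ⟨hPU, h0, hPW⟩] with Q hQ using hQ.2

end IdealProj

/-- The blow-up of `X` along `S`: the closure in `ℙ(𝓘)` of the part over the complement of `S`,
that is, locally over `X`, the closure of the graph of `[f₁ : ⋯ : fₙ]` for generators `fᵢ` of the
ideal of `S`. -/
abbrev Blowup : Type _ := closure {P : H.IdealProj S | P.base ∉ S}

/-- The local coordinate functions on the blow-up: pullbacks of holomorphic functions on `X`, and
the affine coordinates `φ(g) / φ(f)` at the points where `φ(f) ≠ 0`. -/
def blowupCoords (P : H.Blowup S) : Set (H.Blowup S → ℂ) :=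
  {h | ∃ g ∈ H.hol P.1.base, h = fun Q => g Q.1.base} ∪
    {h | ∃ f ∈ H.idealAt S P.1.base, ∃ g ∈ H.idealAt S P.1.base,
      P.1.coord f ≠ 0 ∧ h = fun Q => Q.1.ratio g f}

/-- The complex structure of the blow-up. -/
def blowup : HolStructure (H.Blowup S) :=
  generated (H.blowupCoords S)
    (by
      rintro P h (⟨g, hg, rfl⟩ | ⟨f, hf, g, hg, h0, rfl⟩)
      · exact ContinuousAt.comp (f := fun Q : H.Blowup S => Q.1.base) (H.continuousAt hg)
          (IdealProj.continuous_base.comp continuous_subtype_val).continuousAt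
      · refine ContinuousAt.comp (f := fun Q : H.Blowup S => Q.1) (g := IdealProj.ratio g f) ?_
          continuous_subtype_val.continuousAt
        intro A hA
        obtain ⟨W, hWA, hW, hPW⟩ := mem_nhds_iff.1 hA
        exact (IdealProj.eventually_ratio hf hg h0 hW hPW).mono fun Q hQ => hWA hQ.2)
    (by
      have hb : Continuous (fun Q : H.Blowup S => Q.1.base) :=
        IdealProj.continuous_base.comp continuous_subtype_val
      rintro P h (⟨g, hg, rfl⟩ | ⟨f, hf, g, hg, h0, rfl⟩)
      · filter_upwards [hb.continuousAt.eventually (H.eventually hg)] with Q hQ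
        exact Or.inl ⟨g, hQ, rfl⟩
      · filter_upwards [hb.continuousAt.eventually (idealAt_eventually hf),
          hb.continuousAt.eventually (idealAt_eventually hg),
          (continuous_subtype_val.continuousAt (x := P)).eventually
            (IdealProj.eventually_ratio hf hg h0 isOpen_univ trivial)] with Q h1 h2 h3
        exact Or.inr ⟨f, h1, g, h2, h3.1, rfl⟩)

end

end HolStructure

section Kummer

variable (Λ : Submodule ℤ (Fin 2 → ℂ))

/-- The complex torus `ℂ² / Λ`. -/
abbrev CTorus : Type := (Fin 2 → ℂ) ⧸ Λ.toAddSubgroup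

def CTorus.holStructure : HolStructure (CTorus Λ) :=
  (HolStructure.ofNormed (Fin 2 → ℂ)).quotient (QuotientAddGroup.mk : _ → CTorus Λ)
    isQuotientMap_quot_mk

/-- The singular Kummer surface `T / {±1}` of `T = ℂ² / Λ`, where `ℤˣ = {1, -1}` acts on `T` by
`± t`. -/
abbrev SingularKummer : Type := MulAction.orbitRel.Quotient ℤˣ (CTorus Λ)

namespace SingularKummer

def proj (t : CTorus Λ) : SingularKummer Λ := Quotient.mk _ t

def holStructure : HolStructure (SingularKummer Λ) :=
  (CTorus.holStructure Λ).quotient (proj Λ) isQuotientMap_quot_mk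

/-- An identification `e` of the set of singular points of the singular Kummer surface with the
group `(ℤ/2)⁴` that makes `p` the identity: it comes from a group isomorphism `ψ` of `(ℤ/2)⁴` with
the group of 2-torsion points of the torus, followed by translation by a 2-torsion point `t₀`. -/
def IsGroupIdentification (p : SingularKummer Λ)
    (e : (Fin 4 → ZMod 2) ≃ (holStructure Λ).singularLocus) : Prop :=
  (e 0 : SingularKummer Λ) = p ∧
    ∃ (ψ : (Fin 4 → ZMod 2) ≃+ AddSubgroup.torsionBy (CTorus Λ) 2)
      (t₀ : AddSubgroup.torsionBy (CTorus Λ) 2),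
      ∀ v, (e v : SingularKummer Λ) = proj Λ ((t₀ + ψ v : AddSubgroup.torsionBy (CTorus Λ) 2))

end SingularKummer

end Kummer

end

noncomputable section

section

open Path.Homotopic (Quotient)
open scoped unitInterval

/-- A property of homotopy classes of paths that holds locally and is stable under concatenation
holds for all paths. -/
theorem Path.Homotopic.Quotient.induction_local {X : Type*} [TopologicalSpace X]
    {R : ∀ {x y : X}, Path.Homotopic.Quotient x y → Prop}
    (hloc : ∀ x : X, ∃ V ∈ 𝓝 x, ∀ {a b : X} (γ : Path a b), (∀ t, γ t ∈ V) →
      R (Path.Homotopic.Quotient.mk γ))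
    (htrans : ∀ {x y z : X} (p : Path.Homotopic.Quotient x y) (q : Path.Homotopic.Quotient y z),
      R p → R q → R (p.trans q))
    {x y : X} (p : Path.Homotopic.Quotient x y) : R p := by
  induction p using Path.Homotopic.Quotient.ind with | mk γ => ?_
  choose V hV hVR using hloc
  obtain ⟨t, ht0, htm, ⟨m, hm⟩, hcov⟩ := exists_monotone_Icc_subset_open_cover_unitInterval
    (c := fun x => γ ⁻¹' interior (V x)) (fun x => isOpen_interior.preimage γ.continuous)
    (fun s _ => Set.mem_iUnion.2 ⟨γ s, mem_interior_iff_mem_nhds.2 (hV _)⟩)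
  have hsub : ∀ n, R (Path.Homotopic.Quotient.mk (γ.subpath (t n) (t (n + 1)))) := by
    intro n
    obtain ⟨x, hx⟩ := hcov n
    refine hVR x _ fun s => ?_
    have h1 : γ.subpath (t n) (t (n + 1)) s ∈ γ '' Set.Icc (t n) (t (n + 1)) := by
      rw [← Path.range_subpath_of_le _ _ _ (htm n.le_succ)]
      exact ⟨s, rfl⟩
    obtain ⟨r, hr, hrs⟩ := h1
    exact interior_subset (hrs ▸ hx hr)
  have key : ∀ n, R (Path.Homotopic.Quotient.mk (γ.subpath 0 (t n))) := by
    intro n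
    induction n with
    | zero =>
      obtain ⟨x, hx⟩ := hcov 0
      refine hVR x _ fun s => ?_
      have h0 : γ.subpath 0 (t 0) s = γ 0 := by rw [ht0, Path.subpath_self]; rfl
      rw [h0]
      exact interior_subset (hx ⟨ht0.le, by rw [← ht0]; exact htm (Nat.zero_le _)⟩)
    | succ n ih =>
      have := htrans _ _ ih (hsub n)
      rwa [← Path.Homotopic.Quotient.mk_trans,
        Path.Homotopic.Quotient.eq.2 ⟨Path.Homotopy.subpathTransSubpath γ 0 (t n) (t (n + 1))⟩]
        at this
  have h := key m
  rw [hm m le_rfl, Path.subpath_zero_one] at h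
  have cast_ind : ∀ {x y x' y' : X} (hx : x' = x) (hy : y' = y) (γ : Path x y),
      R (Path.Homotopic.Quotient.mk (γ.cast hx hy)) → R (Path.Homotopic.Quotient.mk γ) := by
    rintro x y _ _ rfl rfl γ h
    exact h
  exact cast_ind _ _ _ h

theorem IsSimplyConnected.homotopic {X : Type*} [TopologicalSpace X] {V : Set X}
    (hV : IsSimplyConnected V) {x y : X} {p q : Path x y} (hp : ∀ t, p t ∈ V)
    (hq : ∀ t, q t ∈ V) : p.Homotopic q := by
  have := hV.simplyConnectedSpace
  have hx : x ∈ V := by simpa using hp 0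
  have hy : y ∈ V := by simpa using hp 1
  let lift : ∀ r : Path x y, (∀ t, r t ∈ V) → Path (⟨x, hx⟩ : V) ⟨y, hy⟩ := fun r hr =>
    { toFun := fun t => ⟨r t, hr t⟩
      continuous_toFun := by fun_prop
      source' := by simp
      target' := by simp }
  exact (SimplyConnectedSpace.paths_homotopic (lift p hp) (lift q hq)).map
    ⟨Subtype.val, continuous_subtype_val⟩

theorem Convex.isSimplyConnected {E : Type*} [AddCommGroup E] [Module ℝ E] [TopologicalSpace E]
    [IsTopologicalAddGroup E] [ContinuousSMul ℝ E] {s : Set E} (hs : Convex ℝ s)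
    (hne : s.Nonempty) : IsSimplyConnected s :=
  have := hs.contractibleSpace hne
  SimplyConnectedSpace.ofContractible s

section Complement

variable {E : Type*} [NormedAddCommGroup E] [NormedSpace ℝ E]

theorem Convex.homotopic_of_subset {O K : Set E} (hK : Convex ℝ K) (hKO : K ⊆ O) {x y : O}
    {p q : Path x y} (hp : ∀ t, (p t : E) ∈ K) (hq : ∀ t, (q t : E) ∈ K) : p.Homotopic q := by
  have hne : K.Nonempty := ⟨_, hp 0⟩
  have h : IsSimplyConnected ((↑) ⁻¹' K : Set O) := by
    rw [← IsEmbedding.subtypeVal.isSimplyConnected_image,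
      Subtype.image_preimage_coe, Set.inter_eq_self_of_subset_right hKO]
    exact hK.isSimplyConnected hne
  exact h.homotopic hp hq

/-- The straight path between two points of a set that contains the segment joining them. -/
def Path.segmentIn {O : Set E} (x y : O) (h : segment ℝ (x : E) y ⊆ O) : Path x y where
  toFun t := ⟨Path.segment (x : E) y t, h (by
    rw [← Path.range_segment]; exact ⟨t, rfl⟩)⟩
  continuous_toFun := by fun_prop
  source' := by simp
  target' := by simp

theorem Path.segmentIn_mem {O : Set E} (x y : O) (h : segment ℝ (x : E) y ⊆ O) (t : I) :
    (Path.segmentIn x y h t : E) ∈ segment ℝ (x : E) y := by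
  rw [← Path.range_segment]; exact ⟨t, rfl⟩

theorem ae_disjoint_convexHull [FiniteDimensional ℝ E] [MeasurableSpace E] [BorelSpace E]
    (μ : MeasureTheory.Measure E) [μ.IsAddHaarMeasure] (hE : 3 ≤ Module.finrank ℝ E) {D : Set E}
    (hD : D.Countable) {x y : E} (hxy : segment ℝ x y ⊆ Dᶜ) :
    ∀ᵐ a ∂μ, convexHull ℝ {a, x, y} ⊆ Dᶜ := by
  have h1 : ∀ d ∈ D, ∀ᵐ a ∂μ, a ∉ (affineSpan ℝ {d, x, y} : Set E) := by
    intro d _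
    refine MeasureTheory.measure_eq_zero_iff_ae_notMem.1
      (MeasureTheory.Measure.addHaar_affineSubspace μ _ fun h => ?_)
    have h3 : Module.finrank ℝ (vectorSpan ℝ (Set.range ![d, x, y])) ≤ 2 :=
      finrank_vectorSpan_range_le ℝ _ (by simp)
    have h4 : Set.range ![d, x, y] = {d, x, y} := by
      simp [Set.insert_comm, Matrix.range_cons, Set.pair_comm]
    rw [h4, ← direction_affineSpan, h, AffineSubspace.direction_top, finrank_top] at h3
    omega
  filter_upwards [(MeasureTheory.ae_ball_iff hD).2 h1] with a ha z hz hzD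
  rw [convexHull_insert ⟨x, by simp⟩, mem_convexJoin] at hz
  obtain ⟨a', rfl, w, hw, hz⟩ := hz
  rw [convexHull_pair] at hw
  obtain ⟨s, t, hs, ht, hst, rfl⟩ := hz
  rcases eq_or_ne s 0 with rfl | hs0
  · obtain rfl : t = 1 := by linarith
    simp only [zero_smul, one_smul, zero_add] at hzD
    exact hxy hw hzD
  · refine ha _ hzD ?_
    set d := s • a' + t • w with hd
    have hw' : w ∈ affineSpan ℝ {d, x, y} := by
      refine convexHull_subset_affineSpan _ (convexHull_mono ?_ (by rwa [convexHull_pair]))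
      exact Set.subset_insert _ _
    have hd' : d ∈ affineSpan ℝ {d, x, y} := subset_affineSpan _ _ (by simp)
    have : a' = AffineMap.lineMap w d s⁻¹ := by
      rw [AffineMap.lineMap_apply, hd, vsub_eq_sub, vadd_eq_add]
      obtain rfl : t = 1 - s := by linarith
      have : s • a' + (1 - s) • w - w = s • (a' - w) := by module
      rw [this, smul_smul, inv_mul_cancel₀ hs0]
      simp
    rw [this]
    exact AffineMap.lineMap_mem _ hw' hd'

/-- In real dimension at least three, the complement of a closed countable set is simply
connected. -/
theorem isSimplyConnected_compl_of_countable [FiniteDimensional ℝ E]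
    (hE : 3 ≤ Module.finrank ℝ E) {D : Set E} (hD : D.Countable) (hDc : IsClosed D) :
    IsSimplyConnected Dᶜ := by
  let _ : MeasurableSpace E := borel E
  have _ : BorelSpace E := ⟨rfl⟩
  let μ : MeasureTheory.Measure E := MeasureTheory.Measure.addHaar
  have hr : 1 < Module.rank ℝ E := by
    rw [← Module.finrank_eq_rank]; exact_mod_cast (by omega : 1 < Module.finrank ℝ E)
  refine simply_connected_iff_paths_homotopic.2
    ⟨isPathConnected_iff_pathConnectedSpace.1 (hD.isPathConnected_compl_of_one_lt_rank hr), ?_⟩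
  let R : ∀ {x y : (Dᶜ : Set E)}, Quotient x y → Prop := fun {x y} q =>
    ∀ᵐ a ∂μ, ∃ (ha : a ∈ Dᶜ) (h1 : segment ℝ (x : E) a ⊆ Dᶜ) (h2 : segment ℝ a (y : E) ⊆ Dᶜ),
      q = .mk ((Path.segmentIn x ⟨a, ha⟩ h1).trans (Path.segmentIn ⟨a, ha⟩ y h2))
  have hR : ∀ {x y : (Dᶜ : Set E)} (q : Quotient x y), R q := by
    intro x y q
    refine Path.Homotopic.Quotient.induction_local (R := R) ?_ ?_ q
    · intro x
      obtain ⟨r, hr, hball⟩ := Metric.isOpen_iff.1 hDc.isOpen_compl x x.2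
      refine ⟨(↑) ⁻¹' Metric.ball (x : E) r,
        continuous_subtype_val.continuousAt.preimage_mem_nhds (Metric.ball_mem_nhds _ hr), ?_⟩
      intro a b γ hγ
      have hab : segment ℝ (a : E) b ⊆ Metric.ball (x : E) r :=
        (convex_ball _ _).segment_subset (γ.source ▸ hγ 0) (γ.target ▸ hγ 1)
      filter_upwards [ae_disjoint_convexHull μ hE hD (hab.trans hball)] with c hc
      have m1 : (c : E) ∈ ({c, ↑a, ↑b} : Set E) := by simp
      have m2 : (a : E) ∈ ({c, ↑a, ↑b} : Set E) := by simp
      have m3 : (b : E) ∈ ({c, ↑a, ↑b} : Set E) := by simp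
      have hcv := convex_convexHull ℝ ({c, ↑a, ↑b} : Set E)
      have m := subset_convexHull ℝ ({c, ↑a, ↑b} : Set E)
      have s1 := hcv.segment_subset (m m2) (m m1)
      have s2 := hcv.segment_subset (m m1) (m m3)
      have s3 := hcv.segment_subset (m m2) (m m3)
      refine ⟨hc (m m1), s1.trans hc, s2.trans hc, Path.Homotopic.Quotient.eq.2 ?_⟩
      refine ((convex_ball (x : E) r).homotopic_of_subset hball (q := Path.segmentIn a b
        (hab.trans hball)) hγ fun t => hab (Path.segmentIn_mem _ _ _ _)).trans ?_
      refine hcv.homotopic_of_subset hc (fun t => s3 (Path.segmentIn_mem _ _ _ _)) fun t => ?_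
      rw [Path.trans_apply]
      split_ifs
      · exact s1 (Path.segmentIn_mem a ⟨c, hc (m m1)⟩ _ _)
      · exact s2 (Path.segmentIn_mem ⟨c, hc (m m1)⟩ b _ _)
    · intro x y z p q hp hq
      filter_upwards [hp, hq] with a ⟨ha, h1, h2, hp⟩ ⟨_, h3, h4, hq⟩
      refine ⟨ha, h1, h4, ?_⟩
      have hc : Path.Homotopic.Quotient.mk
          ((Path.segmentIn ⟨a, ha⟩ y h2).trans (Path.segmentIn y ⟨a, ha⟩ h3)) =
          Path.Homotopic.Quotient.refl _ := by
        rw [← Path.Homotopic.Quotient.mk_refl]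
        refine Path.Homotopic.Quotient.eq.2 ((convex_segment a (y : E)).homotopic_of_subset h2
          (fun t => ?_) fun t => left_mem_segment _ _ _)
        rw [Path.trans_apply]
        split_ifs
        · exact Path.segmentIn_mem ⟨a, ha⟩ y _ _
        · rw [segment_symm]; exact Path.segmentIn_mem y ⟨a, ha⟩ _ _
      rw [hp, hq]
      simp only [Path.Homotopic.Quotient.mk_trans] at hc ⊢
      rw [Path.Homotopic.Quotient.trans_assoc,
        ← Path.Homotopic.Quotient.trans_assoc (.mk (Path.segmentIn ⟨a, ha⟩ y h2)), hc,
        Path.Homotopic.Quotient.refl_trans]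
  intro x y
  refine ⟨fun p q => ?_⟩
  obtain ⟨a, ⟨_, _, _, h1⟩, ⟨_, _, _, h2⟩⟩ := ((hR p).and (hR q)).exists
  rw [h1, h2]

end Complement

end

section

open Path.Homotopic (Quotient)
open scoped unitInterval

section ApproxLift

variable {W X : Type*} [TopologicalSpace W] [TopologicalSpace X]

/-- A simply connected open set `V` that meets the range of `π : W → X` and over which any two
points of the range are joined by the image of a path with prescribed starting point. -/
structure IsGoodNhd (π : W → X) (V : Set X) : Prop where
  isOpen : IsOpen V
  isSimplyConnected : IsSimplyConnected V
  exists_mem : ∃ w, π w ∈ V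
  exists_path : ∀ z w, π z ∈ V → π w ∈ V →
    ∃ w', π w' = π w ∧ ∃ δ : Path z w', ∀ t, π (δ t) ∈ V

/-- A class of paths from `π z` to `x` that lifts to `W` up to arbitrarily short end pieces. -/
def IsApproxLift (π : C(W, X)) {z : W} {x : X} (α : Quotient (π z) x) : Prop :=
  ∀ O ∈ 𝓝 x, ∃ (z' : W) (δ : Path z z') (β : Path (π z') x), (∀ t, β t ∈ O) ∧
    α = (Path.Homotopic.Quotient.mk (δ.map π.continuous)).trans (.mk β)

variable {π : C(W, X)}

theorem IsGoodNhd.exists_path_to {V : Set X} (hV : IsGoodNhd π V) {a b : X} (ha : a ∈ V)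
    (hb : b ∈ V) : ∃ β : Path a b, ∀ t, β t ∈ V :=
  ⟨(hV.isSimplyConnected.isPathConnected.joinedIn a ha b hb).somePath,
    (hV.isSimplyConnected.isPathConnected.joinedIn a ha b hb).somePath_mem⟩

theorem IsGoodNhd.isApproxLift (hgood : ∀ x : X, ∀ O ∈ 𝓝 x, ∃ V ⊆ O, x ∈ V ∧ IsGoodNhd π V)
    {V : Set X} (hV : IsGoodNhd π V) {z : W} {y : X} (γ : Path (π z) y) (hγ : ∀ t, γ t ∈ V) :
    IsApproxLift π (.mk γ) := by
  intro O hO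
  have hz : π z ∈ V := γ.source ▸ hγ 0
  have hy : y ∈ V := γ.target ▸ hγ 1
  obtain ⟨V', hV'O, hyV', hV'⟩ := hgood y _ (inter_mem hO (hV.isOpen.mem_nhds hy))
  obtain ⟨z₁, hz₁⟩ := hV'.exists_mem
  obtain ⟨w, hw, δ, hδ⟩ := hV.exists_path z z₁ hz (hV'O hz₁).2
  obtain ⟨β, hβ⟩ := hV'.exists_path_to (hw ▸ hz₁) hyV'
  refine ⟨w, δ, β, fun t => (hV'O (hβ t)).1, ?_⟩
  rw [← Path.Homotopic.Quotient.mk_trans]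
  refine Path.Homotopic.Quotient.eq.2 (hV.isSimplyConnected.homotopic hγ fun t => ?_)
  rw [Path.trans_apply]
  split_ifs
  · exact hδ _
  · exact (hV'O (hβ _)).2

theorem IsApproxLift.trans (hgood : ∀ x : X, ∀ O ∈ 𝓝 x, ∃ V ⊆ O, x ∈ V ∧ IsGoodNhd π V)
    {x y : X} (γ : Quotient x y) {z : W} {α : Quotient (π z) x} (hα : IsApproxLift π α) :
    IsApproxLift π (α.trans γ) := by
  let R : ∀ {x y : X}, Quotient x y → Prop := fun {x y} γ =>
    ∀ {z : W} {α : Quotient (π z) x}, IsApproxLift π α → IsApproxLift π (α.trans γ)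
  refine Path.Homotopic.Quotient.induction_local (R := R) (fun x => ?_) ?_ γ hα
  · obtain ⟨V, -, hxV, hV⟩ := hgood x _ univ_mem
    refine ⟨V, hV.isOpen.mem_nhds hxV, ?_⟩
    intro a b γ hγ z α hα O hO
    obtain ⟨z', δ, β, hβ, rfl⟩ := hα V (hV.isOpen.mem_nhds (γ.source ▸ hγ 0))
    obtain ⟨z'', δ', β', hβ', h⟩ := hV.isApproxLift hgood (β.trans γ) (fun t => by
      rw [Path.trans_apply]
      split_ifs
      · exact hβ _
      · exact hγ _) O hO
    refine ⟨z'', δ.trans δ', β', hβ', ?_⟩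
    rw [Path.Homotopic.Quotient.mk_trans] at h
    rw [Path.Homotopic.Quotient.trans_assoc, h, Path.map_trans, Path.Homotopic.Quotient.mk_trans,
      Path.Homotopic.Quotient.trans_assoc]
  · intro x y w p q hp hq z α hα
    rw [← Path.Homotopic.Quotient.trans_assoc]
    exact hq (hp hα)

/-- The class in `X` of the image of a path in `W`. -/
def imageClass (π : C(W, X)) {z w : W} (δ : Path z w) {x y : X} (hz : π z = x) (hw : π w = y) :
    Quotient x y :=
  .mk ((δ.map π.continuous).cast hz.symm hw.symm)

theorem imageClass_trans {z w v : W} (δ : Path z w) (ε : Path w v) {x y u : X} (hz : π z = x)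
    (hw : π w = y) (hv : π v = u) :
    imageClass π (δ.trans ε) hz hv = (imageClass π δ hz hw).trans (imageClass π ε hw hv) := by
  subst hz hw hv
  rw [imageClass, imageClass, imageClass, ← Path.Homotopic.Quotient.mk_trans]
  congr 1
  ext t
  simp [Path.map_trans]

@[simp]
theorem imageClass_refl (z : W) {x : X} (hz : π z = x) :
    imageClass π (Path.refl z) hz hz = .refl x := by
  subst hz
  rfl

theorem imageClass_congr [SimplyConnectedSpace W] {z w w' : W} (δ : Path z w) (ε : Path z w')
    (h : w = w') {x y : X} (hz : π z = x) (hw : π w = y) :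
    imageClass π δ hz hw = imageClass π ε hz (h ▸ hw) := by
  subst hz hw h
  exact Path.Homotopic.Quotient.eq.2 ((SimplyConnectedSpace.paths_homotopic δ ε).map π)

theorem imageClass_map {z w : W} (δ : Path z w) {g : W → W} (hg : Continuous g)
    (hπ : ∀ v, π (g v) = π v) {x y : X} (hz : π z = x) (hw : π w = y) :
    imageClass π (δ.map hg) ((hπ z).trans hz) ((hπ w).trans hw) = imageClass π δ hz hw := by
  subst hz hw
  rw [imageClass, imageClass]
  congr 1
  ext t
  simp [hπ]

theorem imageClass_eq_refl_of_mem {V : Set X} (hV : IsSimplyConnected V) {z w : W} (δ : Path z w)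
    (hδ : ∀ t, π (δ t) ∈ V) {x : X} (hz : π z = x) (hw : π w = x) :
    imageClass π δ hz hw = .refl x := by
  rw [imageClass, ← Path.Homotopic.Quotient.mk_refl]
  refine Path.Homotopic.Quotient.eq.2 (hV.homotopic hδ fun t => ?_)
  subst hz
  simpa using hδ 0

theorem exists_eq_imageClass (hgood : ∀ x : X, ∀ O ∈ 𝓝 x, ∃ V ⊆ O, x ∈ V ∧ IsGoodNhd π V)
    {z : W} {x : X} (hz : π z = x) (γ : Quotient x x) :
    ∃ (w : W) (hw : π w = x) (δ : Path z w), γ = imageClass π δ hz hw := by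
  subst hz
  obtain ⟨V, -, hzV, hV⟩ := hgood (π z) _ univ_mem
  have h0 := hV.isApproxLift hgood (Path.refl (π z)) fun _ => hzV
  have h := h0.trans hgood γ
  rw [Path.Homotopic.Quotient.mk_refl, Path.Homotopic.Quotient.refl_trans] at h
  obtain ⟨z', δ, β, hβ, rfl⟩ := h V (hV.isOpen.mem_nhds hzV)
  obtain ⟨w, hw, ε, hε⟩ := hV.exists_path z' z (β.source ▸ hβ 0) hzV
  refine ⟨w, hw, δ.trans ε, ?_⟩
  rw [imageClass_trans δ ε rfl rfl hw]
  congr 1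
  exact Path.Homotopic.Quotient.eq.2 (hV.isSimplyConnected.homotopic hβ hε)

theorem pathConnectedSpace_of_isGoodNhd [PathConnectedSpace W]
    (hgood : ∀ x : X, ∀ O ∈ 𝓝 x, ∃ V ⊆ O, x ∈ V ∧ IsGoodNhd π V) : PathConnectedSpace X := by
  have key : ∀ x, ∃ w, Joined (π w) x := by
    intro x
    obtain ⟨V, -, hxV, hV⟩ := hgood x _ univ_mem
    obtain ⟨w, hw⟩ := hV.exists_mem
    exact ⟨w, (hV.isSimplyConnected.isPathConnected.joinedIn _ hw _ hxV).joined⟩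
  refine ⟨(inferInstance : Nonempty W).map π, fun x y => ?_⟩
  obtain ⟨w, hw⟩ := key x
  obtain ⟨v, hv⟩ := key y
  exact (hw.symm.trans ((PathConnectedSpace.joined w v).map π.continuous)).trans hv

end ApproxLift

section Lattice

variable {E : Type*} [AddCommGroup E] (Λ : AddSubgroup E)

/-- The points `z` with `2z ∈ Λ`. -/
def halfLattice : Set E := {z | z + z ∈ Λ}

variable {Λ}

theorem add_mem_compl_halfLattice {z l : E} (hz : z ∈ (halfLattice Λ)ᶜ) (hl : l ∈ Λ) :
    z + l ∈ (halfLattice Λ)ᶜ := fun h => hz <| by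
  have := sub_mem (sub_mem h hl) hl
  rwa [show z + l + (z + l) - l - l = z + z by abel] at this

theorem sub_mem_compl_halfLattice {z l : E} (hz : z ∈ (halfLattice Λ)ᶜ) (hl : l ∈ Λ) :
    l - z ∈ (halfLattice Λ)ᶜ := fun h => hz <| by
  have := neg_mem (sub_mem (sub_mem h hl) hl)
  rwa [show -(l - z + (l - z) - l - l) = z + z by abel] at this

variable [TopologicalSpace E] [IsTopologicalAddGroup E]

def translateCompl (l : Λ) (z : ((halfLattice Λ)ᶜ : Set E)) : ((halfLattice Λ)ᶜ : Set E) :=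
  ⟨z + l, add_mem_compl_halfLattice z.2 l.2⟩

def reflectCompl (l : Λ) (z : ((halfLattice Λ)ᶜ : Set E)) : ((halfLattice Λ)ᶜ : Set E) :=
  ⟨l - z, sub_mem_compl_halfLattice z.2 l.2⟩

theorem continuous_translateCompl (l : Λ) : Continuous (translateCompl l) := by
  unfold translateCompl; fun_prop

theorem continuous_reflectCompl (l : Λ) : Continuous (reflectCompl l) := by
  unfold reflectCompl; fun_prop

variable {X : Type*} [TopologicalSpace X] {π : C(((halfLattice Λ)ᶜ : Set E), X)}
  (hπ : ∀ z w : ((halfLattice Λ)ᶜ : Set E), π z = π w ↔ (w - z : E) ∈ Λ ∨ (w + z : E) ∈ Λ)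

include hπ

omit [IsTopologicalAddGroup E] in
theorem map_translateCompl (l : Λ) (z : ((halfLattice Λ)ᶜ : Set E)) :
    π (translateCompl l z) = π z := by
  symm
  rw [hπ]
  left
  simp [translateCompl]

omit [IsTopologicalAddGroup E] in
theorem map_reflectCompl (l : Λ) (z : ((halfLattice Λ)ᶜ : Set E)) :
    π (reflectCompl l z) = π z := by
  symm
  rw [hπ]
  right
  simp [reflectCompl]

variable [SimplyConnectedSpace ((halfLattice Λ)ᶜ : Set E)]

/-- The image of a path joining `z` to its reflection in `c` is null-homotopic as soon as this
holds for one such path that stays over a simply connected set. -/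
theorem imageClass_reflectCompl {c : E} (hc : c ∈ halfLattice Λ) {V : Set X}
    (hV : IsSimplyConnected V) {w w' : ((halfLattice Λ)ᶜ : Set E)} (δ : Path w w')
    (hw : (w' : E) = c + c - w) (hδ : ∀ t, π (δ t) ∈ V) {z : ((halfLattice Λ)ᶜ : Set E)}
    (ε : Path z (reflectCompl ⟨c + c, hc⟩ z)) :
    imageClass π ε rfl (map_reflectCompl hπ _ z) = .refl _ := by
  obtain rfl : w' = reflectCompl ⟨c + c, hc⟩ w := Subtype.ext hw
  let η : Path z w := PathConnectedSpace.somePath z w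
  let r := reflectCompl (Λ := Λ) ⟨c + c, hc⟩
  have hr : ∀ v, π (r v) = π v := map_reflectCompl hπ _
  have h1 := imageClass_map η.symm (continuous_reflectCompl ⟨c + c, hc⟩) hr (y := π z) rfl rfl
  have h2 := imageClass_eq_refl_of_mem hV δ hδ rfl (hr w)
  have h3 := imageClass_trans (π := π) η η.symm (y := π w) (u := π z) rfl rfl rfl
  rw [imageClass_congr (η.trans η.symm) (Path.refl z) rfl rfl, imageClass_refl] at h3
  rw [imageClass_congr ε ((η.trans δ).trans (η.symm.map (continuous_reflectCompl ⟨c + c, hc⟩))) rfl,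
    imageClass_trans _ _ rfl (hr w) (hr z), imageClass_trans _ _ rfl rfl (hr w), h2,
    Path.Homotopic.Quotient.trans_refl]
  exact (congrArg _ h1).trans h3.symm

/-- The homomorphism from the translation lattice to the fundamental group. -/
def translationHom (z : ((halfLattice Λ)ᶜ : Set E)) :
    Multiplicative Λ →* FundamentalGroup X (π z) :=
  MonoidHom.mk'
    (fun l => imageClass π (PathConnectedSpace.somePath z (translateCompl l.toAdd z)) rfl
      (map_translateCompl hπ _ z))
    (by
      intro l m
      rw [FundamentalGroup.mul_def]
      have h := imageClass_map (PathConnectedSpace.somePath z (translateCompl l.toAdd z))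
        (continuous_translateCompl m.toAdd) (map_translateCompl hπ _) rfl
        (map_translateCompl hπ _ z)
      have h' : translateCompl m.toAdd (translateCompl l.toAdd z) =
          translateCompl (l * m).toAdd z := by
        ext1
        simp [translateCompl, add_assoc]
      refine (imageClass_congr _ ((PathConnectedSpace.somePath z _).trans
        ((PathConnectedSpace.somePath z _).map (continuous_translateCompl m.toAdd))) h'.symm
          rfl _).trans ?_
      rw [imageClass_trans _ _ rfl (map_translateCompl hπ _ z)
        ((map_translateCompl hπ _ _).trans (map_translateCompl hπ _ z))]
      exact congrArg _ h)

theorem translationHom_eq {z w : ((halfLattice Λ)ᶜ : Set E)} {l : Λ} (hw : w = translateCompl l z)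
    (δ : Path z w) : translationHom hπ z (.ofAdd l) =
      imageClass π δ rfl (hw ▸ map_translateCompl hπ l z) :=
  imageClass_congr _ δ hw.symm rfl (map_translateCompl hπ l z)

theorem translationHom_surjective
    (hgood : ∀ x : X, ∀ O ∈ 𝓝 x, ∃ V ⊆ O, x ∈ V ∧ IsGoodNhd π V)
    {c : E} (hc : c ∈ halfLattice Λ) {V : Set X}
    (hV : IsSimplyConnected V) {w w' : ((halfLattice Λ)ᶜ : Set E)} (δ : Path w w')
    (hw : (w' : E) = c + c - w) (hδ : ∀ t, π (δ t) ∈ V) (z : ((halfLattice Λ)ᶜ : Set E)) :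
    Function.Surjective (translationHom hπ z) := by
  intro γ
  obtain ⟨v, hv, ε, rfl⟩ := exists_eq_imageClass hgood rfl γ
  rcases (hπ z v).1 hv.symm with h | h
  · exact ⟨.ofAdd ⟨_, h⟩, translationHom_eq hπ (by ext1; simp [translateCompl]) ε⟩
  · let ρ : Path z (reflectCompl ⟨c + c, hc⟩ z) := PathConnectedSpace.somePath _ _
    have hρ := imageClass_reflectCompl hπ hc hV δ hw hδ ρ
    have h1 := imageClass_map ρ (continuous_reflectCompl ⟨_, h⟩) (map_reflectCompl hπ _) rfl
        (map_reflectCompl hπ _ z)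
    have hv' : reflectCompl ⟨_, h⟩ z = v := by ext1; simp [reflectCompl]
    let ρ' := (ρ.map (continuous_reflectCompl ⟨_, h⟩)).cast hv'.symm rfl
    refine ⟨.ofAdd ⟨v + z - (c + c), sub_mem h hc⟩, ?_⟩
    refine (translationHom_eq hπ ?_ (ε.trans ρ')).trans ?_
    · ext1
      simp only [reflectCompl, translateCompl]
      abel
    · rw [imageClass_trans ε ρ' rfl hv ((map_reflectCompl hπ _ _).trans (map_reflectCompl hπ _ z))]
      have : imageClass π ρ' hv ((map_reflectCompl hπ _ _).trans (map_reflectCompl hπ _ z)) =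
          .refl _ := (h1.trans hρ)
      rw [this, Path.Homotopic.Quotient.trans_refl]

theorem translationHom_eq_one
    {c c' : E} (hc : c ∈ halfLattice Λ) (hc' : c' ∈ halfLattice Λ) {V V' : Set X}
    (hV : IsSimplyConnected V) {w₁ w₂ : ((halfLattice Λ)ᶜ : Set E)} (δ : Path w₁ w₂)
    (hw : (w₂ : E) = c + c - w₁) (hδ : ∀ t, π (δ t) ∈ V)
    (hV' : IsSimplyConnected V') {w₁' w₂' : ((halfLattice Λ)ᶜ : Set E)} (δ' : Path w₁' w₂')
    (hw' : (w₂' : E) = c' + c' - w₁') (hδ' : ∀ t, π (δ' t) ∈ V')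
    (z : ((halfLattice Λ)ᶜ : Set E)) {l : Λ} (hl : (l : E) = c + c - (c' + c')) :
    translationHom hπ z (.ofAdd l) = 1 := by
  let ρ : Path z (reflectCompl ⟨c + c, hc⟩ z) := PathConnectedSpace.somePath _ _
  let ρ' : Path z (reflectCompl ⟨c' + c', hc'⟩ z) := PathConnectedSpace.somePath _ _
  have hρ := imageClass_reflectCompl hπ hc hV δ hw hδ ρ
  have hρ' := imageClass_reflectCompl hπ hc' hV' δ' hw' hδ' ρ'
  have h1 := imageClass_map ρ' (continuous_reflectCompl ⟨_, hc⟩) (map_reflectCompl hπ _) rfl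
    (map_reflectCompl hπ _ z)
  refine (translationHom_eq hπ ?_
    (ρ.trans (ρ'.map (continuous_reflectCompl ⟨c + c, hc⟩)))).trans ?_
  · ext1
    simp only [reflectCompl, translateCompl, hl]
    abel
  · rw [imageClass_trans _ _ rfl (map_reflectCompl hπ _ z)
      ((map_reflectCompl hπ _ _).trans (map_reflectCompl hπ _ z)), hρ,
      Path.Homotopic.Quotient.refl_trans]
    exact h1.trans hρ'

end Lattice

end

section

section ReflectionQuotient

variable {E : Type*} [AddCommGroup E] {Λ : AddSubgroup E}

/-- The orbit relation on `E` of the group generated by the translations by `L` and the point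
reflection `z ↦ c - z`. -/
def reflectionSetoid (L : AddSubgroup Λ) (c : E) : Setoid E where
  r z w := (∃ l ∈ L, w = z + l) ∨ ∃ l ∈ L, w = c - z + l
  iseqv :=
    { refl := fun z => .inl ⟨0, zero_mem L, by simp⟩
      symm := by
        rintro z w (⟨l, hl, rfl⟩ | ⟨l, hl, rfl⟩)
        · exact .inl ⟨-l, neg_mem hl, by simp⟩
        · exact .inr ⟨l, hl, by abel⟩
      trans := by
        rintro z w v (⟨l, hl, rfl⟩ | ⟨l, hl, rfl⟩) (⟨m, hm, rfl⟩ | ⟨m, hm, rfl⟩)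
        · exact .inl ⟨l + m, add_mem hl hm, by simp [add_assoc]⟩
        · exact .inr ⟨m - l, sub_mem hm hl, by push_cast; abel⟩
        · exact .inr ⟨l + m, add_mem hl hm, by push_cast; abel⟩
        · exact .inl ⟨m - l, sub_mem hm hl, by push_cast; abel⟩ }

/-- The quotient of `E` by the group generated by the translations by `L` and the point
reflection `z ↦ c - z`. -/
def ReflectionQuotient (L : AddSubgroup Λ) (c : E) : Type _ := Quotient (reflectionSetoid L c)

namespace ReflectionQuotient

variable {L : AddSubgroup Λ} {c : E}

def mk (z : E) : ReflectionQuotient L c := Quotient.mk _ z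

theorem mk_eq_mk {z w : E} : (mk z : ReflectionQuotient L c) = mk w ↔
    (∃ l ∈ L, w = z + l) ∨ ∃ l ∈ L, w = c - z + l :=
  Quotient.eq

theorem mk_surjective : Function.Surjective (mk : E → ReflectionQuotient L c) :=
  Quotient.mk_surjective

/-- The translation action of `Λ ⧸ L`. -/
@[reducible] def addAction (hL : ∀ l : Λ, l + l ∈ L) :
    AddAction (Λ ⧸ L) (ReflectionQuotient L c) where
  vadd g m := Quotient.liftOn₂' g m (fun l z => mk (l + z)) (by
    intro l z l' z' hl hz
    rw [QuotientAddGroup.leftRel_apply] at hl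
    refine mk_eq_mk.2 ?_
    rcases hz with ⟨m, hm, rfl⟩ | ⟨m, hm, rfl⟩
    · exact .inl ⟨-l + l' + m, add_mem hl hm, by push_cast; abel⟩
    · exact .inr ⟨-l + l' + m + (l + l), add_mem (add_mem hl hm) (hL l), by push_cast; abel⟩)
  zero_vadd m := by
    obtain ⟨z, rfl⟩ := mk_surjective m
    exact congrArg mk (by simp)
  add_vadd g h m := by
    obtain ⟨z, rfl⟩ := mk_surjective m
    obtain ⟨l, rfl⟩ := QuotientAddGroup.mk_surjective g
    obtain ⟨l', rfl⟩ := QuotientAddGroup.mk_surjective h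
    exact congrArg mk (by simp [add_assoc])

variable [TopologicalSpace E] [IsTopologicalAddGroup E]

instance : TopologicalSpace (ReflectionQuotient L c) :=
  inferInstanceAs (TopologicalSpace (Quotient (reflectionSetoid L c)))

omit [IsTopologicalAddGroup E] in
theorem isQuotientMap_mk : IsQuotientMap (mk : E → ReflectionQuotient L c) :=
  isQuotientMap_quot_mk

theorem isOpenMap_mk : IsOpenMap (mk : E → ReflectionQuotient L c) := by
  intro U hU
  rw [← isQuotientMap_mk.isOpen_preimage]
  have : mk ⁻¹' (mk '' U : Set (ReflectionQuotient L c)) =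
      ⋃ l ∈ L, ((fun z => z + (l : E)) ⁻¹' U ∪ (fun z => c - z + (l : E)) ⁻¹' U) := by
    ext z
    simp only [Set.mem_preimage, Set.mem_image, Set.mem_iUnion, Set.mem_union, exists_prop]
    constructor
    · rintro ⟨w, hw, h⟩
      rcases mk_eq_mk.1 h.symm with ⟨l, hl, rfl⟩ | ⟨l, hl, rfl⟩
      · exact ⟨l, hl, .inl hw⟩
      · exact ⟨l, hl, .inr hw⟩
    · rintro ⟨l, hl, h | h⟩
      · exact ⟨_, h, (mk_eq_mk.2 (.inl ⟨l, hl, rfl⟩)).symm⟩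
      · exact ⟨_, h, (mk_eq_mk.2 (.inr ⟨l, hl, rfl⟩)).symm⟩
  rw [this]
  exact isOpen_biUnion fun l _ => (hU.preimage (by fun_prop)).union (hU.preimage (by fun_prop))

end ReflectionQuotient

end ReflectionQuotient

theorem AddSubgroup.exists_ball_eq {E : Type*} [NormedAddCommGroup E] (Λ : AddSubgroup E)
    [DiscreteTopology Λ] (a : E) : ∃ r > 0, ∀ l ∈ Λ, ‖l - a‖ < r → l = a := by
  have hc : IsClosed (Λ : Set E) := Λ.isClosed_of_discrete
  by_cases ha : a ∈ Λ
  · obtain ⟨U, hU, hUa⟩ := isOpen_induced_iff.1 (isOpen_discrete ({⟨a, ha⟩} : Set Λ))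
    have haU : a ∈ U := by
      have : (⟨a, ha⟩ : Λ) ∈ ((↑) ⁻¹' U : Set Λ) := by rw [hUa]; rfl
      exact this
    obtain ⟨r, hr, hrU⟩ := Metric.isOpen_iff.1 hU a haU
    refine ⟨r, hr, fun l hl h => ?_⟩
    have : (⟨l, hl⟩ : Λ) ∈ ((↑) ⁻¹' U : Set Λ) := hrU (by simpa [dist_eq_norm] using h)
    rw [hUa] at this
    exact congrArg Subtype.val this
  · obtain ⟨r, hr, hrU⟩ := Metric.isOpen_iff.1 hc.isOpen_compl a ha
    exact ⟨r, hr, fun l hl h => absurd hl (hrU (by simpa [dist_eq_norm] using h))⟩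

section Covering

variable {E Y : Type*} [NormedAddCommGroup E] [TopologicalSpace Y] {Λ : AddSubgroup E}
  {κ : E → Y} (hκ : IsQuotientMap κ) (hκ' : ∀ z w, κ z = κ w ↔ w - z ∈ Λ ∨ w + z ∈ Λ)
  {L : AddSubgroup Λ} (hL : ∀ l : Λ, l + l ∈ L) {c : E} (hc : c ∈ Λ)

include hκ' hc in
omit [TopologicalSpace Y] in
theorem map_eq_of_mk_eq {z w : E}
    (h : (ReflectionQuotient.mk z : ReflectionQuotient L c) = .mk w) : κ z = κ w := by
  rw [hκ']
  rcases ReflectionQuotient.mk_eq_mk.1 h with ⟨l, hl, rfl⟩ | ⟨l, hl, rfl⟩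
  · left; simp
  · right
    rw [show c - z + l + z = c + l by abel]
    exact add_mem hc l.2

/-- The map from the quotient by a subgroup generated by reflections to the Kummer quotient. -/
def ReflectionQuotient.toKummer : ReflectionQuotient L c → Y :=
  Quotient.lift κ fun _ _ h => map_eq_of_mk_eq hκ' hc (L := L) (Quotient.sound h)

include hκ hL in
theorem isCoveringMapOn_toKummer [DiscreteTopology Λ] :
    IsCoveringMapOn (ReflectionQuotient.toKummer hκ' hc : ReflectionQuotient L c → Y)
      (κ '' {z | ∀ h : z + z - c ∈ Λ, ⟨z + z - c, h⟩ ∈ L}) := by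
  let _ : AddAction (Λ ⧸ L) (ReflectionQuotient L c) := ReflectionQuotient.addAction hL
  have hvadd : ∀ (l : Λ) (z : E), (l : Λ ⧸ L) +ᵥ (.mk z : ReflectionQuotient L c) = .mk (l + z) :=
    fun _ _ => rfl
  have hf : IsQuotientMap (ReflectionQuotient.toKummer hκ' hc : ReflectionQuotient L c → Y) :=
    IsQuotientMap.of_comp ReflectionQuotient.isQuotientMap_mk.continuous
      (hκ.continuous.quotient_lift _) hκ
  have : ContinuousConstVAdd (Λ ⧸ L) (ReflectionQuotient L c) := by
    refine ⟨fun g => ?_⟩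
    obtain ⟨l, rfl⟩ := QuotientAddGroup.mk_surjective g
    rw [ReflectionQuotient.isQuotientMap_mk.continuous_iff]
    exact ReflectionQuotient.isQuotientMap_mk.continuous.comp (continuous_const_add (l : E))
  refine (hf.isCoveringMapOn_of_vadd_disjoint (G := Λ ⧸ L) ?_ ?_).mono ?_
  · intro e₁ e₂
    obtain ⟨z, rfl⟩ := ReflectionQuotient.mk_surjective e₁
    obtain ⟨w, rfl⟩ := ReflectionQuotient.mk_surjective e₂
    constructor
    · intro h
      rcases (hκ' w z).1 h.symm with h | h
      · exact ⟨((⟨z - w, h⟩ : Λ) : Λ ⧸ L), by simp only [hvadd]; simp⟩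
      · refine ⟨((⟨c - (z + w), sub_mem hc h⟩ : Λ) : Λ ⧸ L), ?_⟩
        simp only [hvadd]
        exact ReflectionQuotient.mk_eq_mk.2 (.inr ⟨0, zero_mem _, by push_cast; abel⟩)
    · rintro ⟨g, h⟩
      obtain ⟨l, rfl⟩ := QuotientAddGroup.mk_surjective g
      simp only [hvadd] at h
      refine (map_eq_of_mk_eq hκ' hc h).symm.trans ((hκ' _ _).2 ?_)
      left
      rw [show w - (l + w) = -l by abel]
      exact neg_mem l.2
  · intro e
    obtain ⟨z, rfl⟩ := ReflectionQuotient.mk_surjective e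
    obtain ⟨r, hr, h1⟩ := Λ.exists_ball_eq 0
    obtain ⟨s, hs, h2⟩ := Λ.exists_ball_eq (z + z)
    refine ⟨_, ReflectionQuotient.isOpenMap_mk.image_mem_nhds
      (Metric.ball_mem_nhds z (by positivity : 0 < min r s / 2)), ?_⟩
    rintro g ⟨_, ⟨_, ⟨w, hw, rfl⟩, rfl⟩, ⟨v, hv, hvw⟩⟩
    obtain ⟨l, rfl⟩ := QuotientAddGroup.mk_surjective g
    simp only [hvadd] at hvw ⊢
    rw [mem_ball_iff_norm] at hw hv
    have hr' := min_le_left r s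
    have hs' := min_le_right r s
    rcases ReflectionQuotient.mk_eq_mk.1 hvw with ⟨m, hm, h⟩ | ⟨m, hm, h⟩
    · have h3 := h1 (l - m) (l - m).2 (by
        rw [show (l - m : E) = l + w - m - w by abel, h]
        calc ‖v + m - m - w - 0‖ = ‖(v - z) - (w - z)‖ := by congr 1; abel
          _ ≤ ‖v - z‖ + ‖w - z‖ := norm_sub_le _ _
          _ < r := by linarith)
      refine ReflectionQuotient.mk_eq_mk.2 (.inl ⟨-m, neg_mem hm, ?_⟩)
      have h3' : (l : E) - m = 0 := by simpa using h3
      push_cast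
      rw [sub_eq_zero.1 h3']
      abel
    · have h4 : (c + m - l : E) = v + w := by
        rw [show (c + m - l : E) = c - v + m + v - l by abel, ← h]; abel
      have h3 := h2 (c + m - l) (sub_mem (add_mem hc m.2) l.2) (by
        rw [h4]
        calc ‖v + w - (z + z)‖ = ‖(v - z) + (w - z)‖ := by congr 1; abel
          _ ≤ ‖v - z‖ + ‖w - z‖ := norm_add_le _ _
          _ < s := by linarith)
      refine ReflectionQuotient.mk_eq_mk.2 (.inr ⟨m, hm, ?_⟩)
      rw [show c - (l + z) + m = (c + m - l) - z by abel, h3]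
      abel
  · rintro _ ⟨z, hz, rfl⟩
    refine ⟨.mk z, ?_, rfl⟩
    rw [Set.mem_ofPred_eq, eq_bot_iff]
    intro g hg
    obtain ⟨l, rfl⟩ := QuotientAddGroup.mk_surjective g
    rw [AddAction.mem_stabilizer_iff, hvadd] at hg
    rw [AddSubgroup.mem_bot, QuotientAddGroup.eq_zero_iff]
    rcases ReflectionQuotient.mk_eq_mk.1 hg with ⟨m, hm, h⟩ | ⟨m, hm, h⟩
    · have : l = -m := by
        ext1
        push_cast
        rw [eq_neg_iff_add_eq_zero]
        have h5 : (l : E) + m = (l + z + m) - z := by abel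
        rw [h5, ← h, sub_self]
      rw [this]
      exact neg_mem hm
    · have h6 : z + z - c = ((m - l : Λ) : E) := by
        nth_rewrite 1 [h]
        push_cast
        abel
      have h7 := hz (h6 ▸ (m - l).2)
      have h8 : (⟨z + z - c, h6 ▸ (m - l).2⟩ : Λ) = m - l := Subtype.ext h6
      rw [h8] at h7
      have := sub_mem hm h7
      simpa using this

include hκ hκ' hL hc in
theorem mem_of_imageClass_eq_refl [DiscreteTopology Λ] {X : Type*} [TopologicalSpace X]
    {π : C(((halfLattice Λ)ᶜ : Set E), X)} {b : X → Y} (hb : Continuous b)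
    (hbπ : ∀ z, b (π z) = κ z)
    (hbX : ∀ x, b x ∈ κ '' {z | ∀ h : z + z - c ∈ Λ, ⟨z + z - c, h⟩ ∈ L})
    {z w : ((halfLattice Λ)ᶜ : Set E)} (δ : Path z w) (hz : π w = π z)
    (hδ : imageClass π δ rfl hz = .refl (π z)) {l : Λ} (hl : (w : E) = z + l) : l ∈ L := by
  let s : Set Y := κ '' {z | ∀ h : z + z - c ∈ Λ, ⟨z + z - c, h⟩ ∈ L}
  let f : ReflectionQuotient L c → Y := ReflectionQuotient.toKummer hκ' hc
  have hcov : IsCoveringMap (s.restrictPreimage f) :=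
    (isCoveringMapOn_toKummer hκ hκ' hL hc).isCoveringMap_restrictPreimage
  let b' : C(X, s) := ⟨fun x => ⟨b x, hbX x⟩, by fun_prop⟩
  have hfs : ∀ v : ((halfLattice Λ)ᶜ : Set E),
      (ReflectionQuotient.mk (v : E) : ReflectionQuotient L c) ∈ f ⁻¹' s := fun v => by
    change κ v ∈ s
    rw [← hbπ]
    exact hbX _
  let g : C(((halfLattice Λ)ᶜ : Set E), f ⁻¹' s) := ⟨fun v => ⟨.mk (v : E), hfs v⟩, by
    have := (ReflectionQuotient.isQuotientMap_mk (L := L) (c := c)).continuous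
    fun_prop⟩
  have hgb : ∀ v, s.restrictPreimage f (g v) = b' (π v) := fun v => Subtype.ext (hbπ v).symm
  have key := hcov.monodromy_eq_of_map_eq (x := b' (π z)) (y := b' (π z))
    (γ := .refl _) (ex := ⟨g z, hgb z⟩) (ey := ⟨g w, (hgb w).trans (congrArg b' hz)⟩)
    (.mk (δ.map g.continuous)) ?_
  · rw [hcov.monodromy_refl] at key
    have h := congrArg (fun e => (e.1.1 : ReflectionQuotient L c)) key
    rcases ReflectionQuotient.mk_eq_mk.1 h with ⟨m, hm, h⟩ | ⟨m, hm, h⟩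
    · rw [hl] at h
      rwa [Subtype.ext (add_left_cancel h)]
    · exfalso
      apply z.2
      have : (z + z : E) = c + m - l := by
        rw [show (z + z : E) = (z + l) + z - l by abel, ← hl, h]
        abel
      change (z + z : E) ∈ Λ
      rw [this]
      exact sub_mem (add_mem hc m.2) l.2
  · rw [imageClass, ← Path.Homotopic.Quotient.mk_refl] at hδ
    have h := (Path.Homotopic.Quotient.eq.1 hδ).map b'
    have h' := h.pathCast (hgb z) ((hgb w).trans (congrArg b' hz))
    have he : (((δ.map π.continuous).cast rfl hz.symm).map b'.continuous).cast (hgb z)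
        ((hgb w).trans (congrArg b' hz)) = (δ.map g.continuous).map hcov.continuous := by
      ext t
      exact congrArg Subtype.val (hgb (δ t)).symm
    exact (Path.Homotopic.Quotient.eq (p := (δ.map g.continuous).map hcov.continuous)
      (q := (Path.refl (b' (π z))).cast (hgb z) ((hgb w).trans (congrArg b' hz)))).2
      (he ▸ h')

end Covering

end

section

section EvenAnalytic

open scoped ENNReal NNReal

variable {ι : Type*} [Fintype ι]

/-- Interleaving a family of pairs of indices. -/
def interleave (m : ℕ) : (Fin m → ι × ι) ≃ (Fin (m * 2) → ι) :=
  (Equiv.arrowCongr (Equiv.refl _) (finTwoArrowEquiv ι).symm).trans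
    ((Equiv.curry _ _ _).symm.trans (Equiv.arrowCongr finProdFinEquiv (Equiv.refl _)))

omit [Fintype ι] in
theorem prod_interleave {m : ℕ} (r : Fin m → ι × ι) (z : ι → ℂ) :
    ∏ k, z (interleave m r k) = ∏ i, z (r i).1 * z (r i).2 := by
  rw [← finProdFinEquiv.prod_comp, Fintype.prod_prod_type]
  refine Finset.prod_congr rfl fun i _ => ?_
  simp [interleave, Fin.prod_univ_two, Equiv.curry, Equiv.arrowCongr]

variable [DecidableEq ι]

/-- The series in the pairwise products of the coordinates whose `m`-th term is the term of degree
`2m` of a given power series. -/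
def pairSeries (p : FormalMultilinearSeries ℂ (ι → ℂ) ℂ) :
    FormalMultilinearSeries ℂ (ι × ι → ℂ) ℂ := fun m =>
  ∑ r : Fin m → ι × ι, p (m * 2) (fun k => Pi.single (interleave m r k) 1) •
    (ContinuousMultilinearMap.mkPiAlgebra ℂ (Fin m) ℂ).compContinuousLinearMap
      fun i => ContinuousLinearMap.proj (R := ℂ) (φ := fun _ : ι × ι => ℂ) (r i)

theorem pairSeries_apply (p : FormalMultilinearSeries ℂ (ι → ℂ) ℂ) (m : ℕ) (z : ι → ℂ) :
    pairSeries p m (fun _ ij => z ij.1 * z ij.2) = p (m * 2) fun _ => z := by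
  have h1 : (p (m * 2) fun _ => z) = p (m * 2) fun _ => ∑ i, z i • Pi.single i (1 : ℂ) := by
    congr 1
    ext k i
    simp [Finset.sum_apply, Pi.single_apply]
  have h2 := (p (m * 2)).toMultilinearMap.map_sum (fun _ i => z i • Pi.single i (1 : ℂ))
  simp only [ContinuousMultilinearMap.coe_coe] at h2
  rw [h1, h2, ← (interleave m).sum_comp, pairSeries, _root_.sum_apply]
  refine Finset.sum_congr rfl fun r _ => ?_
  have h3 := (p (m * 2)).map_smul_univ (fun k => z (interleave m r k))
    (fun k => Pi.single (interleave m r k) (1 : ℂ))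
  rw [h3, prod_interleave]
  simp [mul_comm]

theorem norm_pairSeries_le (p : FormalMultilinearSeries ℂ (ι → ℂ) ℂ) (m : ℕ) :
    ‖pairSeries p m‖ ≤ (Fintype.card ι ^ 2 : ℝ) ^ m * ‖p (m * 2)‖ := by
  refine (norm_sum_le _ _).trans ((Finset.sum_le_card_nsmul _ _ ‖p (m * 2)‖ fun r _ => ?_).trans ?_)
  · rw [norm_smul, ← mul_one ‖p (m * 2)‖]
    gcongr
    · refine ((p (m * 2)).le_opNorm _).trans ?_
      simp [Pi.norm_single]
    · refine (ContinuousMultilinearMap.norm_compContinuousLinearMap_le _ _).trans ?_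
      rw [ContinuousMultilinearMap.norm_mkPiAlgebra, one_mul]
      refine Finset.prod_le_one (fun _ _ => norm_nonneg _) fun i _ => ?_
      exact ContinuousLinearMap.opNorm_le_bound _ zero_le_one fun v => by
        simpa using norm_le_pi_norm v (r i)
  · simp [sq]

theorem pairSeries_radius_pos {p : FormalMultilinearSeries ℂ (ι → ℂ) ℂ} (hp : 0 < p.radius) :
    0 < (pairSeries p).radius := by
  obtain ⟨r, hr0, hr⟩ := ENNReal.lt_iff_exists_nnreal_btwn.1 hp
  obtain ⟨C, hC, hpC⟩ := p.norm_mul_pow_le_of_lt_radius hr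
  have hr0' : 0 < r := by exact_mod_cast hr0
  let ρ : ℝ≥0 := r ^ 2 / (Fintype.card ι ^ 2 + 1)
  have hρ : 0 < ρ := by positivity
  refine lt_of_lt_of_le (by exact_mod_cast hρ) ((pairSeries p).le_radius_of_bound C (r := ρ) ?_)
  intro m
  refine le_trans ?_ (hpC (m * 2))
  calc ‖pairSeries p m‖ * (ρ : ℝ) ^ m
      ≤ (Fintype.card ι ^ 2 : ℝ) ^ m * ‖p (m * 2)‖ * (ρ : ℝ) ^ m := by
        gcongr; exact norm_pairSeries_le p m
    _ = ‖p (m * 2)‖ * (Fintype.card ι ^ 2 * ρ : ℝ) ^ m := by rw [mul_pow]; ring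
    _ ≤ ‖p (m * 2)‖ * ((r : ℝ) ^ 2) ^ m := by
        gcongr
        simp only [ρ]
        push_cast
        rw [← mul_div_assoc, div_le_iff₀ (by positivity)]
        nlinarith [sq_nonneg (r : ℝ)]
    _ = ‖p (m * 2)‖ * (r : ℝ) ^ (m * 2) := by rw [← pow_mul, mul_comm 2]

omit [DecidableEq ι] in
/-- Near the origin, an even analytic function is an affine combination of the pairwise products
of the coordinates with coefficients that are analytic functions of these products. -/
theorem AnalyticAt.exists_pair_of_even {f : (ι → ℂ) → ℂ} (hf : AnalyticAt ℂ f 0)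
    (heven : ∀ᶠ z in 𝓝 0, f (-z) = f z) :
    ∃ A : ι × ι → (ι × ι → ℂ) → ℂ, (∀ ij, AnalyticAt ℂ (A ij) 0) ∧
      ∀ᶠ z in 𝓝 0, f z = f 0 + ∑ ij : ι × ι, z ij.1 * z ij.2 * A ij fun kl => z kl.1 * z kl.2 := by
  classical
  obtain ⟨p, R, hp⟩ := hf
  have hpos : 0 < (pairSeries p).radius :=
    pairSeries_radius_pos (lt_of_lt_of_le hp.r_pos hp.r_le)
  have hq := (pairSeries p).hasFPowerSeriesOnBall hpos
  have hs := (pairSeries p).shift.hasFPowerSeriesOnBall (by rwa [(pairSeries p).radius_shift])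
  rw [(pairSeries p).radius_shift] at hs
  set A := (pairSeries p).shift.sum with hA
  refine ⟨fun ij M => A M (Pi.single ij 1), fun ij => ?_, ?_⟩
  · exact (ContinuousLinearMap.apply ℂ ℂ (Pi.single ij (1 : ℂ))).analyticAt _ |>.comp
      hs.analyticAt
  have hcont : Tendsto (fun z : ι → ℂ => fun ij : ι × ι => z ij.1 * z ij.2) (𝓝 0) (𝓝 0) := by
    have : Continuous (fun z : ι → ℂ => fun ij : ι × ι => z ij.1 * z ij.2) := by fun_prop
    simpa [Pi.zero_def] using this.tendsto 0
  filter_upwards [heven, Metric.eball_mem_nhds (0 : ι → ℂ) hp.r_pos,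
    hcont (Metric.eball_mem_nhds (0 : ι × ι → ℂ) hpos)] with z hz hzR hzq
  set M : ι × ι → ℂ := fun ij => z ij.1 * z ij.2 with hM
  have h1 : HasSum (fun n => p n fun _ => z) (f z) := by simpa using hp.hasSum hzR
  have h2 : HasSum (fun n => p n fun _ => -z) (f z) := by
    rw [← hz]
    have : -z ∈ Metric.eball (0 : ι → ℂ) R := by
      simpa [Metric.mem_eball, edist_zero_right] using hzR
    simpa using hp.hasSum this
  have hneg : ∀ n, (p n fun _ => -z) = (-1) ^ n * p n fun _ => z := fun n => by
    simpa using (p n).map_smul_univ (fun _ => (-1 : ℂ)) fun _ => z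
  have h3 : HasSum (fun m => p (m * 2) fun _ => z) (f z) := by
    have h4 := (h1.add h2).mul_left (1 / 2 : ℂ)
    rw [← two_mul, ← mul_assoc, one_div_mul_cancel two_ne_zero, one_mul,
      ← (mul_left_injective₀ two_ne_zero :
        Function.Injective (fun m : ℕ => m * 2)).hasSum_iff] at h4
    · refine (congrArg (HasSum · (f z)) (funext fun m => ?_)).mp h4
      simp only [Function.comp_apply, hneg, pow_mul', even_two, Even.neg_pow, one_pow]
      ring
    · intro n hn
      have hn' : Odd n := by
        rw [← Nat.not_even_iff_odd]
        rintro ⟨m, rfl⟩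
        exact hn ⟨m, by simp; ring⟩
      simp [hneg, hn'.neg_one_pow]
  have h5 : HasSum (fun m => pairSeries p m fun _ => M) (f z) := by
    simpa only [hM, pairSeries_apply] using h3
  have h6 : HasSum (fun m => (pairSeries p).shift m fun _ => M) (A M) := by
    simpa using hs.hasSum hzq
  have h7 : HasSum (fun m => pairSeries p (m + 1) fun _ => M) (A M M) := by
    have := (ContinuousLinearMap.apply ℂ ℂ M).hasSum h6
    refine (congrArg (HasSum · (A M M)) (funext fun m => ?_)).mp this
    simp only [ContinuousLinearMap.apply_apply, FormalMultilinearSeries.shift,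
      ContinuousMultilinearMap.curryRight_apply]
    congr 1
    refine funext fun i => ?_
    refine Fin.lastCases ?_ (fun i => ?_) i <;> simp
  have h8 : (pairSeries p 0 fun _ => M) = f 0 := by
    rw [← hp.coeff_zero (fun _ => z), hM, pairSeries_apply]
  have h9 := h5.unique ((hasSum_nat_add_iff 1).1 h7)
  rw [Finset.sum_range_one, h8] at h9
  rw [h9, add_comm]
  congr 1
  have hMs : M = ∑ ij, M ij • Pi.single ij (1 : ℂ) := by
    ext ij
    simp [Finset.sum_apply, Pi.single_apply]
  conv_lhs => rw [hMs]
  rw [map_sum]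
  refine Finset.sum_congr rfl fun ij _ => ?_
  rw [map_smul, ← hMs, smul_eq_mul]

end EvenAnalytic

end

section

namespace SingularKummer

variable (Λ : Submodule ℤ (Fin 2 → ℂ))

/-- The composite `ℂ² → T → Y` of the two quotient maps. -/
def ofPoint (z : Fin 2 → ℂ) : SingularKummer Λ := proj Λ (QuotientAddGroup.mk z)

variable {Λ}

theorem ofPoint_eq_iff {z w : Fin 2 → ℂ} :
    ofPoint Λ z = ofPoint Λ w ↔ w - z ∈ Λ.toAddSubgroup ∨ w + z ∈ Λ.toAddSubgroup := by
  have h1 : ofPoint Λ z = ofPoint Λ w ↔ ∃ u : ℤˣ, u • (w : CTorus Λ) = (z : CTorus Λ) := by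
    unfold ofPoint proj
    rw [Quotient.eq, MulAction.orbitRel_apply, MulAction.mem_orbit_iff]
  rw [h1]
  constructor
  · rintro ⟨u, hu⟩
    rcases Int.units_eq_one_or u with rfl | rfl
    · left
      rw [one_smul, eq_comm, QuotientAddGroup.eq] at hu
      rwa [sub_eq_neg_add]
    · right
      rw [Units.smul_def, Units.val_neg, Units.val_one, neg_one_smul, ← QuotientAddGroup.mk_neg,
        QuotientAddGroup.eq, neg_neg] at hu
      exact hu
  · rintro (h | h)
    · refine ⟨1, ?_⟩
      rw [one_smul, eq_comm, QuotientAddGroup.eq]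
      rwa [← sub_eq_neg_add]
    · refine ⟨-1, ?_⟩
      rw [Units.smul_def, Units.val_neg, Units.val_one, neg_one_smul, ← QuotientAddGroup.mk_neg,
        QuotientAddGroup.eq, neg_neg]
      exact h

theorem isQuotientMap_proj : IsQuotientMap (proj Λ) := isQuotientMap_quot_mk

theorem isQuotientMap_ofPoint : IsQuotientMap (ofPoint Λ) :=
  isQuotientMap_proj.comp isQuotientMap_quot_mk

theorem continuous_ofPoint : Continuous (ofPoint Λ) := isQuotientMap_ofPoint.continuous

theorem ofPoint_surjective : Function.Surjective (ofPoint Λ) := isQuotientMap_ofPoint.surjective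

theorem isOpenMap_ofPoint : IsOpenMap (ofPoint Λ) := by
  intro U hU
  rw [← isQuotientMap_ofPoint.isOpen_preimage]
  have : ofPoint Λ ⁻¹' (ofPoint Λ '' U) =
      ⋃ l : Λ, ((fun z => z + (l : Fin 2 → ℂ)) ⁻¹' U ∪ (fun z => (l : Fin 2 → ℂ) - z) ⁻¹' U) := by
    ext z
    simp only [Set.mem_preimage, Set.mem_image, Set.mem_iUnion, Set.mem_union]
    constructor
    · rintro ⟨w, hw, h⟩
      rcases ofPoint_eq_iff.1 h.symm with h | h
      · exact ⟨⟨_, h⟩, .inl (by simpa using hw)⟩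
      · exact ⟨⟨_, h⟩, .inr (by simpa using hw)⟩
    · rintro ⟨l, h | h⟩
      · exact ⟨_, h, (ofPoint_eq_iff.2 (.inl (by simp))).symm⟩
      · exact ⟨_, h, (ofPoint_eq_iff.2 (.inr (by simp))).symm⟩
  rw [this]
  exact isOpen_iUnion fun l => (hU.preimage (by fun_prop)).union (hU.preimage (by fun_prop))

theorem analyticAt_comp_of_ofPoint_eq {f : SingularKummer Λ → ℂ} {z w : Fin 2 → ℂ}
    (h : ofPoint Λ z = ofPoint Λ w) (hf : AnalyticAt ℂ (f ∘ ofPoint Λ) z) :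
    AnalyticAt ℂ (f ∘ ofPoint Λ) w := by
  rcases ofPoint_eq_iff.1 h with h | h
  · have h1 : f ∘ ofPoint Λ = (f ∘ ofPoint Λ) ∘ fun v => v - (w - z) := by
      ext v
      refine congrArg f (ofPoint_eq_iff.2 (.inl ?_))
      rw [show v - (w - z) - v = -(w - z) by abel]
      exact neg_mem h
    rw [h1]
    refine AnalyticAt.comp (by simpa using hf) (by fun_prop)
  · have h1 : f ∘ ofPoint Λ = (f ∘ ofPoint Λ) ∘ fun v => (w + z) - v := by
      ext v
      refine congrArg f (ofPoint_eq_iff.2 (.inr ?_))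
      rwa [sub_add_cancel]
    rw [h1]
    refine AnalyticAt.comp (by simpa using hf) (by fun_prop)

theorem mem_hol_iff {f : SingularKummer Λ → ℂ} {z : Fin 2 → ℂ} :
    f ∈ (holStructure Λ).hol (ofPoint Λ z) ↔ AnalyticAt ℂ (f ∘ ofPoint Λ) z := by
  constructor
  · intro h
    exact (h.self_of_nhds _ rfl).self_of_nhds _ rfl
  · intro h
    have h1 : ∀ᶠ y in 𝓝 (ofPoint Λ z), ∀ w, ofPoint Λ w = y → AnalyticAt ℂ (f ∘ ofPoint Λ) w := by
      have h2 := (isOpenMap_ofPoint (Λ := Λ)).image_mem_nhds h.eventually_analyticAt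
      filter_upwards [h2]
      rintro _ ⟨v, hv, rfl⟩ w hw
      exact analyticAt_comp_of_ofPoint_eq hw.symm hv
    have h3 : ∀ᶠ y in 𝓝 (ofPoint Λ z), ∀ t, proj Λ t = y →
        f ∘ proj Λ ∈ (CTorus.holStructure Λ).hol t := by
      filter_upwards [h1.eventually_nhds] with y hy t ht
      subst ht
      have h4 : ∀ᶠ t' in 𝓝 t, ∀ w, QuotientAddGroup.mk w = t' →
          f ∘ ofPoint Λ ∈ (HolStructure.ofNormed (Fin 2 → ℂ)).hol w := by
        filter_upwards [isQuotientMap_proj.continuous.continuousAt.eventually hy] with t' ht' w hw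
        exact ht' w (congrArg (proj Λ) hw)
      exact h4
    exact h3

section Discrete

variable [DiscreteTopology Λ]

theorem exists_ball_ofPoint_eq (c : Fin 2 → ℂ) : ∃ r > 0, ∀ z ∈ Metric.ball c r,
    ∀ w ∈ Metric.ball c r, ofPoint Λ z = ofPoint Λ w →
      w = z ∨ w = c + c - z ∧ c ∈ halfLattice Λ.toAddSubgroup := by
  obtain ⟨r, hr, h1⟩ := Λ.toAddSubgroup.exists_ball_eq 0
  obtain ⟨s, hs, h2⟩ := Λ.toAddSubgroup.exists_ball_eq (c + c)
  refine ⟨min r s / 2, by positivity, fun z hz w hw h => ?_⟩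
  rw [mem_ball_iff_norm] at hz hw
  have hr' := min_le_left r s
  have hs' := min_le_right r s
  rcases ofPoint_eq_iff.1 h with h | h
  · left
    rw [← sub_eq_zero]
    refine h1 _ h ?_
    calc ‖w - z - 0‖ = ‖(w - c) - (z - c)‖ := by congr 1; abel
      _ ≤ ‖w - c‖ + ‖z - c‖ := norm_sub_le _ _
      _ < r := by linarith
  · right
    have h3 := h2 _ h (by
      calc ‖w + z - (c + c)‖ = ‖(w - c) + (z - c)‖ := by congr 1; abel
        _ ≤ ‖w - c‖ + ‖z - c‖ := norm_add_le _ _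
        _ < s := by linarith)
    exact ⟨by rw [← h3]; abel, show c + c ∈ _ from h3 ▸ h⟩

/-- A chart of the Kummer surface around the image of a point outside `½Λ`. -/
theorem exists_chart {c : Fin 2 → ℂ} (hc : c ∉ halfLattice Λ.toAddSubgroup) :
    ∃ e : OpenPartialHomeomorph (Fin 2 → ℂ) (SingularKummer Λ), c ∈ e.source ∧
      ⇑e = ofPoint Λ := by
  obtain ⟨r, hr, h⟩ := exists_ball_ofPoint_eq (Λ := Λ) c
  have hinj : Set.InjOn (ofPoint Λ) (Metric.ball c r) := fun z hz w hw hzw =>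
    ((h z hz w hw hzw).resolve_right fun h => hc h.2).symm
  exact ⟨OpenPartialHomeomorph.ofContinuousOpen (hinj.toPartialEquiv _ _)
    continuous_ofPoint.continuousOn isOpenMap_ofPoint Metric.isOpen_ball,
    Metric.mem_ball_self hr, rfl⟩

theorem ofPoint_mem_regularLocus {c : Fin 2 → ℂ} (hc : c ∉ halfLattice Λ.toAddSubgroup) :
    ofPoint Λ c ∈ (holStructure Λ).regularLocus := by
  obtain ⟨e, hce, he⟩ := exists_chart hc
  refine ⟨2, e.symm, he ▸ e.map_source hce, fun y hy f => ?_⟩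
  have hy' : ofPoint Λ (e.symm y) = y := by rw [← he]; exact e.right_inv hy
  rw [e.symm_symm, he]
  nth_rewrite 1 [← hy']
  exact mem_hol_iff

omit [DiscreteTopology Λ] in
/-- A function on a small ball that is even about the centre descends to the Kummer surface. -/
theorem exists_descend {c : Fin 2 → ℂ} {r : ℝ} (hr : ∀ z ∈ Metric.ball c r,
    ∀ w ∈ Metric.ball c r, ofPoint Λ z = ofPoint Λ w →
      w = z ∨ w = c + c - z ∧ c ∈ halfLattice Λ.toAddSubgroup) {F : (Fin 2 → ℂ) → ℂ}
    (hF : ∀ z, F (c + c - z) = F z) :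
    ∃ u : SingularKummer Λ → ℂ, ∀ z ∈ Metric.ball c r, u (ofPoint Λ z) = F z := by
  refine ⟨fun y => F (Function.invFunOn (ofPoint Λ) (Metric.ball c r) y), fun z hz => ?_⟩
  have hex : ∃ w ∈ Metric.ball c r, ofPoint Λ w = ofPoint Λ z := ⟨z, hz, rfl⟩
  rcases hr z hz _ (Function.invFunOn_mem hex) (Function.invFunOn_eq hex).symm with h | h
  · simp only [h]
  · simp only [h.1, hF]

end Discrete

end SingularKummer

theorem AnalyticAt.isBigO_sq_of_fderiv_eq_zero {E : Type*} [NormedAddCommGroup E]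
    [NormedSpace ℂ E] {V : E → ℂ} {b : E} (hV : AnalyticAt ℂ V b) (h0 : V b = 0)
    (h1 : fderiv ℂ V b = 0) : V =O[𝓝 b] fun y => ‖y - b‖ ^ 2 := by
  obtain ⟨p, hp⟩ := hV
  have h := hp.isBigO_sub_partialSum_pow 2
  have h2 : Tendsto (fun y => y - b) (𝓝 b) (𝓝 0) := by
    simpa using (continuous_sub_right b).tendsto b
  have h3 := h.comp_tendsto h2
  refine h3.congr' ?_ (.of_forall fun y => by simp)
  refine .of_forall fun y => ?_
  have h4 : (p 1) (fun _ => y - b) = 0 := by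
    have := hp.fderiv_eq
    rw [h1] at this
    have h6 := (congrArg (fun L => L (y - b)) this).symm
    simp only [continuousMultilinearCurryFin1_apply, zero_apply] at h6
    convert h6 using 2
    ext i
    fin_cases i
    rfl
  have h5 : p 0 (fun _ => y - b) = 0 := by rw [hp.coeff_zero, h0]
  simp [FormalMultilinearSeries.partialSum, Finset.sum_range_succ, h4, h5]

/-- The derivative of an even function vanishes at the centre. -/
theorem isLittleO_of_even {E F : Type*} [NormedAddCommGroup E] [NormedSpace ℂ E]
    [NormedAddCommGroup F] [NormedSpace ℂ F] {ζ : E → F} {c : E} (hζ : DifferentiableAt ℂ ζ c)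
    (heven : ∀ z, ζ (c + c - z) = ζ z) :
    (fun z => ζ z - ζ c) =o[𝓝 c] fun z => z - c := by
  have h1 := hζ.hasFDerivAt
  have h2 : HasFDerivAt (fun z => c + c - z) (-ContinuousLinearMap.id ℂ E) c :=
    (hasFDerivAt_id c).const_sub _
  have h3 : HasFDerivAt ζ ((fderiv ℂ ζ c).comp (-ContinuousLinearMap.id ℂ E)) c := by
    have h1' : HasFDerivAt ζ (fderiv ℂ ζ c) (c + c - c) := by simpa using h1
    have := h1'.comp c h2
    exact this.congr_of_eventuallyEq (.of_forall fun z => (heven z).symm)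
  have h4 : fderiv ℂ ζ c = 0 := by
    have h5 := h1.unique h3
    ext v
    have h6 := congrArg (fun L => L v) h5
    simp only [ContinuousLinearMap.comp_apply, neg_apply,
      ContinuousLinearMap.id_apply, map_neg] at h6
    have h7 : (2 : ℂ) • fderiv ℂ ζ c v = 0 := by
      rw [two_smul]
      nth_rewrite 1 [h6]
      exact neg_add_cancel _
    simpa using h7
  rw [h4] at h1
  simpa using h1.isLittleO

theorem analyticAt_sub_mul_sub {ι : Type*} [Fintype ι] (c : ι → ℂ) (i j : ι) (w : ι → ℂ) :
    AnalyticAt ℂ (fun z : ι → ℂ => (z i - c i) * (z j - c j)) w := by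
  have h : ∀ i, AnalyticAt ℂ (fun z : ι → ℂ => z i) w := fun i =>
    (ContinuousLinearMap.proj (R := ℂ) (φ := fun _ : ι => ℂ) i).analyticAt w
  exact ((h i).sub analyticAt_const).mul ((h j).sub analyticAt_const)

section QuadraticChart

variable {G : Type*} [NormedAddCommGroup G] [NormedSpace ℂ G] {ζ : (Fin 2 → ℂ) → G}
  {c : Fin 2 → ℂ}

theorem eq_zero_of_fderiv_eq_zero (hζc : ContinuousAt ζ c)
    (hlittle : (fun z => ζ z - ζ c) =o[𝓝 c] fun z => z - c) {V : G → ℂ}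
    (hVa : AnalyticAt ℂ V (ζ c)) (hV0 : V (ζ c) = 0) (hV1 : fderiv ℂ V (ζ c) = 0) {α β : ℂ}
    (hV : ∀ᶠ z in 𝓝 c, V (ζ z) =
      (z 0 - c 0) * (α * (z 0 - c 0) + β * (z 1 - c 1))) : α = 0 ∧ β = 0 := by
  have h1 : (fun z => V (ζ z)) =o[𝓝 c] fun z => ‖z - c‖ ^ 2 :=
    ((hVa.isBigO_sq_of_fderiv_eq_zero hV0 hV1).comp_tendsto hζc).trans_isLittleO
      (hlittle.norm_norm.pow two_pos)
  have h2 : ∀ w : Fin 2 → ℂ, w 0 * (α * w 0 + β * w 1) = 0 := by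
    intro w
    have ht : Tendsto (fun t : ℂ => c + t • w) (𝓝 0) (𝓝 c) := by
      have : Continuous fun t : ℂ => c + t • w := by fun_prop
      simpa using this.tendsto 0
    have h3 := h1.comp_tendsto ht
    have h4 : (fun t : ℂ => t ^ 2 * (w 0 * (α * w 0 + β * w 1))) =o[𝓝 0]
        fun t : ℂ => t ^ 2 := by
      refine (h3.congr' ?_ .rfl).trans_isBigO ?_
      · filter_upwards [ht.eventually hV] with t h5
        simp only [Function.comp_apply, h5, Pi.add_apply, Pi.smul_apply, smul_eq_mul]
        ring
      · refine Asymptotics.IsBigO.of_bound (‖w‖ ^ 2) (.of_forall fun t => ?_)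
        simp [norm_smul, mul_pow, mul_comm]
    have h5 := (h4.mono (nhdsWithin_le_nhds (s := {0}ᶜ))).tendsto_div_nhds_zero
    have h6 : Tendsto (fun _ : ℂ => w 0 * (α * w 0 + β * w 1)) (𝓝[≠] 0) (𝓝 0) := by
      refine h5.congr' ?_
      filter_upwards [self_mem_nhdsWithin] with t ht
      have : t ≠ 0 := ht
      field_simp
    exact tendsto_nhds_unique tendsto_const_nhds h6
  have h3 : α = 0 := by simpa using h2 ![1, 0]
  have h4 : β = 0 := by simpa [h3] using h2 ![1, 1]
  exact ⟨h3, h4⟩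

theorem fderiv_mul_fderiv_eq {U₀ U₁ U₂ : G → ℂ} {b : G} (h₀ : DifferentiableAt ℂ U₀ b)
    (h₁ : DifferentiableAt ℂ U₁ b) (h₂ : DifferentiableAt ℂ U₂ b) (h₀' : U₀ b = 0)
    (h₁' : U₁ b = 0) (h₂' : U₂ b = 0) (hrel : ∀ᶠ v in 𝓝 b, U₀ v * U₂ v = U₁ v ^ 2) (v : G) :
    fderiv ℂ U₀ b v * fderiv ℂ U₂ b v = fderiv ℂ U₁ b v ^ 2 := by
  have hs : ∀ {U : G → ℂ}, DifferentiableAt ℂ U b →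
      Tendsto (fun t : ℂ => t⁻¹ • (U (b + t • v) - U b)) (𝓝[≠] 0) (𝓝 (fderiv ℂ U b v)) :=
    fun hU => (hU.hasFDerivAt.hasLineDerivAt v).tendsto_slope_zero
  have ht : Tendsto (fun t : ℂ => b + t • v) (𝓝 0) (𝓝 b) := by
    have : Continuous fun t : ℂ => b + t • v := by fun_prop
    simpa using this.tendsto 0
  refine tendsto_nhds_unique (((hs h₀).mul (hs h₂)).congr' ?_) ((hs h₁).pow 2)
  filter_upwards [nhdsWithin_le_nhds (ht.eventually hrel)] with t h
  simp only [h₀', h₁', h₂', sub_zero, smul_eq_mul]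
  linear_combination (t⁻¹) ^ 2 * h

/-- There is no chart in which the functions `x²`, `xy`, `y²` become holomorphic. -/
theorem false_of_quadratic_chart (hζc : ContinuousAt ζ c)
    (hlittle : (fun z => ζ z - ζ c) =o[𝓝 c] fun z => z - c) {U : Fin 2 → Fin 2 → G → ℂ}
    (hUa : ∀ i j, AnalyticAt ℂ (U i j) (ζ c)) (hUb : ∀ i j, U i j (ζ c) = 0)
    (hUζ : ∀ i j, ∀ᶠ z in 𝓝 c, U i j (ζ z) = (z i - c i) * (z j - c j))
    (hrel : ∀ᶠ v in 𝓝 (ζ c), U 0 0 v * U 1 1 v = U 0 1 v ^ 2) : False := by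
  have hd := fun i j => (hUa i j).differentiableAt
  have hindep : ∀ α β : ℂ, (∀ v, α * fderiv ℂ (U 0 0) (ζ c) v + β * fderiv ℂ (U 0 1) (ζ c) v = 0) →
      α = 0 ∧ β = 0 := by
    intro α β h
    refine eq_zero_of_fderiv_eq_zero hζc hlittle (V := fun v => α * U 0 0 v + β * U 0 1 v)
      ((analyticAt_const.mul (hUa 0 0)).add (analyticAt_const.mul (hUa 0 1))) (by simp [hUb]) ?_ ?_
    · have h1 := ((hd 0 0).hasFDerivAt.const_mul α).add ((hd 0 1).hasFDerivAt.const_mul β)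
      refine h1.fderiv.trans ?_
      ext v
      simpa using h v
    · filter_upwards [hUζ 0 0, hUζ 0 1] with z h0 h1
      rw [h0, h1]
      ring
  have hquad := fderiv_mul_fderiv_eq (hd 0 0) (hd 0 1) (hd 1 1) (hUb 0 0) (hUb 0 1) (hUb 1 1) hrel
  generalize fderiv ℂ (U 0 0) (ζ c) = L₀ at *
  generalize fderiv ℂ (U 0 1) (ζ c) = L₁ at *
  generalize fderiv ℂ (U 1 1) (ζ c) = L₂ at *
  obtain ⟨v₀, hv₀⟩ : ∃ v, L₀ v ≠ 0 := by
    by_contra! h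
    exact one_ne_zero (hindep 1 0 (by simp [h])).1
  refine hv₀ (neg_eq_zero.1 (hindep (L₁ v₀) (-L₀ v₀) fun v => ?_).2)
  have h := hquad (L₀ v₀ • v - L₀ v • v₀)
  simp only [map_sub, map_smul, smul_eq_mul] at h
  rw [mul_comm (L₀ v), sub_self, zero_mul] at h
  have h' := pow_eq_zero_iff two_ne_zero |>.1 h.symm
  linear_combination -h'

end QuadraticChart

namespace SingularKummer

variable {Λ : Submodule ℤ (Fin 2 → ℂ)} [DiscreteTopology Λ]

omit [DiscreteTopology Λ] in
theorem ofPoint_reflect {c : Fin 2 → ℂ} (hc : c ∈ halfLattice Λ.toAddSubgroup) (z : Fin 2 → ℂ) :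
    ofPoint Λ (c + c - z) = ofPoint Λ z := by
  rw [eq_comm, ofPoint_eq_iff]
  right
  rw [sub_add_cancel]
  exact hc

theorem ofPoint_mem_singularLocus {c : Fin 2 → ℂ} (hc : c ∈ halfLattice Λ.toAddSubgroup) :
    ofPoint Λ c ∈ (holStructure Λ).singularLocus := by
  rintro ⟨n, e, hce, he⟩
  obtain ⟨r, hr, hball⟩ := exists_ball_ofPoint_eq (Λ := Λ) c
  have hsymm : Tendsto e.symm (𝓝 (e (ofPoint Λ c))) (𝓝 (ofPoint Λ c)) := e.tendsto_symm hce
  set ζ : (Fin 2 → ℂ) → Fin n → ℂ := fun z => e (ofPoint Λ z) with hζ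
  set b := ζ c with hb
  have hζa : AnalyticAt ℂ ζ c := by
    refine analyticAt_pi_iff.2 fun i => ?_
    have h1 : (fun y => e y i) ∈ (holStructure Λ).hol (ofPoint Λ c) := by
      rw [he _ hce]
      refine (ContinuousLinearMap.proj (R := ℂ) (φ := fun _ : Fin n => ℂ) i).analyticAt _
        |>.congr ?_
      filter_upwards [e.open_target.mem_nhds (e.map_source hce)] with v hv
      simp [e.right_inv hv]
    exact mem_hol_iff.1 h1
  have hlittle : (fun z => ζ z - b) =o[𝓝 c] fun z => z - c :=
    isLittleO_of_even hζa.differentiableAt fun z => congrArg e (ofPoint_reflect hc z)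
  let F : Fin 2 → Fin 2 → (Fin 2 → ℂ) → ℂ := fun i j z => (z i - c i) * (z j - c j)
  have hF : ∀ i j, ∃ u : SingularKummer Λ → ℂ, ∀ z ∈ Metric.ball c r, u (ofPoint Λ z) = F i j z :=
    fun i j => exists_descend hball fun z => by simp only [F, Pi.sub_apply, Pi.add_apply]; ring
  choose u hu using hF
  have hcball : c ∈ Metric.ball c r := Metric.mem_ball_self hr
  have hballn : Metric.ball c r ∈ 𝓝 c := Metric.ball_mem_nhds c hr
  have hu0 : ∀ i j, u i j (ofPoint Λ c) = 0 := fun i j => by rw [hu i j c hcball]; simp [F]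
  let U : Fin 2 → Fin 2 → (Fin n → ℂ) → ℂ := fun i j => u i j ∘ e.symm
  have hUa : ∀ i j, AnalyticAt ℂ (U i j) b := fun i j => by
    refine (he _ hce _).1 (mem_hol_iff.2 ?_)
    have h1 : AnalyticAt ℂ (F i j) c := analyticAt_sub_mul_sub c i j c
    refine h1.congr ?_
    filter_upwards [hballn] with z hz
    exact (hu i j z hz).symm
  have hUb : ∀ i j, U i j b = 0 := fun i j => by
    simp only [U, hb, hζ, Function.comp_apply, e.left_inv hce, hu0]
  have hUζ : ∀ i j, ∀ᶠ z in 𝓝 c, U i j (ζ z) = F i j z := fun i j => by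
    filter_upwards [hballn, continuous_ofPoint.continuousAt.preimage_mem_nhds
      (e.open_source.mem_nhds hce)] with z hz hz'
    simp only [U, hζ, Function.comp_apply]
    rw [e.left_inv hz', hu i j z hz]
  have hrel : ∀ᶠ v in 𝓝 b, U 0 0 v * U 1 1 v = U 0 1 v ^ 2 := by
    filter_upwards [hsymm ((isOpenMap_ofPoint (Λ := Λ)).image_mem_nhds hballn)]
    rintro v ⟨z, hz, hzv⟩
    simp only [U, Function.comp_apply, ← hzv, hu _ _ z hz, F]
    ring
  exact false_of_quadratic_chart hζa.continuousAt hlittle hUa hUb hUζ hrel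

theorem singularLocus_eq : (holStructure Λ).singularLocus =
    ofPoint Λ '' halfLattice Λ.toAddSubgroup := by
  ext y
  constructor
  · intro hy
    obtain ⟨z, rfl⟩ := ofPoint_surjective y
    by_contra h
    exact hy (ofPoint_mem_regularLocus fun hz => h ⟨z, hz, rfl⟩)
  · rintro ⟨c, hc, rfl⟩
    exact ofPoint_mem_singularLocus hc

omit [DiscreteTopology Λ] in
theorem ofPoint_mem_image_halfLattice_iff {z : Fin 2 → ℂ} :
    ofPoint Λ z ∈ ofPoint Λ '' halfLattice Λ.toAddSubgroup ↔
      z ∈ halfLattice Λ.toAddSubgroup := by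
  refine ⟨?_, fun h => ⟨z, h, rfl⟩⟩
  rintro ⟨c, hc, h⟩
  change z + z ∈ Λ.toAddSubgroup
  rcases ofPoint_eq_iff.1 h with h | h
  · have := add_mem (add_mem h h) hc
    rwa [show z - c + (z - c) + (c + c) = z + z by abel] at this
  · have := sub_mem (add_mem h h) hc
    rwa [show z + c + (z + c) - (c + c) = z + z by abel] at this

end SingularKummer

end

section

namespace HolStructure

section Away

variable {X : Type*} [TopologicalSpace X] {H : HolStructure X} {S : Set X}

/-- A linear form in the dual of the fibre only depends on the germ of its argument. -/
theorem fibreDual_congr {x : X} (φ : H.fibreDual S x) {f g : H.idealAt S x}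
    (h : (f : X → ℂ) =ᶠ[𝓝 x] g) : φ.1 f = φ.1 g := by
  classical
  rw [← sub_eq_zero, ← map_sub]
  let d : H.idealAt S x := f - g
  let χ : X → ℂ := fun y => if d.1 y = 0 then 0 else 1
  have hd : d.1 =ᶠ[𝓝 x] 0 := by
    filter_upwards [h] with y hy
    simp [d, hy]
  have hχ : χ ∈ H.hol x := by
    refine H.congr ?_ (zero_mem (H.hol x))
    filter_upwards [hd] with y hy
    simp [χ, hy]
  have hχd : (⟨χ * d.1, mul_mem_idealAt hχ d.2⟩ : H.idealAt S x) = d := by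
    ext y
    by_cases hy : d.1 y = 0 <;> simp [χ, hy]
  have h1 := φ.2 χ hχ d
  rw [hχd] at h1
  have h2 : χ x = 0 := by simp [χ, hd.self_of_nhds]
  rw [h1, h2, zero_mul]

theorem mem_idealAt_of_notMem (hS : IsClosed S) {x : X} (hx : x ∉ S) {f : X → ℂ}
    (hf : f ∈ H.hol x) : f ∈ H.idealAt S x :=
  ⟨hf, by filter_upwards [hS.isOpen_compl.mem_nhds hx] with y hy h using absurd h hy⟩

/-- Evaluation at a point as a linear form on the fibre of the ideal sheaf. -/
def evalDual (x : X) : H.fibreDual S x :=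
  ⟨{ toFun := fun f => f.1 x, map_add' := fun _ _ => rfl, map_smul' := fun _ _ => rfl },
    fun _ _ _ => rfl⟩

theorem fibreDual_eq_smul (hS : IsClosed S) {x : X} (hx : x ∉ S) (φ : H.fibreDual S x) :
    φ = φ.1 ⟨1, mem_idealAt_of_notMem hS hx (one_mem _)⟩ • evalDual x := by
  ext f
  have h := φ.2 f.1 f.2.1 ⟨1, mem_idealAt_of_notMem hS hx (one_mem _)⟩
  have h1 : (⟨f.1 * 1, mul_mem_idealAt f.2.1 (mem_idealAt_of_notMem hS hx (one_mem _))⟩ :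
      H.idealAt S x) = f := by ext; simp
  rw [h1] at h
  change φ.1 f = _ * f.1 x
  rw [h, mul_comm]

theorem evalDual_ne_zero (hS : IsClosed S) {x : X} (hx : x ∉ S) :
    (evalDual x : H.fibreDual S x) ≠ 0 := by
  intro h
  have := congrArg (fun φ : H.fibreDual S x =>
    φ.1 ⟨1, mem_idealAt_of_notMem hS hx (one_mem _)⟩) h
  exact one_ne_zero this

namespace IdealProj

theorem coord_of_mem {f : X → ℂ} {P : H.IdealProj S} (hf : f ∈ H.idealAt S P.base) :
    P.coord f = P.line.rep.1 ⟨f, hf⟩ := dif_pos hf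

/-- Homogeneous coordinates may be computed with any representative of the line. -/
theorem exists_coord_mk {x : X} {φ : H.fibreDual S x} (hφ : φ ≠ 0) :
    ∃ k : ℂ, k ≠ 0 ∧ ∀ f (hf : f ∈ H.idealAt S x),
      (⟨x, Projectivization.mk ℂ φ hφ⟩ : H.IdealProj S).coord f = k * φ.1 ⟨f, hf⟩ := by
  obtain ⟨a, ha⟩ := Projectivization.exists_smul_eq_mk_rep ℂ φ hφ
  refine ⟨a, a.ne_zero, fun f hf => ?_⟩
  rw [coord_of_mem (P := ⟨x, _⟩) hf]
  simp only
  rw [← ha]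
  rfl

/-- The point of the projective fibre space over a point outside `S`. -/
def ofBase (hS : IsClosed S) (x : X) (hx : x ∉ S) : H.IdealProj S :=
  ⟨x, Projectivization.mk ℂ (evalDual x) (evalDual_ne_zero hS hx)⟩

theorem eq_ofBase (hS : IsClosed S) {P : H.IdealProj S} (hP : P.base ∉ S) :
    P = ofBase hS P.base hP := by
  obtain ⟨x, l⟩ := P
  have h := fibreDual_eq_smul hS hP l.rep
  refine congrArg (IdealProj.mk x) ?_
  rw [← l.mk_rep, Projectivization.mk_eq_mk_iff']
  exact ⟨_, h.symm⟩

theorem coord_of_notMem (hS : IsClosed S) {P : H.IdealProj S} (hP : P.base ∉ S) :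
    ∃ k : ℂ, k ≠ 0 ∧ ∀ f ∈ H.hol P.base, P.coord f = k * f P.base := by
  obtain ⟨k, hk, h⟩ := exists_coord_mk (evalDual_ne_zero (H := H) hS hP)
  refine ⟨k, hk, fun f hf => ?_⟩
  have h1 := h f (mem_idealAt_of_notMem hS hP hf)
  conv_lhs => rw [eq_ofBase hS hP]
  exact h1

theorem coord_ne_zero_iff (hS : IsClosed S) {P : H.IdealProj S} (hP : P.base ∉ S) {f : X → ℂ}
    (hf : f ∈ H.hol P.base) : P.coord f ≠ 0 ↔ f P.base ≠ 0 := by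
  obtain ⟨k, hk, h⟩ := coord_of_notMem hS hP
  rw [h f hf]
  simp [hk]

theorem ratio_of_notMem (hS : IsClosed S) {P : H.IdealProj S} (hP : P.base ∉ S) {f g : X → ℂ}
    (hf : f ∈ H.hol P.base) (hg : g ∈ H.hol P.base) :
    P.ratio g f = g P.base / f P.base := by
  obtain ⟨k, hk, h⟩ := coord_of_notMem hS hP
  rw [ratio, h f hf, h g hg, mul_div_mul_left _ _ hk]

theorem continuousAt_ratio {P : H.IdealProj S} {f g : X → ℂ} (hf : f ∈ H.idealAt S P.base)
    (hg : g ∈ H.idealAt S P.base) (h0 : P.coord f ≠ 0) : ContinuousAt (ratio g f) P := by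
  intro A hA
  obtain ⟨W, hWA, hW, hPW⟩ := mem_nhds_iff.1 hA
  exact (eventually_ratio hf hg h0 hW hPW).mono fun Q hQ => hWA hQ.2

theorem eventually_coord_ne_zero {P : H.IdealProj S} {f : X → ℂ} (hf : f ∈ H.idealAt S P.base)
    (h0 : P.coord f ≠ 0) : ∀ᶠ Q : H.IdealProj S in 𝓝 P, Q.coord f ≠ 0 :=
  (eventually_ratio hf hf h0 isOpen_univ trivial).mono fun _ h => h.1

/-- A criterion for convergence in the projective fibre space. -/
theorem tendsto_iff {α : Type*} {l : Filter α} {β : α → H.IdealProj S} {P : H.IdealProj S}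
    (hbase : Tendsto (fun a => (β a).base) l (𝓝 P.base))
    (hratio : ∀ f ∈ H.idealAt S P.base, ∀ g ∈ H.idealAt S P.base, P.coord f ≠ 0 →
      (∀ᶠ a in l, (β a).coord f ≠ 0) ∧ Tendsto (fun a => (β a).ratio g f) l (𝓝 (P.ratio g f))) :
    Tendsto β l (𝓝 P) := by
  rw [TopologicalSpace.tendsto_nhds_generateFrom_iff]
  rintro _ (⟨U, hU, rfl⟩ | ⟨U, f, g, W, hU, hW, hfg, rfl⟩) hP
  · exact hbase (hU.mem_nhds hP)
  · obtain ⟨h1, h2⟩ := hratio f (hfg _ hP.1).1 g (hfg _ hP.1).2 hP.2.1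
    filter_upwards [hbase (hU.mem_nhds hP.1), h1, h2 (hW.mem_nhds hP.2.2)] with a h3 h4 h5
    exact ⟨h3, h4, h5⟩

theorem continuousAt_ofBase (hS : IsClosed S) {α : Type*} [TopologicalSpace α] {b : α → X}
    (hb : ∀ a, b a ∉ S) {a : α} (hbc : ContinuousAt b a) :
    ContinuousAt (fun a => (ofBase hS (b a) (hb a) : H.IdealProj S)) a := by
  refine tendsto_iff hbc fun f hf g hg h0 => ?_
  have hfh : ∀ᶠ a in 𝓝 a, f ∈ H.hol (b a) := hbc.eventually (H.eventually hf.1)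
  have hgh : ∀ᶠ a in 𝓝 a, g ∈ H.hol (b a) := hbc.eventually (H.eventually hg.1)
  have hfc : Tendsto (fun a => f (b a)) (𝓝 a) (𝓝 (f (b a))) :=
    ContinuousAt.comp (g := f) (f := b) (H.continuousAt hf.1) hbc
  have hgc : Tendsto (fun a => g (b a)) (𝓝 a) (𝓝 (g (b a))) :=
    ContinuousAt.comp (g := g) (f := b) (H.continuousAt hg.1) hbc
  rw [coord_ne_zero_iff hS (hb a) hf.1] at h0
  constructor
  · filter_upwards [hfc.eventually_ne h0, hfh] with a h1 h2
    exact (coord_ne_zero_iff hS (hb a) h2).2 h1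
  · rw [ratio_of_notMem hS (hb a) hf.1 hg.1]
    refine (hgc.div hfc h0).congr' ?_
    filter_upwards [hfh, hgh] with a h1 h2
    exact (ratio_of_notMem (P := ofBase hS (b a) (hb a)) hS (hb a) h1 h2).symm

end IdealProj

/-- The point of the blow-up over a point outside `S`. -/
def Blowup.ofBase (hS : IsClosed S) (x : X) (hx : x ∉ S) : H.Blowup S :=
  ⟨IdealProj.ofBase hS x hx, subset_closure hx⟩

theorem Blowup.eq_ofBase (hS : IsClosed S) {P : H.Blowup S} (hP : P.1.base ∉ S) :
    P = Blowup.ofBase hS P.1.base hP :=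
  Subtype.ext (IdealProj.eq_ofBase hS hP)

theorem Blowup.continuous_base : Continuous fun P : H.Blowup S => P.1.base :=
  IdealProj.continuous_base.comp continuous_subtype_val

/-- The projection of the blow-up is a homeomorphism outside `S`. -/
def Blowup.away (hS : IsClosed S) (P₀ : H.Blowup S) : OpenPartialHomeomorph (H.Blowup S) X := by
  classical
  exact
  { toFun := fun P => P.1.base
    invFun := fun x => if hx : x ∉ S then Blowup.ofBase hS x hx else P₀
    source := {P | P.1.base ∉ S}
    target := Sᶜ
    map_source' := fun P hP => hP
    map_target' := fun x hx => by
      have hx' : x ∉ S := hx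
      simp [hx', Blowup.ofBase, IdealProj.ofBase]
    left_inv' := fun P hP => by
      have hx' : P.1.base ∉ S := hP
      simp only [hx', not_false_eq_true, dif_pos]
      exact (Blowup.eq_ofBase hS hP).symm
    right_inv' := fun x hx => by
      have hx' : x ∉ S := hx
      simp [hx', Blowup.ofBase, IdealProj.ofBase]
    open_source := hS.isOpen_compl.preimage Blowup.continuous_base
    open_target := hS.isOpen_compl
    continuousOn_toFun := Blowup.continuous_base.continuousOn
    continuousOn_invFun := by
      rw [continuousOn_iff_continuous_domRestrict]
      have h : Continuous fun x : (Sᶜ : Set X) => (Blowup.ofBase hS x.1 x.2 : H.Blowup S) :=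
        Continuous.subtype_mk (continuous_iff_continuousAt.2 fun x =>
          IdealProj.continuousAt_ofBase hS (fun x : (Sᶜ : Set X) => x.2)
            continuous_subtype_val.continuousAt) _
      refine h.congr fun x => ?_
      have hx' : (x : X) ∉ S := x.2
      simp [hx'] }

/-- Stability of the holomorphic functions under analytic substitutions. -/
def IsAnalyticallyClosed (H : HolStructure X) : Prop :=
  ∀ (x : X) (n : ℕ) (G : Fin n → X → ℂ) (F : (Fin n → ℂ) → ℂ), (∀ i, G i ∈ H.hol x) →
    AnalyticAt ℂ F (fun i => G i x) → (fun y => F fun i => G i y) ∈ H.hol x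

theorem mem_blowup_hol_of_notMem (hH : H.IsAnalyticallyClosed) (hS : IsClosed S)
    {P : H.Blowup S} (hP : P.1.base ∉ S) {h : H.Blowup S → ℂ} :
    h ∈ (H.blowup S).hol P ↔ ∃ g ∈ H.hol P.1.base, h =ᶠ[𝓝 P] fun Q => g Q.1.base := by
  constructor
  · rintro ⟨n, G, F, hG, hF, hh⟩
    have hG' : ∀ i, ∃ g ∈ H.hol P.1.base, G i =ᶠ[𝓝 P] fun Q => g Q.1.base := by
      intro i
      rcases hG i with ⟨g, hg, h⟩ | ⟨f, hf, g, hg, h0, h⟩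
      · exact ⟨g, hg, .of_eq h⟩
      · have h0' := (IdealProj.coord_ne_zero_iff hS hP hf.1).1 h0
        refine ⟨fun x => g x / f x, ?_, ?_⟩
        · refine hH P.1.base 2 ![g, f] (fun v => v 0 / v 1) (fun i => ?_) ?_
          · fin_cases i
            exacts [hg.1, hf.1]
          · have hpr : ∀ (i : Fin 2) (w : Fin 2 → ℂ), AnalyticAt ℂ (fun v : Fin 2 → ℂ => v i) w :=
              fun i w => (ContinuousLinearMap.proj (R := ℂ)
                (φ := fun _ : Fin 2 => ℂ) i).analyticAt w
            exact (hpr 0 _).div (hpr 1 _) (by simpa using h0')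
        · rw [h]
          filter_upwards [Blowup.continuous_base.continuousAt.eventually (H.eventually hf.1),
            Blowup.continuous_base.continuousAt.eventually (H.eventually hg.1),
            Blowup.continuous_base.continuousAt.eventually (hS.isOpen_compl.mem_nhds hP)]
            with Q h1 h2 h3
          exact IdealProj.ratio_of_notMem hS h3 h1 h2
    choose g hg hGg using hG'
    refine ⟨fun x => F fun i => g i x, hH _ n g F hg ?_, ?_⟩
    · convert hF using 2 with i
      exact (hGg _).self_of_nhds.symm
    · filter_upwards [hh, eventually_all.2 hGg] with Q h1 h2
      rw [h1]
      simp only [h2]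
  · rintro ⟨g, hg, h⟩
    refine (H.blowup S).congr h.symm ⟨1, fun _ Q => g Q.1.base, fun v => v 0,
      fun _ => .inl ⟨g, hg, rfl⟩, ?_, .rfl⟩
    exact (ContinuousLinearMap.proj (R := ℂ) (φ := fun _ : Fin 1 => ℂ) 0).analyticAt _

theorem mem_regularLocus_iff_of_openPartialHomeomorph {Y : Type*} [TopologicalSpace Y]
    {HX : HolStructure X} {HY : HolStructure Y} (φ : OpenPartialHomeomorph X Y) {x : X}
    (hx : x ∈ φ.source)
    (hφ : ∀ z ∈ φ.source, ∀ f : Y → ℂ, f ∈ HY.hol (φ z) ↔ f ∘ φ ∈ HX.hol z) :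
    x ∈ HX.regularLocus ↔ φ x ∈ HY.regularLocus := by
  constructor
  · rintro ⟨n, e, hxe, he⟩
    refine ⟨n, φ.symm.trans e, by simp [hx, hxe], fun y hy f => ?_⟩
    rw [OpenPartialHomeomorph.trans_source] at hy
    obtain ⟨hy, hye⟩ := hy
    have hy' : y ∈ φ.target := hy
    have hyz := φ.map_target hy'
    have h1 := hφ _ hyz f
    rw [φ.right_inv hy'] at h1
    rw [h1, he _ hye]
    rfl
  · rintro ⟨n, e, hxe, he⟩
    refine ⟨n, φ.trans e, by simp [hx, hxe], fun z hz f => ?_⟩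
    rw [OpenPartialHomeomorph.trans_source] at hz
    obtain ⟨hz, hze⟩ := hz
    have h1 := (hφ z hz (f ∘ φ.symm)).symm.trans (he _ hze (f ∘ φ.symm))
    refine Iff.trans ⟨fun h => HX.congr ?_ h, fun h => HX.congr ?_ h⟩ h1
    · filter_upwards [φ.open_source.mem_nhds hz] with w hw
      simp [φ.left_inv hw]
    · filter_upwards [φ.open_source.mem_nhds hz] with w hw
      simp [φ.left_inv hw]

theorem mem_regularLocus_blowup_iff (hH : H.IsAnalyticallyClosed) (hS : IsClosed S)
    {P : H.Blowup S} (hP : P.1.base ∉ S) :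
    P ∈ (H.blowup S).regularLocus ↔ P.1.base ∈ H.regularLocus := by
  refine mem_regularLocus_iff_of_openPartialHomeomorph (Blowup.away hS P) hP fun Q hQ f => ?_
  rw [mem_blowup_hol_of_notMem hH hS hQ]
  constructor
  · intro hf
    exact ⟨f, hf, .rfl⟩
  · rintro ⟨g, hg, h⟩
    refine H.congr ?_ hg
    have h1 : ∀ᶠ x in 𝓝 Q.1.base, g x = f x := by
      have h2 : Tendsto (Blowup.away hS P).symm (𝓝 Q.1.base) (𝓝 Q) :=
        (Blowup.away hS P).tendsto_symm hQ
      filter_upwards [h2.eventually h, hS.isOpen_compl.mem_nhds hQ] with x hx hxS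
      have h3 : ((Blowup.away hS P).symm x).1.base = x := (Blowup.away hS P).right_inv hxS
      rw [h3] at hx
      rw [← hx]
      change f ((Blowup.away hS P).symm x).1.base = f x
      rw [h3]
    exact h1

end Away

end HolStructure

end

section

open HolStructure

namespace SingularKummer

variable {Λ : Submodule ℤ (Fin 2 → ℂ)}

theorem isAnalyticallyClosed : (holStructure Λ).IsAnalyticallyClosed := by
  intro y n G F hG hF
  obtain ⟨z, rfl⟩ := ofPoint_surjective y
  refine mem_hol_iff.2 ?_
  exact AnalyticAt.comp (g := F) (f := fun w i => G i (ofPoint Λ w)) hF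
    (analyticAt_pi_iff.2 fun i => mem_hol_iff.1 (hG i))

variable (Λ) in
/-- The ball of radius `r` around the centre `c` of a point of `S` is mapped to the Kummer surface
by the quotient by the reflection in `c`, and its image meets `S` only in the image of `c`. -/
structure IsCentredBall (S : Set (SingularKummer Λ)) (c : Fin 2 → ℂ) (r : ℝ) : Prop where
  pos : 0 < r
  mem_halfLattice : c ∈ halfLattice Λ.toAddSubgroup
  mem : ofPoint Λ c ∈ S
  eq_or_eq : ∀ z ∈ Metric.ball c r, ∀ w ∈ Metric.ball c r, ofPoint Λ z = ofPoint Λ w →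
    w = z ∨ w = c + c - z ∧ c ∈ halfLattice Λ.toAddSubgroup
  eq_of_mem : ∀ z ∈ Metric.ball c r, z ∈ halfLattice Λ.toAddSubgroup → z = c

theorem exists_isCentredBall [DiscreteTopology Λ] {S : Set (SingularKummer Λ)} {c : Fin 2 → ℂ}
    (hc : c ∈ halfLattice Λ.toAddSubgroup) (hcS : ofPoint Λ c ∈ S) :
    ∃ r, IsCentredBall Λ S c r := by
  obtain ⟨r, hr, h1⟩ := exists_ball_ofPoint_eq (Λ := Λ) c
  obtain ⟨s, hs, h2⟩ := Λ.toAddSubgroup.exists_ball_eq (c + c)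
  refine ⟨min r (s / 2), by positivity, hc, hcS, fun z hz w hw => h1 z ?_ w ?_, fun z hz hzΛ => ?_⟩
  · exact Metric.ball_subset_ball (min_le_left _ _) hz
  · exact Metric.ball_subset_ball (min_le_left _ _) hw
  · rw [mem_ball_iff_norm] at hz
    have h3 := h2 (z + z) hzΛ (by
      calc ‖z + z - (c + c)‖ = ‖(z - c) + (z - c)‖ := by congr 1; abel
        _ ≤ ‖z - c‖ + ‖z - c‖ := norm_add_le _ _
        _ < s := by linarith [min_le_right r (s / 2)])
    rw [← two_smul ℂ z, ← two_smul ℂ c] at h3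
    exact smul_right_injective _ two_ne_zero h3

theorem isClosed_of_subset_singularLocus [DiscreteTopology Λ] {S : Set (SingularKummer Λ)}
    (hS : S ⊆ (holStructure Λ).singularLocus) : IsClosed S := by
  rw [singularLocus_eq] at hS
  rw [← isOpen_compl_iff, isOpen_iff_mem_nhds]
  intro y hy
  obtain ⟨z, rfl⟩ := ofPoint_surjective y
  obtain ⟨s, hs, h2⟩ := Λ.toAddSubgroup.exists_ball_eq (z + z)
  refine mem_of_superset ((isOpenMap_ofPoint (Λ := Λ)).image_mem_nhds
    (Metric.ball_mem_nhds z (half_pos hs))) ?_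
  rintro _ ⟨w, hw, rfl⟩ hwS
  have hwΛ := ofPoint_mem_image_halfLattice_iff.1 (hS hwS)
  rw [mem_ball_iff_norm] at hw
  have h3 := h2 (w + w) hwΛ (by
    calc ‖w + w - (z + z)‖ = ‖(w - z) + (w - z)‖ := by congr 1; abel
      _ ≤ ‖w - z‖ + ‖w - z‖ := norm_add_le _ _
      _ < s := by linarith)
  rw [← two_smul ℂ w, ← two_smul ℂ z] at h3
  exact hy (smul_right_injective _ two_ne_zero h3 ▸ hwS)

variable (Λ) in
/-- The function `(zᵢ - cᵢ) (zⱼ - cⱼ)` on the image of the ball of radius `r` around `c`. -/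
def quadFun (c : Fin 2 → ℂ) (r : ℝ) (i j : Fin 2) (y : SingularKummer Λ) : ℂ :=
  (Function.invFunOn (ofPoint Λ) (Metric.ball c r) y i - c i) *
    (Function.invFunOn (ofPoint Λ) (Metric.ball c r) y j - c j)

theorem quadFun_comm (c : Fin 2 → ℂ) (r : ℝ) (i j : Fin 2) :
    quadFun Λ c r i j = quadFun Λ c r j i :=
  funext fun _ => mul_comm _ _

section Local

variable {S : Set (SingularKummer Λ)} {c : Fin 2 → ℂ} {r : ℝ} (h : IsCentredBall Λ S c r)

include h

theorem IsCentredBall.mem_self : c ∈ Metric.ball c r := Metric.mem_ball_self h.pos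

theorem IsCentredBall.mem_nhds : Metric.ball c r ∈ 𝓝 c := Metric.ball_mem_nhds c h.pos

theorem quadFun_ofPoint {z : Fin 2 → ℂ} (hz : z ∈ Metric.ball c r) (i j : Fin 2) :
    quadFun Λ c r i j (ofPoint Λ z) = (z i - c i) * (z j - c j) := by
  have hex : ∃ w ∈ Metric.ball c r, ofPoint Λ w = ofPoint Λ z := ⟨z, hz, rfl⟩
  unfold quadFun
  rcases h.eq_or_eq z hz _ (Function.invFunOn_mem hex) (Function.invFunOn_eq hex).symm with h | h
  · rw [h]
  · rw [h.1]
    simp only [Pi.sub_apply, Pi.add_apply]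
    ring

theorem quadFun_mem_hol {z : Fin 2 → ℂ} (hz : z ∈ Metric.ball c r) (i j : Fin 2) :
    quadFun Λ c r i j ∈ (holStructure Λ).hol (ofPoint Λ z) := by
  refine mem_hol_iff.2 ((analyticAt_sub_mul_sub c i j z).congr ?_)
  filter_upwards [Metric.isOpen_ball.mem_nhds hz] with w hw
  exact (quadFun_ofPoint h hw i j).symm

variable (hS : S ⊆ (holStructure Λ).singularLocus) [DiscreteTopology Λ]
include hS

theorem eq_of_ofPoint_mem {z : Fin 2 → ℂ} (hz : z ∈ Metric.ball c r) (hzS : ofPoint Λ z ∈ S) :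
    z = c := by
  rw [singularLocus_eq] at hS
  exact h.eq_of_mem z hz (ofPoint_mem_image_halfLattice_iff.1 (hS hzS))

theorem quadFun_mem_idealAt {z : Fin 2 → ℂ} (hz : z ∈ Metric.ball c r) (i j : Fin 2) :
    quadFun Λ c r i j ∈ (holStructure Λ).idealAt S (ofPoint Λ z) := by
  refine ⟨quadFun_mem_hol h hz i j, ?_⟩
  filter_upwards [(isOpenMap_ofPoint (Λ := Λ)).image_mem_nhds (Metric.isOpen_ball.mem_nhds hz)]
  rintro _ ⟨w, hw, rfl⟩ hwS
  rw [quadFun_ofPoint h hw, eq_of_ofPoint_mem h hS hw hwS, sub_self, zero_mul]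

/-- The ideal at the image of `c` is generated by the functions `(zᵢ - cᵢ) (zⱼ - cⱼ)`. -/
theorem exists_generation {f : SingularKummer Λ → ℂ}
    (hf : f ∈ (holStructure Λ).idealAt S (ofPoint Λ c)) :
    ∃ A : Fin 2 × Fin 2 → (Fin 2 × Fin 2 → ℂ) → ℂ, (∀ kl, AnalyticAt ℂ (A kl) 0) ∧
      (∀ᶠ z in 𝓝 (0 : Fin 2 → ℂ), f (ofPoint Λ (c + z)) =
        ∑ kl : Fin 2 × Fin 2, z kl.1 * z kl.2 * A kl fun mn => z mn.1 * z mn.2) ∧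
      ∀ φ : (holStructure Λ).fibreDual S (ofPoint Λ c), φ.1 ⟨f, hf⟩ = ∑ kl : Fin 2 × Fin 2,
        A kl 0 * φ.1 ⟨quadFun Λ c r kl.1 kl.2, quadFun_mem_idealAt h hS h.mem_self _ _⟩ := by
  have hfa : AnalyticAt ℂ (fun z => f (ofPoint Λ (c + z))) 0 := by
    have h1 : AnalyticAt ℂ (f ∘ ofPoint Λ) (c + 0) := by
      simpa using mem_hol_iff.1 hf.1
    exact h1.comp (f := fun z => c + z) (analyticAt_const.add analyticAt_id)
  have hf0 : f (ofPoint Λ (c + 0)) = 0 := by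
    rw [add_zero]
    exact hf.2.self_of_nhds h.mem
  obtain ⟨A, hA, hfA⟩ := hfa.exists_pair_of_even (.of_forall fun z => congrArg f (by
    rw [← ofPoint_reflect h.mem_halfLattice]
    congr 1
    abel))
  simp only [hf0, zero_add] at hfA
  refine ⟨A, hA, hfA, fun φ => ?_⟩
  have hdesc : ∀ kl, ∃ a : SingularKummer Λ → ℂ, ∀ z ∈ Metric.ball c r,
      a (ofPoint Λ z) = A kl fun mn => (z mn.1 - c mn.1) * (z mn.2 - c mn.2) := fun kl =>
    exists_descend h.eq_or_eq (F := fun z => A kl fun mn => (z mn.1 - c mn.1) * (z mn.2 - c mn.2))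
      fun z => by
        congr 1
        ext mn
        simp only [Pi.sub_apply, Pi.add_apply]
        ring
  choose a ha using hdesc
  have haH : ∀ kl, a kl ∈ (holStructure Λ).hol (ofPoint Λ c) := by
    intro kl
    refine mem_hol_iff.2 ?_
    have h1 : AnalyticAt ℂ (fun z : Fin 2 → ℂ => A kl fun mn =>
        (z mn.1 - c mn.1) * (z mn.2 - c mn.2)) c := by
      refine AnalyticAt.comp (g := A kl)
        (f := fun (z : Fin 2 → ℂ) (mn : Fin 2 × Fin 2) => (z mn.1 - c mn.1) * (z mn.2 - c mn.2)) ?_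
        (analyticAt_pi_iff.2 fun mn => analyticAt_sub_mul_sub c _ _ _)
      have h0 : (fun mn : Fin 2 × Fin 2 => (c mn.1 - c mn.1) * (c mn.2 - c mn.2)) = 0 := by
        ext mn
        simp
      simpa only [h0] using hA kl
    refine h1.congr ?_
    filter_upwards [h.mem_nhds] with z hz
    exact (ha kl z hz).symm
  have hac : ∀ kl, a kl (ofPoint Λ c) = A kl 0 := fun kl => by
    rw [ha kl c h.mem_self]
    congr 1
    ext mn
    simp
  let u : Fin 2 × Fin 2 → (holStructure Λ).idealAt S (ofPoint Λ c) := fun kl =>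
    ⟨quadFun Λ c r kl.1 kl.2, quadFun_mem_idealAt h hS h.mem_self _ _⟩
  have h2 : φ.1 ⟨f, hf⟩ = φ.1 (∑ kl, ⟨a kl * (u kl).1, mul_mem_idealAt (haH kl) (u kl).2⟩) := by
    refine fibreDual_congr φ ?_
    have h3 : ∀ᶠ z in 𝓝 c, f (ofPoint Λ z) = ∑ kl : Fin 2 × Fin 2,
        (z kl.1 - c kl.1) * (z kl.2 - c kl.2) *
          A kl fun mn => (z mn.1 - c mn.1) * (z mn.2 - c mn.2) := by
      have h4 : Tendsto (fun z => z - c) (𝓝 c) (𝓝 0) := by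
        simpa using (continuous_sub_right c).tendsto c
      filter_upwards [h4.eventually hfA] with z hz
      simpa using hz
    filter_upwards [(isOpenMap_ofPoint (Λ := Λ)).image_mem_nhds (inter_mem h.mem_nhds h3)]
    rintro _ ⟨z, ⟨hz, hz'⟩, rfl⟩
    have hz'' : f (ofPoint Λ z) = _ := hz'
    simp only [AddSubmonoidClass.coe_finsetSum, Finset.sum_apply, Pi.mul_apply, u,
      quadFun_ofPoint h hz, ha _ z hz, hz'']
    exact Finset.sum_congr rfl fun kl _ => mul_comm _ _
  rw [h2, map_sum]
  refine Finset.sum_congr rfl fun kl _ => ?_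
  rw [φ.2 (a kl) (haH kl) (u kl), hac]

end Local

end SingularKummer

end

section

open HolStructure

/-- The vector of `ℂ²` with `i`-th coordinate `1` and other coordinate `t`. -/
def affineDir (i : Fin 2) (t : ℂ) (k : Fin 2) : ℂ := if k = i then 1 else t

@[simp] theorem affineDir_self (i : Fin 2) (t : ℂ) : affineDir i t i = 1 := if_pos rfl

theorem analyticAt_affineDir {E : Type*} [NormedAddCommGroup E] [NormedSpace ℂ E] (i k : Fin 2)
    {t : E → ℂ} {x : E} (ht : AnalyticAt ℂ t x) :
    AnalyticAt ℂ (fun x => affineDir i (t x) k) x := by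
  unfold affineDir
  split
  exacts [analyticAt_const, ht]

theorem affineDir_of_ne {i j : Fin 2} (hij : j ≠ i) (t : ℂ) : affineDir i t j = t := if_neg hij

/-- The points `c + s v` with `v` in an affine chart of the projective line of directions. -/
def polarPoint (c : Fin 2 → ℂ) (i : Fin 2) (x : ℂ × ℂ) : Fin 2 → ℂ :=
  fun k => c k + x.1 * affineDir i x.2 k

theorem continuous_polarPoint (c : Fin 2 → ℂ) (i : Fin 2) : Continuous (polarPoint c i) := by
  refine continuous_pi fun k => ?_
  unfold polarPoint affineDir
  split <;> fun_prop

@[simp] theorem polarPoint_zero (c : Fin 2 → ℂ) (i : Fin 2) (t : ℂ) :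
    polarPoint c i (0, t) = c := by
  ext k
  simp [polarPoint]

theorem polarPoint_neg (c : Fin 2 → ℂ) (i : Fin 2) (s t : ℂ) :
    polarPoint c i (-s, t) = c + c - polarPoint c i (s, t) := by
  ext k
  simp only [polarPoint, Pi.sub_apply, Pi.add_apply]
  ring

/-- The map `(s, t) ↦ (s², t)`. -/
def sqFst (x : ℂ × ℂ) : Fin 2 → ℂ := ![x.1 ^ 2, x.2]

theorem continuous_sqFst : Continuous sqFst := by
  unfold sqFst
  fun_prop

theorem isOpenMap_sqFst : IsOpenMap sqFst := by
  have h1 : IsOpenMap (fun s : ℂ => s ^ 2) := (Complex.isOpenQuotientMap_pow 2).isOpenMap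
  have h2 : IsOpenMap (Prod.map (fun s : ℂ => s ^ 2) (id : ℂ → ℂ)) := h1.prodMap IsOpenMap.id
  exact (Homeomorph.finTwoArrow (X := ℂ)).symm.isOpenMap.comp h2

theorem sqFst_eq_iff {x y : ℂ × ℂ} : sqFst x = sqFst y ↔ (x.1 = y.1 ∨ x.1 = -y.1) ∧ x.2 = y.2 := by
  rw [← sq_eq_sq_iff_eq_or_eq_neg]
  constructor
  · intro h
    exact ⟨congrFun h 0, congrFun h 1⟩
  · rintro ⟨h1, h2⟩
    simp [sqFst, h1, h2]

/-- A preimage under `sqFst`. -/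
def sqFstInv (w : Fin 2 → ℂ) : ℂ × ℂ := (w 0 ^ (1 / 2 : ℂ), w 1)

theorem sqFst_sqFstInv (w : Fin 2 → ℂ) : sqFst (sqFstInv w) = w := by
  have h : (w 0 ^ (1 / 2 : ℂ)) ^ 2 = w 0 := by
    rw [← Complex.cpow_nat_mul]
    norm_num
  ext k
  fin_cases k
  · exact h
  · rfl

theorem eventually_nhds_sqFst {p : (Fin 2 → ℂ) → Prop} {x : ℂ × ℂ}
    (h : ∀ᶠ y in 𝓝 x, p (sqFst y)) : ∀ᶠ w in 𝓝 (sqFst x), p w :=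
  isOpenMap_sqFst.nhds_le x h

/-- An even function of `s` is a function of `s²`, analytically where `s ≠ 0`. -/
theorem AnalyticAt.exists_comp_sqFst {c : Fin 2 → ℂ} {i : Fin 2} {F : (Fin 2 → ℂ) → ℂ}
    {x : ℂ × ℂ} (hx : x.1 ≠ 0) (hF : AnalyticAt ℂ F (polarPoint c i x))
    (heven : ∀ z, F (c + c - z) = F z) : ∃ G : (Fin 2 → ℂ) → ℂ, AnalyticAt ℂ G (sqFst x) ∧
      ∀ᶠ y in 𝓝 x, F (polarPoint c i y) = G (sqFst y) := by
  obtain ⟨s, t⟩ := x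
  have hx' : s ≠ 0 := hx
  let σ : ℂ → ℂ := fun a => s * Complex.exp (Complex.log (a / s ^ 2) / 2)
  have hσ : AnalyticAt ℂ σ (s ^ 2) := by
    refine analyticAt_const.mul ((AnalyticAt.clog (analyticAt_id.div analyticAt_const
      (pow_ne_zero 2 hx')) ?_).div_const.cexp)
    simp [div_self (pow_ne_zero 2 hx')]
  have hσ1 : σ (s ^ 2) = s := by simp [σ, div_self (pow_ne_zero 2 hx')]
  have hσ2 : ∀ a ≠ 0, σ a ^ 2 = a := fun a ha => by
    simp only [σ, mul_pow, ← Complex.exp_nat_mul]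
    rw [Nat.cast_ofNat, mul_div_cancel₀ _ two_ne_zero, Complex.exp_log (by positivity)]
    field_simp
  have hproj : ∀ (k : Fin 2) (w : Fin 2 → ℂ), AnalyticAt ℂ (fun w : Fin 2 → ℂ => w k) w :=
    fun k w => (ContinuousLinearMap.proj (R := ℂ) (φ := fun _ : Fin 2 => ℂ) k).analyticAt w
  refine ⟨fun w => F (polarPoint c i (σ (w 0), w 1)), ?_, ?_⟩
  · refine AnalyticAt.comp (g := F) (f := fun w : Fin 2 → ℂ => polarPoint c i (σ (w 0), w 1)) ?_ ?_
    · convert hF using 3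
      · simpa [sqFst] using hσ1
      · rfl
    · refine analyticAt_pi_iff.2 fun k => ?_
      exact analyticAt_const.add ((AnalyticAt.comp (g := σ) (f := fun w : Fin 2 → ℂ => w 0)
        (by simpa [sqFst] using hσ) (hproj 0 _)).mul (analyticAt_affineDir i k (hproj 1 _)))
  · have h1 : ∀ᶠ y : ℂ × ℂ in 𝓝 (s, t), y.1 ≠ 0 := continuous_fst.continuousAt.eventually_ne hx
    filter_upwards [h1] with y hy
    have h2 := hσ2 (y.1 ^ 2) (pow_ne_zero 2 hy)
    change _ = F (polarPoint c i (σ (y.1 ^ 2), y.2))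
    rcases sq_eq_sq_iff_eq_or_eq_neg.1 h2 with h3 | h3
    · rw [h3]
    · rw [h3, polarPoint_neg, heven]

namespace SingularKummer

variable {Λ : Submodule ℤ (Fin 2 → ℂ)} {S : Set (SingularKummer Λ)} {c : Fin 2 → ℂ} {r : ℝ}

theorem quadFun_polarPoint (h : IsCentredBall Λ S c r) {i : Fin 2} {x : ℂ × ℂ}
    (hx : polarPoint c i x ∈ Metric.ball c r) (k l : Fin 2) :
    quadFun Λ c r k l (ofPoint Λ (polarPoint c i x)) =
      x.1 ^ 2 * (affineDir i x.2 k * affineDir i x.2 l) := by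
  rw [quadFun_ofPoint h hx]
  simp only [polarPoint]
  ring

variable [DiscreteTopology Λ]

/-- An element of the ideal at the image of `c` is divisible by `s²` in the chart `(s², t)`. -/
theorem exists_eq_sq_mul (h : IsCentredBall Λ S c r) (hS : S ⊆ (holStructure Λ).singularLocus)
    {f : SingularKummer Λ → ℂ} (hf : f ∈ (holStructure Λ).idealAt S (ofPoint Λ c)) (i : Fin 2)
    (t : ℂ) : ∃ G : (Fin 2 → ℂ) → ℂ, AnalyticAt ℂ G (sqFst (0, t)) ∧
      ∀ᶠ x in 𝓝 (0, t), f (ofPoint Λ (polarPoint c i x)) = x.1 ^ 2 * G (sqFst x) := by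
  obtain ⟨A, hA, hfA, -⟩ := exists_generation h hS hf
  have hproj : ∀ (k : Fin 2) (w : Fin 2 → ℂ), AnalyticAt ℂ (fun w : Fin 2 → ℂ => w k) w :=
    fun k w => (ContinuousLinearMap.proj (R := ℂ) (φ := fun _ : Fin 2 => ℂ) k).analyticAt w
  refine ⟨fun w => ∑ kl : Fin 2 × Fin 2, affineDir i (w 1) kl.1 * affineDir i (w 1) kl.2 *
    A kl fun mn => w 0 * (affineDir i (w 1) mn.1 * affineDir i (w 1) mn.2), ?_, ?_⟩
  · refine Finset.analyticAt_fun_sum _ fun kl _ => ?_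
    refine ((analyticAt_affineDir i _ (hproj 1 _)).mul
      (analyticAt_affineDir i _ (hproj 1 _))).mul ?_
    refine AnalyticAt.comp (g := A kl) (f := fun (w : Fin 2 → ℂ) (mn : Fin 2 × Fin 2) =>
      w 0 * (affineDir i (w 1) mn.1 * affineDir i (w 1) mn.2)) ?_ ?_
    · have h0 : (fun mn : Fin 2 × Fin 2 => sqFst (0, t) 0 *
          (affineDir i (sqFst (0, t) 1) mn.1 * affineDir i (sqFst (0, t) 1) mn.2)) = 0 := by
        ext mn
        simp [sqFst]
      simpa only [h0] using hA kl
    · exact analyticAt_pi_iff.2 fun mn => (hproj 0 _).mul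
        ((analyticAt_affineDir i _ (hproj 1 _)).mul (analyticAt_affineDir i _ (hproj 1 _)))
  · have h4 : Tendsto (fun x => polarPoint c i x - c) (𝓝 (0, t)) (𝓝 0) := by
      have h5 : Continuous fun x => polarPoint c i x - c :=
        (continuous_polarPoint c i).sub continuous_const
      simpa using h5.tendsto (0, t)
    filter_upwards [h4.eventually hfA] with x hx
    rw [add_sub_cancel] at hx
    rw [hx, Finset.mul_sum]
    refine Finset.sum_congr rfl fun kl _ => ?_
    have h5 : (fun mn : Fin 2 × Fin 2 => (polarPoint c i x - c) mn.1 * (polarPoint c i x - c) mn.2)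
        = fun mn => sqFst x 0 *
          (affineDir i (sqFst x 1) mn.1 * affineDir i (sqFst x 1) mn.2) := by
      ext mn
      simp only [polarPoint, sqFst, Pi.sub_apply, Matrix.cons_val_zero, Matrix.cons_val_one]
      ring
    rw [h5]
    simp only [polarPoint, sqFst, Pi.sub_apply, Matrix.cons_val_zero, Matrix.cons_val_one]
    ring

theorem exists_tendsto_div_sq (h : IsCentredBall Λ S c r)
    (hS : S ⊆ (holStructure Λ).singularLocus)
    {f : SingularKummer Λ → ℂ} (hf : f ∈ (holStructure Λ).idealAt S (ofPoint Λ c)) (i : Fin 2)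
    (t : ℂ) : ∃ G : (Fin 2 → ℂ) → ℂ, AnalyticAt ℂ G (sqFst (0, t)) ∧
      (∀ᶠ x in 𝓝 (0, t), f (ofPoint Λ (polarPoint c i x)) = x.1 ^ 2 * G (sqFst x)) ∧
      ∀ᶠ t' in 𝓝 t, Tendsto (fun s => f (ofPoint Λ (polarPoint c i (s, t'))) / s ^ 2) (𝓝[≠] 0)
        (𝓝 (G (sqFst (0, t')))) := by
  obtain ⟨G, hG, hfG⟩ := exists_eq_sq_mul h hS hf i t
  refine ⟨G, hG, hfG, ?_⟩
  have hG' : ∀ᶠ x in 𝓝 ((0 : ℂ), t), AnalyticAt ℂ G (sqFst x) :=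
    continuous_sqFst.continuousAt.eventually hG.eventually_analyticAt
  have h1 : Tendsto (fun t' : ℂ => ((0 : ℂ), t')) (𝓝 t) (𝓝 (0, t)) :=
    (Continuous.prodMk continuous_const continuous_id).tendsto t
  filter_upwards [h1.eventually hG', h1.eventually hfG.eventually_nhds] with t' h2 h3
  have h4 : Tendsto (fun s : ℂ => (s, t')) (𝓝 0) (𝓝 (0, t')) :=
    (Continuous.prodMk continuous_id continuous_const).tendsto 0
  have h5 : Tendsto (fun s : ℂ => G (sqFst (s, t'))) (𝓝 0) (𝓝 (G (sqFst (0, t')))) :=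
    (h2.continuousAt.tendsto.comp continuous_sqFst.continuousAt).comp h4
  refine (h5.mono_left nhdsWithin_le_nhds).congr' ?_
  filter_upwards [nhdsWithin_le_nhds (h4.eventually h3), self_mem_nhdsWithin] with s h6 h7
  rw [h6, mul_div_cancel_left₀ _ (pow_ne_zero 2 h7)]

/-- The linear form `f ↦ lim f(c + s v) / s²` on the ideal at the image of `c`. -/
def polarDual (h : IsCentredBall Λ S c r) (hS : S ⊆ (holStructure Λ).singularLocus)
    (i : Fin 2) (t : ℂ) : (holStructure Λ).fibreDual S (ofPoint Λ c) := by
  have hlim : ∀ f ∈ (holStructure Λ).idealAt S (ofPoint Λ c), Tendsto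
      (fun s => f (ofPoint Λ (polarPoint c i (s, t))) / s ^ 2) (𝓝[≠] 0)
      (𝓝 (limUnder (𝓝[≠] 0) fun s => f (ofPoint Λ (polarPoint c i (s, t))) / s ^ 2)) := by
    intro f hf
    obtain ⟨G, -, -, hG⟩ := exists_tendsto_div_sq h hS hf i t
    exact tendsto_nhds_limUnder ⟨_, hG.self_of_nhds⟩
  exact
  ⟨{ toFun := fun f => limUnder (𝓝[≠] 0) fun s => f.1 (ofPoint Λ (polarPoint c i (s, t))) / s ^ 2
     map_add' := fun f g => ((hlim f f.2).add (hlim g g.2)).congr (fun s => by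
       simp [add_div]) |>.limUnder_eq
     map_smul' := fun a f => ((hlim f f.2).const_mul a).congr (fun s => by
       simp [mul_div_assoc]) |>.limUnder_eq },
   fun g hg f => by
     have h1 : Tendsto (fun s : ℂ => g (ofPoint Λ (polarPoint c i (s, t)))) (𝓝[≠] 0)
         (𝓝 (g (ofPoint Λ c))) := by
       have h2 : Tendsto (fun s : ℂ => ofPoint Λ (polarPoint c i (s, t))) (𝓝 0)
           (𝓝 (ofPoint Λ c)) := by
         have h3 : Continuous fun s : ℂ => ofPoint Λ (polarPoint c i (s, t)) :=
           continuous_ofPoint.comp ((continuous_polarPoint c i).comp (by fun_prop))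
         simpa using h3.tendsto 0
       exact (((holStructure Λ).continuousAt hg).tendsto.comp h2).mono_left nhdsWithin_le_nhds
     exact (h1.mul (hlim f f.2)).congr (fun s => by
       simp [mul_div_assoc]) |>.limUnder_eq⟩

theorem polarDual_eq_of_tendsto (h : IsCentredBall Λ S c r)
    (hS : S ⊆ (holStructure Λ).singularLocus) {i : Fin 2} {t : ℂ}
    (f : (holStructure Λ).idealAt S (ofPoint Λ c)) {a : ℂ}
    (ha : Tendsto (fun s => f.1 (ofPoint Λ (polarPoint c i (s, t))) / s ^ 2) (𝓝[≠] 0) (𝓝 a)) :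
    (polarDual h hS i t).1 f = a :=
  ha.limUnder_eq

theorem polarDual_quadFun (h : IsCentredBall Λ S c r)
    (hS : S ⊆ (holStructure Λ).singularLocus) (i : Fin 2) (t : ℂ) (k l : Fin 2) :
    (polarDual h hS i t).1 ⟨quadFun Λ c r k l, quadFun_mem_idealAt h hS h.mem_self k l⟩ =
      affineDir i t k * affineDir i t l := by
  refine polarDual_eq_of_tendsto h hS _ (tendsto_const_nhds.congr' ?_)
  have h3 : Tendsto (fun s : ℂ => polarPoint c i (s, t)) (𝓝 0) (𝓝 c) := by
    have h3 : Continuous fun s : ℂ => polarPoint c i (s, t) :=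
      (continuous_polarPoint c i).comp (by fun_prop)
    simpa using h3.tendsto 0
  filter_upwards [nhdsWithin_le_nhds (h3.eventually h.mem_nhds), self_mem_nhdsWithin] with s h6 h7
  rw [quadFun_polarPoint h h6, mul_div_cancel_left₀ _ (pow_ne_zero 2 h7)]

theorem polarDual_ne_zero (h : IsCentredBall Λ S c r)
    (hS : S ⊆ (holStructure Λ).singularLocus) (i : Fin 2) (t : ℂ) : polarDual h hS i t ≠ 0 := by
  intro h0
  have h1 := polarDual_quadFun h hS i t i i
  rw [h0] at h1
  simp at h1

/-- The parametrization of the blow-up near the exceptional curve over the image of `c`. -/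
def polarProj (h : IsCentredBall Λ S c r) (hS : S ⊆ (holStructure Λ).singularLocus)
    (i : Fin 2) (x : ℂ × ℂ) : (holStructure Λ).IdealProj S := by
  classical
  exact if hx : x.1 ≠ 0 ∧ ofPoint Λ (polarPoint c i x) ∉ S then
    IdealProj.ofBase (isClosed_of_subset_singularLocus hS) _ hx.2
  else ⟨ofPoint Λ c, Projectivization.mk ℂ (polarDual h hS i x.2) (polarDual_ne_zero h hS i x.2)⟩

section

variable (h : IsCentredBall Λ S c r) (hS : S ⊆ (holStructure Λ).singularLocus) {i : Fin 2}

include hS in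
theorem ofPoint_polarPoint_notMem (h : IsCentredBall Λ S c r) {x : ℂ × ℂ} (hx : x.1 ≠ 0)
    (hxr : polarPoint c i x ∈ Metric.ball c r) : ofPoint Λ (polarPoint c i x) ∉ S := by
  intro hxS
  have h1 := congrFun (eq_of_ofPoint_mem h hS hxr hxS) i
  simp [polarPoint, hx] at h1

theorem polarProj_of_ne {x : ℂ × ℂ} (hx : x.1 ≠ 0)
    (hxr : polarPoint c i x ∈ Metric.ball c r) : polarProj h hS i x =
      IdealProj.ofBase (isClosed_of_subset_singularLocus hS) _
        (ofPoint_polarPoint_notMem hS h hx hxr) :=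
  dif_pos (⟨hx, ofPoint_polarPoint_notMem hS h hx hxr⟩ :
    x.1 ≠ 0 ∧ ofPoint Λ (polarPoint c i x) ∉ S)

theorem polarProj_zero (t : ℂ) : polarProj h hS i (0, t) =
    ⟨ofPoint Λ c, Projectivization.mk ℂ (polarDual h hS i t) (polarDual_ne_zero h hS i t)⟩ :=
  dif_neg fun hx => hx.1 rfl

theorem base_polarProj {x : ℂ × ℂ} (hxr : polarPoint c i x ∈ Metric.ball c r) :
    (polarProj h hS i x).base = ofPoint Λ (polarPoint c i x) := by
  by_cases hx : x.1 = 0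
  · obtain ⟨s, t⟩ := x
    obtain rfl : s = 0 := hx
    rw [polarProj_zero, polarPoint_zero]
  · rw [polarProj_of_ne h hS hx hxr]
    rfl

theorem isOpen_polarPoint_preimage : IsOpen (polarPoint c i ⁻¹' Metric.ball c r) :=
  Metric.isOpen_ball.preimage (continuous_polarPoint c i)

theorem coord_polarProj_ne_zero {x : ℂ × ℂ} (hxr : polarPoint c i x ∈ Metric.ball c r) :
    (polarProj h hS i x).coord (quadFun Λ c r i i) ≠ 0 := by
  by_cases hx : x.1 = 0
  · obtain ⟨s, t⟩ := x
    obtain rfl : s = 0 := hx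
    rw [polarProj_zero]
    obtain ⟨k, hk, hk'⟩ := IdealProj.exists_coord_mk (polarDual_ne_zero h hS i t)
    rw [hk' _ (quadFun_mem_idealAt h hS h.mem_self i i), polarDual_quadFun]
    simpa using hk
  · rw [polarProj_of_ne h hS hx hxr, IdealProj.coord_ne_zero_iff
      (isClosed_of_subset_singularLocus hS) (ofPoint_polarPoint_notMem hS h hx hxr)
      (quadFun_mem_hol h hxr i i)]
    change quadFun Λ c r i i (ofPoint Λ (polarPoint c i x)) ≠ 0
    rw [quadFun_polarPoint h hxr]
    simpa using hx

theorem ratio_polarProj_of_ne {x : ℂ × ℂ} (hx : x.1 ≠ 0)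
    (hxr : polarPoint c i x ∈ Metric.ball c r) {f : SingularKummer Λ → ℂ}
    (hf : f ∈ (holStructure Λ).hol (ofPoint Λ (polarPoint c i x))) :
    (polarProj h hS i x).ratio f (quadFun Λ c r i i) =
      f (ofPoint Λ (polarPoint c i x)) / x.1 ^ 2 := by
  rw [polarProj_of_ne h hS hx hxr, IdealProj.ratio_of_notMem
      (isClosed_of_subset_singularLocus hS) (ofPoint_polarPoint_notMem hS h hx hxr)
      (quadFun_mem_hol h hxr i i) hf]
  change _ / quadFun Λ c r i i (ofPoint Λ (polarPoint c i x)) = _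
  rw [quadFun_polarPoint h hxr]
  simp [IdealProj.ofBase]

theorem ratio_polarProj_zero {t : ℂ} {f : SingularKummer Λ → ℂ}
    (hf : f ∈ (holStructure Λ).idealAt S (ofPoint Λ c)) :
    (polarProj h hS i (0, t)).ratio f (quadFun Λ c r i i) = (polarDual h hS i t).1 ⟨f, hf⟩ := by
  rw [polarProj_zero]
  obtain ⟨k, hk, hk'⟩ := IdealProj.exists_coord_mk (polarDual_ne_zero h hS i t)
  rw [IdealProj.ratio, hk' _ (quadFun_mem_idealAt h hS h.mem_self i i), hk' _ hf,
    polarDual_quadFun]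
  simp [hk]

theorem ratio_polarProj_quadFun {x : ℂ × ℂ} (hxr : polarPoint c i x ∈ Metric.ball c r)
    (k l : Fin 2) : (polarProj h hS i x).ratio (quadFun Λ c r k l) (quadFun Λ c r i i) =
      affineDir i x.2 k * affineDir i x.2 l := by
  by_cases hx : x.1 = 0
  · obtain ⟨s, t⟩ := x
    obtain rfl : s = 0 := hx
    rw [ratio_polarProj_zero h hS (quadFun_mem_idealAt h hS h.mem_self k l), polarDual_quadFun]
  · rw [ratio_polarProj_of_ne h hS hx hxr (quadFun_mem_hol h hxr k l), quadFun_polarPoint h hxr,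
      mul_div_cancel_left₀ _ (pow_ne_zero 2 hx)]

/-- Quotients by the generator `(zᵢ - cᵢ)²` of the ideal are analytic in the chart `(s², t)`. -/
theorem exists_ratio_eq {x : ℂ × ℂ} (hxr : polarPoint c i x ∈ Metric.ball c r)
    {f : SingularKummer Λ → ℂ}
    (hf : f ∈ (holStructure Λ).idealAt S (ofPoint Λ (polarPoint c i x))) :
    ∃ G : (Fin 2 → ℂ) → ℂ, AnalyticAt ℂ G (sqFst x) ∧
      ∀ᶠ y in 𝓝 x, (polarProj h hS i y).ratio f (quadFun Λ c r i i) = G (sqFst y) := by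
  have hball : ∀ᶠ y in 𝓝 x, polarPoint c i y ∈ Metric.ball c r :=
    isOpen_polarPoint_preimage.mem_nhds hxr
  have hhol : ∀ᶠ y in 𝓝 x, f ∈ (holStructure Λ).idealAt S (ofPoint Λ (polarPoint c i y)) :=
    (continuous_ofPoint.comp (continuous_polarPoint c i)).continuousAt.eventually
      (idealAt_eventually hf)
  by_cases hx : x.1 = 0
  · obtain ⟨s, t⟩ := x
    obtain rfl : s = 0 := hx
    rw [polarPoint_zero] at hf
    obtain ⟨G, hG, hfG, hGl⟩ := exists_tendsto_div_sq h hS hf i t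
    refine ⟨G, hG, ?_⟩
    filter_upwards [hball, hhol, hfG, continuous_snd.continuousAt.eventually hGl]
      with y h1 h2 h3 h4
    by_cases hy : y.1 = 0
    · obtain ⟨s, t'⟩ := y
      obtain rfl : s = 0 := hy
      rw [ratio_polarProj_zero h hS hf]
      exact polarDual_eq_of_tendsto h hS _ h4
    · rw [ratio_polarProj_of_ne h hS hy h1 h2.1, h3, mul_div_cancel_left₀ _ (pow_ne_zero 2 hy)]
  · obtain ⟨G, hG, hfG⟩ := AnalyticAt.exists_comp_sqFst hx (mem_hol_iff.1 hf.1)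
      fun z => congrArg f (ofPoint_reflect h.mem_halfLattice z)
    refine ⟨fun w => G w / w 0, ?_, ?_⟩
    · refine hG.div ((ContinuousLinearMap.proj (R := ℂ)
        (φ := fun _ : Fin 2 => ℂ) 0).analyticAt _) ?_
      simpa [sqFst] using hx
    · filter_upwards [hball, hhol, hfG, continuous_fst.continuousAt.eventually_ne hx]
        with y h1 h2 h3 h4
      rw [ratio_polarProj_of_ne h hS h4 h1 h2.1]
      exact congrArg (· / y.1 ^ 2) h3

include hS in
/-- Holomorphic functions on the Kummer surface are analytic in the chart `(s², t)`. -/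
theorem exists_comp_ofPoint_eq (h : IsCentredBall Λ S c r) {x : ℂ × ℂ}
    (hxr : polarPoint c i x ∈ Metric.ball c r) {f : SingularKummer Λ → ℂ}
    (hf : f ∈ (holStructure Λ).hol (ofPoint Λ (polarPoint c i x))) :
    ∃ G : (Fin 2 → ℂ) → ℂ, AnalyticAt ℂ G (sqFst x) ∧
      ∀ᶠ y in 𝓝 x, f (ofPoint Λ (polarPoint c i y)) = G (sqFst y) := by
  by_cases hx : x.1 = 0
  · obtain ⟨s, t⟩ := x
    obtain rfl : s = 0 := hx
    rw [polarPoint_zero] at hf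
    let a : ℂ := f (ofPoint Λ c)
    have hfa : f - (fun _ => a) ∈ (holStructure Λ).idealAt S (ofPoint Λ c) := by
      refine ⟨sub_mem hf (((holStructure Λ).hol _).algebraMap_mem a), ?_⟩
      filter_upwards [(isOpenMap_ofPoint (Λ := Λ)).image_mem_nhds h.mem_nhds]
      rintro _ ⟨w, hw, rfl⟩ hwS
      rw [eq_of_ofPoint_mem h hS hw hwS]
      simp [a]
    obtain ⟨G, hG, hfG⟩ := exists_eq_sq_mul h hS hfa i t
    refine ⟨fun w => w 0 * G w + a, ?_, ?_⟩
    · exact (((ContinuousLinearMap.proj (R := ℂ)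
        (φ := fun _ : Fin 2 => ℂ) 0).analyticAt _).mul hG).add analyticAt_const
    · filter_upwards [hfG] with y hy
      rw [Pi.sub_apply, sub_eq_iff_eq_add] at hy
      exact hy
  · exact AnalyticAt.exists_comp_sqFst hx (mem_hol_iff.1 hf)
      fun z => congrArg f (ofPoint_reflect h.mem_halfLattice z)

theorem ratio_eq_ratio_div_ratio {x : ℂ × ℂ} (hxr : polarPoint c i x ∈ Metric.ball c r)
    (f g : SingularKummer Λ → ℂ) : (polarProj h hS i x).ratio g f =
      (polarProj h hS i x).ratio g (quadFun Λ c r i i) /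
        (polarProj h hS i x).ratio f (quadFun Λ c r i i) :=
  (div_div_div_cancel_right₀ (coord_polarProj_ne_zero h hS hxr) _ _).symm

theorem ratio_polarProj_ne_zero_iff {x : ℂ × ℂ} (hxr : polarPoint c i x ∈ Metric.ball c r)
    (f : SingularKummer Λ → ℂ) : (polarProj h hS i x).ratio f (quadFun Λ c r i i) ≠ 0 ↔
      (polarProj h hS i x).coord f ≠ 0 := by
  simp [IdealProj.ratio, coord_polarProj_ne_zero h hS hxr]

theorem continuousAt_polarProj {x : ℂ × ℂ} (hxr : polarPoint c i x ∈ Metric.ball c r) :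
    ContinuousAt (polarProj h hS i) x := by
  have hball : ∀ᶠ y in 𝓝 x, polarPoint c i y ∈ Metric.ball c r :=
    isOpen_polarPoint_preimage.mem_nhds hxr
  refine IdealProj.tendsto_iff ?_ fun f hf g hg h0 => ?_
  · rw [base_polarProj h hS hxr]
    refine ((continuous_ofPoint.comp (continuous_polarPoint c i)).tendsto x).congr' ?_
    filter_upwards [hball] with y hy
    exact (base_polarProj h hS hy).symm
  · rw [base_polarProj h hS hxr] at hf hg
    obtain ⟨F, hF, hfF⟩ := exists_ratio_eq h hS hxr hf
    obtain ⟨G, hG, hgG⟩ := exists_ratio_eq h hS hxr hg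
    have h1 : F (sqFst x) ≠ 0 := by
      rwa [← hfF.self_of_nhds, ratio_polarProj_ne_zero_iff h hS hxr]
    have hFt := hF.continuousAt.tendsto.comp continuous_sqFst.continuousAt
    have hGt := hG.continuousAt.tendsto.comp continuous_sqFst.continuousAt
    constructor
    · filter_upwards [hball, hfF, hFt.eventually_ne h1] with y h2 h3 h4
      rw [← ratio_polarProj_ne_zero_iff h hS h2, h3]
      exact h4
    · rw [ratio_eq_ratio_div_ratio h hS hxr, hfF.self_of_nhds, hgG.self_of_nhds]
      refine (hGt.div hFt h1).congr' ?_
      filter_upwards [hball, hfF, hgG] with y h2 h3 h4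
      rw [ratio_eq_ratio_div_ratio h hS h2, h3, h4]
      rfl

theorem polarProj_mem_closure (x : ℂ × ℂ) :
    polarProj h hS i x ∈ closure {P : (holStructure Λ).IdealProj S | P.base ∉ S} := by
  by_cases hx : x.1 ≠ 0 ∧ ofPoint Λ (polarPoint c i x) ∉ S
  · refine subset_closure ?_
    rw [show polarProj h hS i x = _ from dif_pos hx]
    exact hx.2
  · obtain ⟨s, t⟩ := x
    have h1 : polarProj h hS i (s, t) = polarProj h hS i (0, t) := by
      rw [polarProj_zero]
      exact dif_neg hx
    have hc : polarPoint c i (0, t) ∈ Metric.ball c r := by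
      rw [polarPoint_zero]
      exact h.mem_self
    rw [h1]
    have h2 : Tendsto (fun s : ℂ => (s, t)) (𝓝[≠] 0) (𝓝 (0, t)) :=
      ((Continuous.prodMk continuous_id continuous_const).tendsto 0).mono_left nhdsWithin_le_nhds
    refine mem_closure_of_tendsto ((continuousAt_polarProj h hS hc).tendsto.comp h2) ?_
    filter_upwards [h2.eventually (isOpen_polarPoint_preimage.mem_nhds hc), self_mem_nhdsWithin]
      with s h3 h4
    change (polarProj h hS i (s, t)).base ∉ S
    rw [base_polarProj h hS h3]
    exact ofPoint_polarPoint_notMem hS h h4 h3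

/-- The parametrization of the blow-up near the exceptional curve over the image of `c`. -/
def polarLift (i : Fin 2) (x : ℂ × ℂ) : (holStructure Λ).Blowup S :=
  ⟨polarProj h hS i x, polarProj_mem_closure h hS x⟩

theorem continuousAt_polarLift {x : ℂ × ℂ} (hxr : polarPoint c i x ∈ Metric.ball c r) :
    ContinuousAt (polarLift h hS i) x :=
  (continuousAt_polarProj h hS hxr).codRestrict _

theorem polarLift_eq_of_sqFst_eq {x y : ℂ × ℂ} (hxr : polarPoint c i x ∈ Metric.ball c r)
    (hxy : sqFst x = sqFst y) : polarPoint c i y ∈ Metric.ball c r ∧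
      polarLift h hS i x = polarLift h hS i y := by
  obtain ⟨s, t⟩ := x
  obtain ⟨s', t'⟩ := y
  obtain ⟨h1, h2⟩ := sqFst_eq_iff.1 hxy
  simp only at h1 h2
  subst h2
  rcases h1 with rfl | rfl
  · exact ⟨hxr, rfl⟩
  · have h3 : polarPoint c i (s', t) = c + c - polarPoint c i (-s', t) := by
      rw [← polarPoint_neg, neg_neg]
    have h4 : polarPoint c i (s', t) ∈ Metric.ball c r := by
      rw [h3, mem_ball_iff_norm, show c + c - polarPoint c i (-s', t) - c =
        -(polarPoint c i (-s', t) - c) by abel, norm_neg]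
      exact mem_ball_iff_norm.1 hxr
    refine ⟨h4, Subtype.ext ?_⟩
    change polarProj h hS i _ = polarProj h hS i _
    by_cases hs : s' = 0
    · simp [hs]
    · rw [polarProj_of_ne h hS (neg_ne_zero.2 hs) hxr, polarProj_of_ne h hS hs h4]
      congr 1
      rw [h3, ofPoint_reflect h.mem_halfLattice]

end

end SingularKummer

end

section

open HolStructure

namespace SingularKummer

variable {Λ : Submodule ℤ (Fin 2 → ℂ)} {S : Set (SingularKummer Λ)} {c : Fin 2 → ℂ} {r : ℝ}
  [DiscreteTopology Λ] (h : IsCentredBall Λ S c r) (hS : S ⊆ (holStructure Λ).singularLocus)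

theorem exists_polarPoint_eq {i : Fin 2} {z : Fin 2 → ℂ} (hz : z i ≠ c i) :
    ∃ x : ℂ × ℂ, x.1 ≠ 0 ∧ polarPoint c i x = z := by
  obtain ⟨j, hj⟩ := exists_ne i
  refine ⟨(z i - c i, (z j - c j) / (z i - c i)), sub_ne_zero.2 hz, ?_⟩
  ext k
  by_cases hk : k = i
  · subst hk
    simp [polarPoint]
  · obtain rfl : k = j := by omega
    simp only [polarPoint, affineDir_of_ne hj]
    rw [mul_div_cancel₀ _ (sub_ne_zero.2 hz)]
    ring

include h hS in
theorem quadFun_mem_idealAt_base {P : (holStructure Λ).IdealProj S}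
    (hP : P.base ∈ ofPoint Λ '' Metric.ball c r) (i j : Fin 2) :
    quadFun Λ c r i j ∈ (holStructure Λ).idealAt S P.base := by
  obtain ⟨z, hz, hzP⟩ := hP
  rw [← hzP]
  exact quadFun_mem_idealAt h hS hz i j

include h hS in
/-- The homogeneous coordinates of a point of the blow-up satisfy the equation of a conic. -/
theorem ratio_mul_ratio_eq {P : (holStructure Λ).Blowup S}
    (hP : P.1.base ∈ ofPoint Λ '' Metric.ball c r) {k l : Fin 2}
    (h0 : P.1.coord (quadFun Λ c r k l) ≠ 0) (i j : Fin 2) :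
    P.1.ratio (quadFun Λ c r i i) (quadFun Λ c r k l) *
      P.1.ratio (quadFun Λ c r j j) (quadFun Λ c r k l) =
      P.1.ratio (quadFun Λ c r i j) (quadFun Λ c r k l) ^ 2 := by
  have hcl := isClosed_of_subset_singularLocus hS
  have hcont : ∀ i j, ContinuousAt (IdealProj.ratio (quadFun Λ c r i j) (quadFun Λ c r k l)) P.1 :=
    fun i j => IdealProj.continuousAt_ratio (quadFun_mem_idealAt_base h hS hP k l)
      (quadFun_mem_idealAt_base h hS hP i j) h0
  by_contra hne
  have h1 := ((hcont i i).mul (hcont j j)).sub ((hcont i j).pow 2)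
  have h2 := h1.eventually_ne (sub_ne_zero.2 hne)
  have h3 : ∀ᶠ Q : (holStructure Λ).IdealProj S in 𝓝 P.1, Q.base ∈ ofPoint Λ '' Metric.ball c r :=
    IdealProj.continuous_base.continuousAt.eventually
      ((isOpenMap_ofPoint (Λ := Λ) _ Metric.isOpen_ball).mem_nhds hP)
  obtain ⟨Q, hQS, hQ2, z, hz, hzQ⟩ := ((mem_closure_iff_frequently.1 P.2).and_eventually
    (h2.and h3)).exists
  refine hQ2 ?_
  have hQS' : Q.base ∉ S := hQS
  have hhol : ∀ i j, quadFun Λ c r i j ∈ (holStructure Λ).hol Q.base := fun i j => by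
    rw [← hzQ]
    exact quadFun_mem_hol h hz i j
  simp only [Pi.sub_apply, Pi.mul_apply, Pi.pow_apply,
    IdealProj.ratio_of_notMem hcl hQS' (hhol k l) (hhol _ _), ← hzQ, quadFun_ofPoint h hz]
  ring

include hS in
theorem exists_quadFun_ne_zero (h : IsCentredBall Λ S c r)
    {φ : (holStructure Λ).fibreDual S (ofPoint Λ c)} (hφ : φ ≠ 0) :
    ∃ i j, φ.1 ⟨quadFun Λ c r i j, quadFun_mem_idealAt h hS h.mem_self i j⟩ ≠ 0 := by
  by_contra! h0
  refine hφ (Subtype.ext (LinearMap.ext fun f => ?_))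
  obtain ⟨A, -, -, hA⟩ := exists_generation h hS f.2
  rw [show φ.1 f = _ from hA φ]
  simp [h0]

include h hS in
theorem exists_coord_quadFun_ne_zero {P : (holStructure Λ).Blowup S}
    (hP : P.1.base = ofPoint Λ c) : ∃ i, P.1.coord (quadFun Λ c r i i) ≠ 0 := by
  by_contra! h0
  have hPb : P.1.base ∈ ofPoint Λ '' Metric.ball c r := ⟨c, h.mem_self, hP.symm⟩
  have h1 : ∃ i j, P.1.coord (quadFun Λ c r i j) ≠ 0 := by
    obtain ⟨⟨b, l⟩, hQ⟩ := P
    obtain rfl : b = ofPoint Λ c := hP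
    obtain ⟨i, j, hij⟩ := exists_quadFun_ne_zero hS h l.rep_nonzero
    refine ⟨i, j, ?_⟩
    rw [IdealProj.coord_of_mem (quadFun_mem_idealAt h hS h.mem_self i j)]
    exact hij
  obtain ⟨i, j, hij⟩ := h1
  have h2 := ratio_mul_ratio_eq h hS hPb hij i j
  simp [IdealProj.ratio, h0, hij] at h2

theorem eq_polarLift_of_base_eq {P : (holStructure Λ).Blowup S}
    (hP : P.1.base = ofPoint Λ c) {i j : Fin 2} (hij : j ≠ i)
    (h0 : P.1.coord (quadFun Λ c r i i) ≠ 0) :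
    P = polarLift h hS i (0, P.1.ratio (quadFun Λ c r i j) (quadFun Λ c r i i)) := by
  have hPb : P.1.base ∈ ofPoint Λ '' Metric.ball c r := ⟨c, h.mem_self, hP.symm⟩
  have hrel := ratio_mul_ratio_eq h hS hPb h0 i j
  set t := P.1.ratio (quadFun Λ c r i j) (quadFun Λ c r i i) with ht
  have hii : P.1.ratio (quadFun Λ c r i i) (quadFun Λ c r i i) = 1 := div_self h0
  rw [hii, one_mul] at hrel
  have hkl : ∀ k l, P.1.coord (quadFun Λ c r k l) =
      P.1.coord (quadFun Λ c r i i) * (affineDir i t k * affineDir i t l) := by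
    intro k l
    suffices h2 : P.1.ratio (quadFun Λ c r k l) (quadFun Λ c r i i) =
        affineDir i t k * affineDir i t l by
      rw [← h2, IdealProj.ratio, mul_div_cancel₀ _ h0]
    by_cases hk : k = i <;> by_cases hl : l = i
    · simp [hk, hl, hii]
    · obtain rfl : l = j := by omega
      simp [hk, affineDir_of_ne hij, ht]
    · obtain rfl : k = j := by omega
      simp [hl, affineDir_of_ne hij, ht, quadFun_comm c r k i]
    · obtain rfl : k = j := by omega
      obtain rfl : l = k := by omega
      rw [hrel, affineDir_of_ne hij, sq]
  obtain ⟨⟨b, l⟩, hQ⟩ := P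
  obtain rfl : b = ofPoint Λ c := hP
  refine Subtype.ext ?_
  change _ = polarProj h hS i (0, t)
  rw [polarProj_zero]
  refine congrArg (IdealProj.mk _) ?_
  rw [← l.mk_rep, Projectivization.mk_eq_mk_iff']
  refine ⟨IdealProj.coord (quadFun Λ c r i i) ⟨ofPoint Λ c, l⟩, ?_⟩
  refine Subtype.ext (LinearMap.ext fun f => ?_)
  obtain ⟨A, -, -, hA⟩ := exists_generation h hS f.2
  change _ * (polarDual h hS i t).1 f = l.rep.1 f
  rw [show l.rep.1 f = _ from hA l.rep, show (polarDual h hS i t).1 f = _ from hA _,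
    Finset.mul_sum]
  refine Finset.sum_congr rfl fun kl _ => ?_
  have h3 := hkl kl.1 kl.2
  rw [IdealProj.coord_of_mem (P := ⟨ofPoint Λ c, l⟩)
    (quadFun_mem_idealAt h hS h.mem_self kl.1 kl.2)] at h3
  simp only at h3
  rw [h3, polarDual_quadFun]
  ring

/-- The domain of a chart of the blow-up over the image of the ball around `c`. -/
def polarSource (S : Set (SingularKummer Λ)) (c : Fin 2 → ℂ) (r : ℝ) (i : Fin 2) :
    Set ((holStructure Λ).Blowup S) :=
  {P | P.1.base ∈ ofPoint Λ '' Metric.ball c r ∧ P.1.coord (quadFun Λ c r i i) ≠ 0}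

theorem exists_polarLift_eq {i : Fin 2} {P : (holStructure Λ).Blowup S}
    (hP : P ∈ polarSource S c r i) :
    ∃ x, polarPoint c i x ∈ Metric.ball c r ∧ polarLift h hS i x = P := by
  obtain ⟨⟨z, hz, hzP⟩, h0⟩ := hP
  by_cases hPS : P.1.base ∈ S
  · obtain ⟨j, hj⟩ := exists_ne i
    rw [← hzP] at hPS
    rw [eq_of_ofPoint_mem h hS hz hPS] at hzP
    refine ⟨_, ?_, (eq_polarLift_of_base_eq h hS hzP.symm hj h0).symm⟩
    rw [polarPoint_zero]
    exact h.mem_self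
  · have hcl := isClosed_of_subset_singularLocus hS
    have h1 := (IdealProj.coord_ne_zero_iff hcl hPS (hzP ▸ quadFun_mem_hol h hz i i)).1 h0
    rw [← hzP, quadFun_ofPoint h hz, mul_self_ne_zero, sub_ne_zero] at h1
    obtain ⟨x, hx, rfl⟩ := exists_polarPoint_eq h1
    refine ⟨x, hz, Subtype.ext ?_⟩
    change polarProj h hS i x = _
    rw [polarProj_of_ne h hS hx hz, IdealProj.eq_ofBase hcl hPS]
    congr 1

theorem polarLift_mem_polarSource {i : Fin 2} {x : ℂ × ℂ}
    (hx : polarPoint c i x ∈ Metric.ball c r) : polarLift h hS i x ∈ polarSource S c r i :=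
  ⟨⟨_, hx, (base_polarProj h hS hx).symm⟩, coord_polarProj_ne_zero h hS hx⟩

include h hS in
theorem isOpen_polarSource (i : Fin 2) : IsOpen (polarSource S c r i) := by
  rw [isOpen_iff_mem_nhds]
  rintro P ⟨hP, h0⟩
  filter_upwards [Blowup.continuous_base.continuousAt.eventually
      ((isOpenMap_ofPoint (Λ := Λ) _ Metric.isOpen_ball).mem_nhds hP),
    continuous_subtype_val.continuousAt.eventually (IdealProj.eventually_coord_ne_zero
      (quadFun_mem_idealAt_base h hS hP i i) h0)] with Q h1 h2
  exact ⟨h1, h2⟩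

/-- The coordinates of the chart of the blow-up over the image of the ball around `c`. -/
def polarCoord (S : Set (SingularKummer Λ)) (c : Fin 2 → ℂ) (r : ℝ) (i j : Fin 2)
    (P : (holStructure Λ).Blowup S) : Fin 2 → ℂ :=
  ![quadFun Λ c r i i P.1.base, P.1.ratio (quadFun Λ c r i j) (quadFun Λ c r i i)]

theorem polarCoord_polarLift {i j : Fin 2} (hij : j ≠ i) {x : ℂ × ℂ}
    (hx : polarPoint c i x ∈ Metric.ball c r) :
    polarCoord S c r i j (polarLift h hS i x) = sqFst x := by
  change ![quadFun Λ c r i i (polarProj h hS i x).base, _] = _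
  rw [base_polarProj h hS hx, quadFun_polarPoint h hx]
  change ![_, (polarProj h hS i x).ratio _ _] = _
  rw [ratio_polarProj_quadFun h hS hx, affineDir_of_ne hij]
  simp [sqFst]

include h hS in
theorem quadFun_mem_blowupCoords {i : Fin 2} {P : (holStructure Λ).Blowup S}
    (hP : P ∈ polarSource S c r i) (k l : Fin 2) :
    (fun Q : (holStructure Λ).Blowup S => quadFun Λ c r k l Q.1.base) ∈
      (holStructure Λ).blowupCoords S P :=
  .inl ⟨_, (quadFun_mem_idealAt_base h hS hP.1 k l).1, rfl⟩

include h hS in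
theorem ratio_mem_blowupCoords {i : Fin 2} {P : (holStructure Λ).Blowup S}
    (hP : P ∈ polarSource S c r i) (k l : Fin 2) :
    (fun Q : (holStructure Λ).Blowup S => Q.1.ratio (quadFun Λ c r k l) (quadFun Λ c r i i)) ∈
      (holStructure Λ).blowupCoords S P :=
  .inr ⟨_, quadFun_mem_idealAt_base h hS hP.1 i i, _, quadFun_mem_idealAt_base h hS hP.1 k l,
    hP.2, rfl⟩

include h hS in
theorem continuousAt_polarCoord {i : Fin 2} (j : Fin 2) {P : (holStructure Λ).Blowup S}
    (hP : P ∈ polarSource S c r i) : ContinuousAt (polarCoord S c r i j) P := by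
  refine continuousAt_pi.2 fun k => ?_
  fin_cases k
  · exact ContinuousAt.comp (g := quadFun Λ c r i i)
      ((holStructure Λ).continuousAt (quadFun_mem_idealAt_base h hS hP.1 i i).1)
      Blowup.continuous_base.continuousAt
  · exact ContinuousAt.comp (g := IdealProj.ratio (quadFun Λ c r i j) (quadFun Λ c r i i))
      (IdealProj.continuousAt_ratio (quadFun_mem_idealAt_base h hS hP.1 i i)
        (quadFun_mem_idealAt_base h hS hP.1 i j) hP.2) continuous_subtype_val.continuousAt

/-- A chart of the blow-up near the exceptional curve over the image of `c`. -/
def polarChart {i j : Fin 2} (hij : j ≠ i) :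
    OpenPartialHomeomorph ((holStructure Λ).Blowup S) (Fin 2 → ℂ) where
  toFun := polarCoord S c r i j
  invFun := fun w => polarLift h hS i (sqFstInv w)
  source := polarSource S c r i
  target := sqFst '' (polarPoint c i ⁻¹' Metric.ball c r)
  map_source' := fun P hP => by
    obtain ⟨x, hx, rfl⟩ := exists_polarLift_eq h hS hP
    rw [polarCoord_polarLift h hS hij hx]
    exact ⟨x, hx, rfl⟩
  map_target' := by
    rintro _ ⟨x, hx, rfl⟩
    exact polarLift_mem_polarSource h hS
      (polarLift_eq_of_sqFst_eq h hS hx (sqFst_sqFstInv (sqFst x)).symm).1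
  left_inv' := fun P hP => by
    obtain ⟨x, hx, rfl⟩ := exists_polarLift_eq h hS hP
    rw [polarCoord_polarLift h hS hij hx]
    exact (polarLift_eq_of_sqFst_eq h hS hx (sqFst_sqFstInv (sqFst x)).symm).2.symm
  right_inv' := by
    rintro _ ⟨x, hx, rfl⟩
    rw [polarCoord_polarLift h hS hij
      (polarLift_eq_of_sqFst_eq h hS hx (sqFst_sqFstInv (sqFst x)).symm).1, sqFst_sqFstInv]
  open_source := isOpen_polarSource h hS i
  open_target := isOpenMap_sqFst _ isOpen_polarPoint_preimage
  continuousOn_toFun := fun P hP => (continuousAt_polarCoord h hS j hP).continuousWithinAt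
  continuousOn_invFun := by
    rintro _ ⟨x, hx, rfl⟩
    refine ContinuousAt.continuousWithinAt fun A hA => ?_
    rw [← (polarLift_eq_of_sqFst_eq h hS hx (sqFst_sqFstInv (sqFst x)).symm).2] at hA
    refine eventually_nhds_sqFst (p := fun w => polarLift h hS i (sqFstInv w) ∈ A) ?_
    filter_upwards [continuousAt_polarLift h hS hx hA, isOpen_polarPoint_preimage.mem_nhds hx]
      with y h1 h2
    rw [← (polarLift_eq_of_sqFst_eq h hS h2 (sqFst_sqFstInv (sqFst y)).symm).2]
    exact h1

theorem polarChart_symm_sqFst {i j : Fin 2} (hij : j ≠ i) {x : ℂ × ℂ}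
    (hx : polarPoint c i x ∈ Metric.ball c r) :
    (polarChart h hS hij).symm (sqFst x) = polarLift h hS i x :=
  (polarLift_eq_of_sqFst_eq h hS hx (sqFst_sqFstInv (sqFst x)).symm).2.symm

theorem analyticAt_polarChart_of_mem_blowupCoords {i j : Fin 2} (hij : j ≠ i) {x : ℂ × ℂ}
    (hx : polarPoint c i x ∈ Metric.ball c r) {g : (holStructure Λ).Blowup S → ℂ}
    (hg : g ∈ (holStructure Λ).blowupCoords S (polarLift h hS i x)) :
    AnalyticAt ℂ (g ∘ (polarChart h hS hij).symm) (sqFst x) := by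
  have hball : ∀ᶠ y in 𝓝 x, polarPoint c i y ∈ Metric.ball c r :=
    isOpen_polarPoint_preimage.mem_nhds hx
  have hbase : (polarLift h hS i x).1.base = ofPoint Λ (polarPoint c i x) :=
    base_polarProj h hS hx
  have key : ∀ G : (Fin 2 → ℂ) → ℂ, AnalyticAt ℂ G (sqFst x) →
      (∀ᶠ y in 𝓝 x, g (polarLift h hS i y) = G (sqFst y)) →
      AnalyticAt ℂ (g ∘ (polarChart h hS hij).symm) (sqFst x) := by
    intro G hG hgG
    refine hG.congr (eventually_nhds_sqFst ?_)
    filter_upwards [hgG, hball] with y h1 h2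
    rw [Function.comp_apply, polarChart_symm_sqFst h hS hij h2, h1]
  rcases hg with ⟨g, hg, rfl⟩ | ⟨f, hf, g, hg, h0, rfl⟩
  · rw [hbase] at hg
    obtain ⟨G, hG, hgG⟩ := exists_comp_ofPoint_eq hS h hx hg
    refine key G hG ?_
    filter_upwards [hgG, hball] with y h1 h2
    rw [← h1]
    exact congrArg g (base_polarProj h hS h2)
  · rw [hbase] at hf hg
    obtain ⟨F, hF, hfF⟩ := exists_ratio_eq h hS hx hf
    obtain ⟨G, hG, hgG⟩ := exists_ratio_eq h hS hx hg
    have h1 : F (sqFst x) ≠ 0 := by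
      rw [← hfF.self_of_nhds, ratio_polarProj_ne_zero_iff h hS hx]
      exact h0
    refine key _ (hG.div hF h1) ?_
    filter_upwards [hfF, hgG, hball] with y h2 h3 h4
    rw [Pi.div_apply, ← h2, ← h3]
    exact ratio_eq_ratio_div_ratio h hS h4 f g

theorem mem_hol_blowup_iff {i j : Fin 2} (hij : j ≠ i) {P : (holStructure Λ).Blowup S}
    (hP : P ∈ polarSource S c r i) (g : (holStructure Λ).Blowup S → ℂ) :
    g ∈ ((holStructure Λ).blowup S).hol P ↔
      AnalyticAt ℂ (g ∘ (polarChart h hS hij).symm) (polarChart h hS hij P) := by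
  have hP' : P ∈ (polarChart h hS hij).source := hP
  constructor
  · rintro ⟨n, G, F, hG, hF, hg⟩
    obtain ⟨x, hx, rfl⟩ := exists_polarLift_eq h hS hP
    have he : polarChart h hS hij (polarLift h hS i x) = sqFst x :=
      polarCoord_polarLift h hS hij hx
    have h1 : AnalyticAt ℂ (fun w => F fun k => G k ((polarChart h hS hij).symm w)) (sqFst x) := by
      refine AnalyticAt.comp (g := F)
        (f := fun w k => G k ((polarChart h hS hij).symm w)) ?_ ?_
      · rw [polarChart_symm_sqFst h hS hij hx]
        exact hF
      · exact analyticAt_pi_iff.2 fun k =>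
          analyticAt_polarChart_of_mem_blowupCoords h hS hij hx (hG k)
    rw [he]
    refine h1.congr ?_
    have h2 := (polarChart h hS hij).tendsto_symm hP'
    rw [he] at h2
    filter_upwards [h2.eventually hg] with w hw
    exact hw.symm
  · intro hg
    refine ⟨2, fun k Q => polarCoord S c r i j Q k, g ∘ (polarChart h hS hij).symm,
      fun k => ?_, hg, ?_⟩
    · fin_cases k
      · exact quadFun_mem_blowupCoords h hS hP i i
      · exact ratio_mem_blowupCoords h hS hP i j
    · filter_upwards [(isOpen_polarSource h hS i).mem_nhds hP] with Q hQ
      exact congrArg g ((polarChart h hS hij).left_inv hQ).symm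

include h hS in
theorem mem_regularLocus_of_mem_polarSource {i : Fin 2} {P : (holStructure Λ).Blowup S}
    (hP : P ∈ polarSource S c r i) : P ∈ ((holStructure Λ).blowup S).regularLocus := by
  obtain ⟨j, hj⟩ := exists_ne i
  exact ⟨2, polarChart h hS hj, hP, fun Q hQ g => mem_hol_blowup_iff h hS hj hQ g⟩

theorem exists_mem_polarSource (hS : S ⊆ (holStructure Λ).singularLocus)
    {P : (holStructure Λ).Blowup S} (hP : P.1.base ∈ S) :
    ∃ c r i, IsCentredBall Λ S c r ∧ P.1.base = ofPoint Λ c ∧ P ∈ polarSource S c r i := by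
  have h1 := hS hP
  rw [singularLocus_eq] at h1
  obtain ⟨c, hc, hcP⟩ := h1
  obtain ⟨r, hr⟩ := exists_isCentredBall (S := S) hc (hcP ▸ hP)
  obtain ⟨i, hi⟩ := exists_coord_quadFun_ne_zero hr hS hcP.symm
  exact ⟨c, r, i, hr, hcP.symm, ⟨c, hr.mem_self, hcP⟩, hi⟩

theorem mem_regularLocus_blowup (hS : S ⊆ (holStructure Λ).singularLocus)
    {P : (holStructure Λ).Blowup S} : P ∈ ((holStructure Λ).blowup S).regularLocus ↔
      (P.1.base ∈ (holStructure Λ).singularLocus → P.1.base ∈ S) := by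
  by_cases hP : P.1.base ∈ S
  · obtain ⟨c, r, i, hr, -, hi⟩ := exists_mem_polarSource hS hP
    exact iff_of_true (mem_regularLocus_of_mem_polarSource hr hS hi) fun _ => hP
  · rw [HolStructure.mem_regularLocus_blowup_iff isAnalyticallyClosed
      (isClosed_of_subset_singularLocus hS) hP]
    simp [hP, singularLocus]

end SingularKummer

end

section

open HolStructure

theorem IsGoodNhd.of_parametrization {E : Type*} [AddCommGroup E] [TopologicalSpace E]
    [IsTopologicalAddGroup E] {Λ : AddSubgroup E} {X : Type*} [TopologicalSpace X]
    {π : C(((halfLattice Λ)ᶜ : Set E), X)}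
    (hπ : ∀ z w : ((halfLattice Λ)ᶜ : Set E), π z = π w ↔ (w - z : E) ∈ Λ ∨ (w + z : E) ∈ Λ)
    {V : Set X} (hV : IsOpen V) (hVs : IsSimplyConnected V) {A : Type*} [TopologicalSpace A]
    [PathConnectedSpace A] {θ : A → ((halfLattice Λ)ᶜ : Set E)} (hθ : Continuous θ)
    (hθV : ∀ a, π (θ a) ∈ V) (hVθ : ∀ z, π z ∈ V → ∃ a, π (θ a) = π z) : IsGoodNhd π V where
  isOpen := hV
  isSimplyConnected := hVs
  exists_mem := (PathConnectedSpace.nonempty (X := A)).elim fun a => ⟨_, hθV a⟩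
  exists_path := fun z w hz hw => by
    obtain ⟨a, ha⟩ := hVθ z hz
    obtain ⟨b, hb⟩ := hVθ w hw
    have key : ∃ g : ((halfLattice Λ)ᶜ : Set E) → ((halfLattice Λ)ᶜ : Set E), Continuous g ∧
        (∀ v, π (g v) = π v) ∧ g (θ a) = z := by
      rcases (hπ _ _).1 ha with h | h
      · exact ⟨_, continuous_translateCompl ⟨_, h⟩, map_translateCompl hπ _,
          Subtype.ext (by simp [translateCompl])⟩
      · exact ⟨_, continuous_reflectCompl ⟨_, h⟩, map_reflectCompl hπ _,
          Subtype.ext (by simp [reflectCompl])⟩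
    obtain ⟨g, hg, hgπ, hgz⟩ := key
    refine ⟨g (θ b), (hgπ _).trans hb,
      ((PathConnectedSpace.somePath a b).map (hg.comp hθ)).cast hgz.symm rfl, fun t => ?_⟩
    simp only [Path.cast_coe, Path.map_coe, Function.comp_apply, hgπ]
    exact hθV _

/-- Small balls in a chart are simply connected open neighbourhoods. -/
theorem OpenPartialHomeomorph.exists_isSimplyConnected {Y E : Type*} [TopologicalSpace Y]
    [NormedAddCommGroup E] [NormedSpace ℝ E] (e : OpenPartialHomeomorph Y E) {R : Set Y}
    (hR : IsOpen R) {P : R} (hP : P.1 ∈ e.source) {O : Set R} (hO : O ∈ 𝓝 P) :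
    ∃ ε > 0, Metric.ball (e P) ε ⊆ e.target ∧ (∀ w ∈ Metric.ball (e P) ε, e.symm w ∈ R) ∧
      {Q : R | Q.1 ∈ e.source ∧ e Q ∈ Metric.ball (e P) ε} ⊆ O ∧
      IsOpen {Q : R | Q.1 ∈ e.source ∧ e Q ∈ Metric.ball (e P) ε} ∧
      IsSimplyConnected {Q : R | Q.1 ∈ e.source ∧ e Q ∈ Metric.ball (e P) ε} := by
  rw [nhds_subtype_eq_comap] at hO
  obtain ⟨O', hO', hO'O⟩ := mem_comap.1 hO
  obtain ⟨ε, hε, hball⟩ := Metric.mem_nhds_iff.1 (inter_mem (e.open_target.mem_nhds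
    (e.map_source hP)) (e.tendsto_symm hP (inter_mem hO' (hR.mem_nhds P.2))))
  refine ⟨ε, hε, fun w hw => (hball hw).1, fun w hw => (hball hw).2.2, ?_, ?_, ?_⟩
  · rintro Q ⟨hQ, hQe⟩
    have h1 := (hball hQe).2.1
    rw [e.left_inv hQ] at h1
    exact hO'O h1
  · exact (e.isOpen_inter_preimage Metric.isOpen_ball).preimage continuous_subtype_val
  · rw [← IsEmbedding.subtypeVal.isSimplyConnected_image]
    have h1 : Subtype.val '' {Q : R | Q.1 ∈ e.source ∧ e Q ∈ Metric.ball (e P) ε} =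
        e.symm '' Metric.ball (e P) ε := by
      ext Q
      constructor
      · rintro ⟨Q, ⟨hQ, hQe⟩, rfl⟩
        exact ⟨_, hQe, e.left_inv hQ⟩
      · rintro ⟨w, hw, rfl⟩
        exact ⟨⟨_, (hball hw).2.2⟩, ⟨e.map_target (hball hw).1, by
          simpa only [e.right_inv (hball hw).1] using hw⟩, rfl⟩
    rw [h1]
    have h2 : IsSimplyConnected (Metric.ball (e P) ε) :=
      (convex_ball _ _).isSimplyConnected ⟨_, Metric.mem_ball_self hε⟩
    have h3 : Metric.ball (e P) ε ≃ₜ e.symm '' Metric.ball (e P) ε :=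
      e.symm.homeomorphOfImageSubsetSource (fun w hw => (hball hw).1) rfl
    exact h3.toHomotopyEquiv.simplyConnectedSpace_iff.1 h2

theorem HolStructure.isOpen_regularLocus {X : Type*} [TopologicalSpace X] (H : HolStructure X) :
    IsOpen H.regularLocus := by
  rw [isOpen_iff_mem_nhds]
  rintro x ⟨n, e, hx, he⟩
  filter_upwards [e.open_source.mem_nhds hx] with y hy
  exact ⟨n, e, hy, he⟩

theorem sqFst_mem_ball_iff {x : ℂ × ℂ} {t : ℂ} {ε : ℝ} (hε : 0 < ε) :
    sqFst x ∈ Metric.ball (sqFst (0, t)) ε ↔ ‖x.1‖ ^ 2 < ε ∧ x.2 ∈ Metric.ball t ε := by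
  rw [Metric.mem_ball, dist_pi_lt_iff hε, Fin.forall_fin_two]
  simp [sqFst, dist_eq_norm]

theorem Complex.norm_exp_sq_lt_iff {a : ℂ} {ε : ℝ} (hε : 0 < ε) :
    ‖Complex.exp a‖ ^ 2 < ε ↔ a.re < Real.log ε / 2 := by
  rw [Complex.norm_exp, ← Real.exp_nat_mul, ← Real.lt_log_iff_exp_lt hε, lt_div_iff₀ two_pos,
    mul_comm]
  norm_num

namespace SingularKummer

variable {Λ : Submodule ℤ (Fin 2 → ℂ)} {S : Set (SingularKummer Λ)} {c : Fin 2 → ℂ} {r : ℝ}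
  [DiscreteTopology Λ] (h : IsCentredBall Λ S c r) (hS : S ⊆ (holStructure Λ).singularLocus)

theorem ofPoint_notMem_singularLocus {z : Fin 2 → ℂ} (hz : z ∈ (halfLattice Λ.toAddSubgroup)ᶜ) :
    ofPoint Λ z ∉ (holStructure Λ).singularLocus := by
  rw [singularLocus_eq, ofPoint_mem_image_halfLattice_iff]
  exact hz

/-- The map from the complement of the half lattice to the regular part of the blow-up. -/
def toBlowup : C(((halfLattice Λ.toAddSubgroup)ᶜ : Set (Fin 2 → ℂ)),
    ((holStructure Λ).blowup S).regularLocus) where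
  toFun z := ⟨Blowup.ofBase (isClosed_of_subset_singularLocus hS) (ofPoint Λ z)
      fun hz => ofPoint_notMem_singularLocus z.2 (hS hz),
    (mem_regularLocus_blowup hS).2 fun hz => absurd hz (ofPoint_notMem_singularLocus z.2)⟩
  continuous_toFun := by
    refine Continuous.subtype_mk (Continuous.subtype_mk (continuous_iff_continuousAt.2 fun z => ?_)
      _) _
    exact IdealProj.continuousAt_ofBase _ _
      (continuous_ofPoint.comp continuous_subtype_val).continuousAt

theorem base_toBlowup (z : ((halfLattice Λ.toAddSubgroup)ᶜ : Set (Fin 2 → ℂ))) :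
    (toBlowup hS z).1.1.base = ofPoint Λ z := rfl

theorem toBlowup_eq_of_base {z : ((halfLattice Λ.toAddSubgroup)ᶜ : Set (Fin 2 → ℂ))}
    {P : ((holStructure Λ).blowup S).regularLocus} (hP : P.1.1.base = ofPoint Λ z) :
    toBlowup hS z = P := by
  refine Subtype.ext ?_
  have h1 : P.1.1.base ∉ S := by
    rw [hP]
    exact fun hz => ofPoint_notMem_singularLocus z.2 (hS hz)
  rw [Blowup.eq_ofBase (isClosed_of_subset_singularLocus hS) h1]
  change Blowup.ofBase _ _ _ = _
  congr 1
  exact hP.symm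

theorem toBlowup_eq_iff (z w : ((halfLattice Λ.toAddSubgroup)ᶜ : Set (Fin 2 → ℂ))) :
    toBlowup hS z = toBlowup hS w ↔
      (w - z : Fin 2 → ℂ) ∈ Λ.toAddSubgroup ∨ (w + z : Fin 2 → ℂ) ∈ Λ.toAddSubgroup := by
  rw [← ofPoint_eq_iff]
  exact ⟨fun h => congrArg (fun P => P.1.1.base) h,
    fun h => toBlowup_eq_of_base hS (h.symm ▸ rfl)⟩

theorem isClosed_halfLattice : IsClosed (halfLattice Λ.toAddSubgroup) := by
  have h1 : IsClosed (Λ.toAddSubgroup : Set (Fin 2 → ℂ)) := AddSubgroup.isClosed_of_discrete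
  exact h1.preimage (by fun_prop : Continuous fun z : Fin 2 → ℂ => z + z)

theorem exists_isGoodNhd_of_base_notMem {P : ((holStructure Λ).blowup S).regularLocus}
    (hP : P.1.1.base ∉ S) {O : Set ((holStructure Λ).blowup S).regularLocus} (hO : O ∈ 𝓝 P) :
    ∃ V ⊆ O, P ∈ V ∧ IsGoodNhd (toBlowup hS) V := by
  have hcl := isClosed_of_subset_singularLocus hS
  obtain ⟨z, hz⟩ := ofPoint_surjective P.1.1.base
  have hzΛ : z ∈ (halfLattice Λ.toAddSubgroup)ᶜ := fun h1 =>
    hP ((mem_regularLocus_blowup hS).1 P.2 (hz ▸ ofPoint_mem_singularLocus h1))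
  obtain ⟨k, hzk, hk⟩ := exists_chart hzΛ
  obtain ⟨k', hk'⟩ : ∃ k', k' = k.restrOpen (halfLattice Λ.toAddSubgroup)ᶜ
      isClosed_halfLattice.isOpen_compl := ⟨_, rfl⟩
  have hk'f : ⇑k' = ofPoint Λ := by rw [hk', OpenPartialHomeomorph.coe_restrOpen, hk]
  have hk's : k'.source = k.source ∩ (halfLattice Λ.toAddSubgroup)ᶜ := by
    rw [hk', OpenPartialHomeomorph.restrOpen_source]
  have hzk' : z ∈ k'.source := by
    rw [hk's]
    exact ⟨hzk, hzΛ⟩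
  let e : OpenPartialHomeomorph ((holStructure Λ).Blowup S) (Fin 2 → ℂ) :=
    (Blowup.away hcl P.1).trans k'.symm
  have hes : e.source = {Q | Q.1.base ∉ S ∧ Q.1.base ∈ k'.target} :=
    OpenPartialHomeomorph.trans_source _ _
  have hPe : P.1 ∈ e.source := by
    rw [hes, Set.mem_ofPred_eq, ← hz]
    refine ⟨hz ▸ hP, ?_⟩
    rw [← hk'f]
    exact k'.map_source hzk'
  obtain ⟨ε, hε, htarget, -, hVO, hVo, hVs⟩ :=
    e.exists_isSimplyConnected (HolStructure.isOpen_regularLocus _) hPe hO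
  set V := {Q : ((holStructure Λ).blowup S).regularLocus |
    Q.1 ∈ e.source ∧ e Q ∈ Metric.ball (e P) ε} with hV
  have hsub : ∀ w ∈ Metric.ball (e P) ε, w ∈ k'.source := fun w hw => by
    have h1 := htarget hw
    rw [OpenPartialHomeomorph.trans_target] at h1
    exact h1.1
  have hsub' : ∀ w ∈ Metric.ball (e P) ε, w ∈ (halfLattice Λ.toAddSubgroup)ᶜ := fun w hw => by
    have h1 := hsub w hw
    rw [hk's] at h1
    exact h1.2
  have : PathConnectedSpace (Metric.ball (e P) ε) :=
    isPathConnected_iff_pathConnectedSpace.1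
      ((convex_ball _ _).isPathConnected ⟨_, Metric.mem_ball_self hε⟩)
  refine ⟨V, hVO, ⟨hPe, Metric.mem_ball_self hε⟩, IsGoodNhd.of_parametrization (toBlowup_eq_iff hS)
    hVo hVs (A := Metric.ball (e P) ε) (θ := fun w => ⟨w, hsub' w w.2⟩) (by fun_prop) ?_ ?_⟩
  · rintro ⟨w, hw⟩
    have h1 : (toBlowup hS ⟨w, hsub' w hw⟩).1.1.base = k' w := by rw [hk'f]; rfl
    have h2 : e (toBlowup hS ⟨w, hsub' w hw⟩).1 = w := by
      change k'.symm (toBlowup hS ⟨w, hsub' w hw⟩).1.1.base = w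
      rw [h1, k'.left_inv (hsub w hw)]
    refine ⟨?_, by rw [h2]; exact hw⟩
    rw [hes]
    refine ⟨?_, ?_⟩
    · exact fun h3 => ofPoint_notMem_singularLocus (hsub' w hw) (hS h3)
    · rw [h1]
      exact k'.map_source (hsub w hw)
  · rintro v ⟨h1, h2⟩
    refine ⟨⟨_, h2⟩, toBlowup_eq_of_base hS ?_⟩
    rw [hes] at h1
    change _ = ofPoint Λ (k'.symm _)
    rw [← hk'f, k'.right_inv]
    · rfl
    · exact h1.2

theorem exists_isGoodNhd_of_mem_polarSource (h : IsCentredBall Λ S c r) {i : Fin 2}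
    {P : ((holStructure Λ).blowup S).regularLocus} (hP : P.1.1.base = ofPoint Λ c)
    (hPi : P.1 ∈ polarSource S c r i)
    {O : Set ((holStructure Λ).blowup S).regularLocus} (hO : O ∈ 𝓝 P) :
    ∃ V ⊆ O, P ∈ V ∧ IsGoodNhd (toBlowup hS) V ∧
      ∃ (w w' : ((halfLattice Λ.toAddSubgroup)ᶜ : Set (Fin 2 → ℂ))) (δ : Path w w'),
        (w' : Fin 2 → ℂ) = c + c - w ∧ ∀ t, toBlowup hS (δ t) ∈ V := by
  obtain ⟨j, hj⟩ := exists_ne i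
  let e := polarChart h hS hj
  obtain ⟨t, ht⟩ : ∃ t, P.1 = polarLift h hS i (0, t) :=
    ⟨_, eq_polarLift_of_base_eq h hS hP hj hPi.2⟩
  have hc0 : polarPoint c i (0, t) ∈ Metric.ball c r := by
    rw [polarPoint_zero]
    exact h.mem_self
  have hPe : P.1 ∈ e.source := hPi
  obtain ⟨ε, hε, htarget, -, hVO, hVo, hVs⟩ :=
    e.exists_isSimplyConnected (HolStructure.isOpen_regularLocus _) hPe hO
  have heP : e P = sqFst (0, t) := by
    rw [ht]
    exact polarCoord_polarLift h hS hj hc0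
  rw [heP] at htarget hVO hVo hVs
  set V := {Q : ((holStructure Λ).blowup S).regularLocus |
    Q.1 ∈ e.source ∧ e Q ∈ Metric.ball (sqFst (0, t)) ε} with hV
  let A : Set (ℂ × ℂ) := {a : ℂ | a.re < Real.log ε / 2} ×ˢ Metric.ball t ε
  have hA : ∀ a ∈ A, sqFst (Complex.exp a.1, a.2) ∈ Metric.ball (sqFst (0, t)) ε := fun a ha =>
    (sqFst_mem_ball_iff hε).2 ⟨(Complex.norm_exp_sq_lt_iff hε).2 ha.1, ha.2⟩
  have hAr : ∀ a ∈ A, polarPoint c i (Complex.exp a.1, a.2) ∈ Metric.ball c r := fun a ha => by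
    obtain ⟨x, hx, hxa⟩ := htarget (hA a ha)
    exact (polarLift_eq_of_sqFst_eq h hS hx hxa).1
  have hAΛ : ∀ a ∈ A, polarPoint c i (Complex.exp a.1, a.2) ∈ (halfLattice Λ.toAddSubgroup)ᶜ :=
    fun a ha haΛ => by
      have h1 := congrFun (h.eq_of_mem _ (hAr a ha) haΛ) i
      simp [polarPoint] at h1
  let θ : A → ((halfLattice Λ.toAddSubgroup)ᶜ : Set (Fin 2 → ℂ)) := fun a =>
    ⟨polarPoint c i (Complex.exp a.1.1, a.1.2), hAΛ a a.2⟩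
  have hθ : Continuous θ := by
    refine Continuous.subtype_mk ((continuous_polarPoint c i).comp ?_) _
    fun_prop
  have hθl : ∀ a : A, (toBlowup hS (θ a)).1 = polarLift h hS i (Complex.exp a.1.1, a.1.2) :=
    fun a => Subtype.ext (polarProj_of_ne h hS (Complex.exp_ne_zero _) (hAr a a.2)).symm
  have hθV : ∀ a, toBlowup hS (θ a) ∈ V := fun a => by
    refine ⟨?_, ?_⟩
    · rw [hθl]
      exact polarLift_mem_polarSource h hS (hAr a a.2)
    · rw [hθl, show e (polarLift h hS i _) = _ from polarCoord_polarLift h hS hj (hAr a a.2)]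
      exact hA a a.2
  have hApc : PathConnectedSpace A := by
    refine isPathConnected_iff_pathConnectedSpace.1
      (((convex_halfSpace_re_lt _).prod (convex_ball _ _)).isPathConnected ?_)
    refine ⟨(((Real.log ε / 2 - 1 : ℝ) : ℂ), t), ?_, Metric.mem_ball_self hε⟩
    change Complex.re _ < _
    rw [Complex.ofReal_re]
    linarith
  refine ⟨V, hVO, ⟨hPe, heP ▸ Metric.mem_ball_self hε⟩,
    IsGoodNhd.of_parametrization (toBlowup_eq_iff hS) hVo hVs hθ hθV ?_, ?_⟩
  · rintro v ⟨h1, h2⟩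
    obtain ⟨x, hx, hxv⟩ := exists_polarLift_eq h hS h1
    have h3 : x.1 ≠ 0 := by
      intro h3
      have h4 : (toBlowup hS v).1.1.base = ofPoint Λ (polarPoint c i x) := by
        rw [← hxv]
        exact base_polarProj h hS hx
      obtain ⟨s, t'⟩ := x
      obtain rfl : s = 0 := h3
      rw [polarPoint_zero] at h4
      have h5 : (toBlowup hS v).1.1.base ∈ (holStructure Λ).singularLocus := by
        rw [h4]
        exact hS h.mem
      exact ofPoint_notMem_singularLocus v.2 h5
    have h5 : e (toBlowup hS v).1 = sqFst x := by
      rw [← hxv]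
      exact polarCoord_polarLift h hS hj hx
    rw [h5, sqFst_mem_ball_iff hε, ← Complex.exp_log h3, Complex.norm_exp_sq_lt_iff hε] at h2
    refine ⟨⟨(Complex.log x.1, x.2), h2⟩, Subtype.ext ?_⟩
    rw [hθl, ← hxv]
    simp only [Complex.exp_log h3]
  · obtain ⟨a⟩ := (PathConnectedSpace.nonempty (X := A))
    let a' : A := ⟨(a.1.1 + Real.pi * Complex.I, a.1.2), by
      refine ⟨?_, a.2.2⟩
      have : a.1.1.re < Real.log ε / 2 := a.2.1
      simpa using this⟩
    refine ⟨θ a, θ a', (PathConnectedSpace.somePath a a').map hθ, ?_, fun t => hθV _⟩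
    change polarPoint c i (Complex.exp (a.1.1 + Real.pi * Complex.I), a.1.2) = _
    rw [Complex.exp_add, Complex.exp_pi_mul_I, mul_neg_one, polarPoint_neg]

theorem exists_isGoodNhd (P : ((holStructure Λ).blowup S).regularLocus)
    (O : Set ((holStructure Λ).blowup S).regularLocus) (hO : O ∈ 𝓝 P) :
    ∃ V ⊆ O, P ∈ V ∧ IsGoodNhd (toBlowup hS) V := by
  by_cases hP : P.1.1.base ∈ S
  · obtain ⟨c, r, i, h, hPc, hPi⟩ := exists_mem_polarSource hS hP
    obtain ⟨V, hVO, hPV, hV, -⟩ := exists_isGoodNhd_of_mem_polarSource hS h hPc hPi hO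
    exact ⟨V, hVO, hPV, hV⟩
  · exact exists_isGoodNhd_of_base_notMem hS hP hO

/-- The reflection in the centre of a blown up point is realized by a path over a simply connected
set. -/
theorem exists_reflection_path (hc : c ∈ halfLattice Λ.toAddSubgroup) (hcS : ofPoint Λ c ∈ S) :
    ∃ V : Set ((holStructure Λ).blowup S).regularLocus, IsSimplyConnected V ∧
      ∃ (w w' : ((halfLattice Λ.toAddSubgroup)ᶜ : Set (Fin 2 → ℂ))) (δ : Path w w'),
        (w' : Fin 2 → ℂ) = c + c - w ∧ ∀ t, toBlowup hS (δ t) ∈ V := by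
  obtain ⟨r, h⟩ := exists_isCentredBall hc hcS
  have hc0 : polarPoint c 0 (0, 0) ∈ Metric.ball c r := by
    rw [polarPoint_zero]
    exact h.mem_self
  have hP := polarLift_mem_polarSource h hS hc0
  have hb : (polarLift h hS 0 (0, 0)).1.base = ofPoint Λ c := by
    have h1 := base_polarProj h hS hc0
    rwa [polarPoint_zero] at h1
  obtain ⟨V, -, -, hV, hw⟩ := exists_isGoodNhd_of_mem_polarSource hS h
    (P := ⟨_, mem_regularLocus_of_mem_polarSource h hS hP⟩) hb hP univ_mem
  exact ⟨V, hV.isSimplyConnected, hw⟩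

end SingularKummer

end

section

open HolStructure

/-- Two surjective homomorphisms with the same kernel have isomorphic targets. -/
@[to_additive /-- Two surjective homomorphisms with the same kernel have isomorphic targets. -/]
theorem MonoidHom.exists_mulEquiv_of_surjective {G H K : Type*} [Group G] [Group H] [Group K]
    {f : G →* H} {g : G →* K} (hf : Function.Surjective f) (hg : Function.Surjective g)
    (hfg : ∀ a, f a = 1 ↔ g a = 1) : Nonempty (H ≃* K) := by
  have h : f.ker = g.ker := by
    ext a
    exact hfg a
  exact ⟨((QuotientGroup.quotientKerEquivOfSurjective f hf).symm.trans
    (QuotientGroup.quotientMulEquivOfEq h)).trans (QuotientGroup.quotientKerEquivOfSurjective g hg)⟩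

namespace SingularKummer

variable {Λ : Submodule ℤ (Fin 2 → ℂ)}

variable (Λ) in
/-- The homomorphism `λ ↦ λ / 2` from the lattice to the 2-torsion points of the torus. -/
def halfHom : Λ.toAddSubgroup →+ AddSubgroup.torsionBy (CTorus Λ) 2 where
  toFun l := ⟨((2 : ℂ)⁻¹ • (l : Fin 2 → ℂ) : Fin 2 → ℂ), by
    change (2 : ℤ) • (((2 : ℂ)⁻¹ • (l : Fin 2 → ℂ) : Fin 2 → ℂ) : CTorus Λ) = 0
    rw [two_smul, ← QuotientAddGroup.mk_add, ← two_smul ℂ, smul_inv_smul₀ two_ne_zero,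
      QuotientAddGroup.eq_zero_iff]
    exact l.2⟩
  map_zero' := by
    ext1
    simp
  map_add' l m := by
    ext1
    simp

theorem coe_halfHom (l : Λ.toAddSubgroup) : (halfHom Λ l : CTorus Λ) =
    (((2 : ℂ)⁻¹ • (l : Fin 2 → ℂ) : Fin 2 → ℂ) : CTorus Λ) := rfl

theorem half_add_half (z : Fin 2 → ℂ) : (2 : ℂ)⁻¹ • z + (2 : ℂ)⁻¹ • z = z := by
  rw [← two_smul ℂ, smul_inv_smul₀ two_ne_zero]

theorem half_add_self (z : Fin 2 → ℂ) : (2 : ℂ)⁻¹ • (z + z) = z := by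
  rw [smul_add, half_add_half]

theorem mk_mem_torsionBy_iff {z : Fin 2 → ℂ} :
    (z : CTorus Λ) ∈ AddSubgroup.torsionBy (CTorus Λ) 2 ↔ z ∈ halfLattice Λ.toAddSubgroup := by
  change (2 : ℤ) • (z : CTorus Λ) = 0 ↔ _
  rw [two_smul, ← QuotientAddGroup.mk_add, QuotientAddGroup.eq_zero_iff]
  rfl

theorem halfHom_surjective : Function.Surjective (halfHom Λ) := by
  rintro ⟨t, ht⟩
  obtain ⟨z, rfl⟩ := QuotientAddGroup.mk_surjective t
  refine ⟨⟨z + z, mk_mem_torsionBy_iff.1 ht⟩, Subtype.ext ?_⟩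
  rw [coe_halfHom, half_add_self]

theorem halfHom_eq_zero_iff {l : Λ.toAddSubgroup} : halfHom Λ l = 0 ↔ ∃ m, l = m + m := by
  rw [← Subtype.coe_inj, coe_halfHom, ZeroMemClass.coe_zero, QuotientAddGroup.eq_zero_iff]
  constructor
  · intro h
    exact ⟨⟨_, h⟩, Subtype.ext (half_add_half _).symm⟩
  · rintro ⟨m, rfl⟩
    rw [AddSubgroup.coe_add, half_add_self]
    exact m.2

theorem halfHom_add_self (l : Λ.toAddSubgroup) : halfHom Λ (l + l) = 0 :=
  halfHom_eq_zero_iff.2 ⟨l, rfl⟩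

theorem proj_injOn_torsionBy {s t : CTorus Λ} (hs : s ∈ AddSubgroup.torsionBy (CTorus Λ) 2)
    (h : proj Λ s = proj Λ t) : s = t := by
  obtain ⟨z, rfl⟩ := QuotientAddGroup.mk_surjective s
  obtain ⟨w, rfl⟩ := QuotientAddGroup.mk_surjective t
  rw [mk_mem_torsionBy_iff] at hs
  rw [QuotientAddGroup.eq, neg_add_eq_sub]
  rcases ofPoint_eq_iff.1 h with h | h
  · exact h
  · have := sub_mem h hs
    rwa [show w + z - (z + z) = w - z by abel] at this

/-- The reduction modulo `2` of a lattice. -/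
theorem exists_torsionBy_equiv [DiscreteTopology Λ] [IsZLattice ℝ Λ] :
    Nonempty ((Fin 4 → ZMod 2) ≃+ AddSubgroup.torsionBy (CTorus Λ) 2) := by
  have : Module.Finite ℤ Λ := ZLattice.module_finite ℝ Λ
  have : Module.Free ℤ Λ := ZLattice.module_free ℝ Λ
  have hrank : Module.finrank ℤ Λ = 4 := by
    rw [ZLattice.rank ℝ Λ, Module.finrank_pi_fintype]
    simp
  let b : Module.Basis (Fin 4) ℤ Λ := Module.finBasisOfFinrankEq ℤ Λ hrank
  let f : Λ.toAddSubgroup →+ (Fin 4 → ZMod 2) :=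
    { toFun := fun l i => (b.equivFun l i : ZMod 2)
      map_zero' := by
        ext i
        change ((b.equivFun (0 : Λ) i : ℤ) : ZMod 2) = 0
        simp
      map_add' := fun l m => by
        ext i
        change ((b.equivFun ((l : Λ) + (m : Λ)) i : ℤ) : ZMod 2) = _
        rw [map_add, Pi.add_apply, Int.cast_add]
        rfl }
  refine AddMonoidHom.exists_addEquiv_of_surjective (f := f) (g := halfHom Λ) ?_
    halfHom_surjective fun l => ?_
  · intro v
    refine ⟨b.equivFun.symm fun i => ((v i).val : ℤ), ?_⟩
    ext i
    change ((b.equivFun (b.equivFun.symm fun i => ((v i).val : ℤ)) i : ℤ) : ZMod 2) = _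
    rw [LinearEquiv.apply_symm_apply, Int.cast_natCast, ZMod.natCast_zmod_val]
  · rw [halfHom_eq_zero_iff]
    constructor
    · intro h
      have h1 : ∀ i, ∃ n : ℤ, b.equivFun l i = n + n := fun i => by
        have h2 : ((b.equivFun l i : ℤ) : ZMod 2) = 0 := congrFun h i
        rw [ZMod.intCast_zmod_eq_zero_iff_dvd] at h2
        obtain ⟨n, hn⟩ := h2
        exact ⟨n, by rw [hn]; push_cast; ring⟩
      choose n hn using h1
      refine ⟨b.equivFun.symm n, ?_⟩
      apply b.equivFun.injective
      change _ = b.equivFun ((b.equivFun.symm n : Λ) + b.equivFun.symm n)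
      ext i
      rw [hn i, map_add, LinearEquiv.apply_symm_apply]
      rfl
    · rintro ⟨m, rfl⟩
      rw [map_add]
      ext i
      exact CharTwo.add_self_eq_zero _

theorem exists_isGroupIdentification [DiscreteTopology Λ] [IsZLattice ℝ Λ] {p : SingularKummer Λ}
    (hp : p ∈ (holStructure Λ).singularLocus) : ∃ e, IsGroupIdentification Λ p e := by
  obtain ⟨ψ⟩ := exists_torsionBy_equiv (Λ := Λ)
  obtain ⟨c, hc, rfl⟩ := singularLocus_eq (Λ := Λ) ▸ hp
  let t₀ : AddSubgroup.torsionBy (CTorus Λ) 2 := ⟨(c : CTorus Λ), mk_mem_torsionBy_iff.2 hc⟩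
  have hmem : ∀ t : AddSubgroup.torsionBy (CTorus Λ) 2,
      proj Λ t ∈ (holStructure Λ).singularLocus := by
    rintro ⟨t, ht⟩
    obtain ⟨z, rfl⟩ := QuotientAddGroup.mk_surjective t
    exact ofPoint_mem_singularLocus (mk_mem_torsionBy_iff.1 ht)
  let e : (Fin 4 → ZMod 2) ≃ (holStructure Λ).singularLocus :=
    Equiv.ofBijective (fun v => ⟨proj Λ ((t₀ + ψ v : AddSubgroup.torsionBy (CTorus Λ) 2)), hmem _⟩)
      ⟨fun v w h => by
        have h1 := proj_injOn_torsionBy (t₀ + ψ v).2 (congrArg Subtype.val h)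
        exact ψ.injective (add_left_cancel (Subtype.ext h1)), by
        rintro ⟨y, hy⟩
        obtain ⟨z, hz, rfl⟩ := singularLocus_eq (Λ := Λ) ▸ hy
        refine ⟨ψ.symm (⟨(z : CTorus Λ), mk_mem_torsionBy_iff.2 hz⟩ - t₀), Subtype.ext ?_⟩
        simp only [AddEquiv.apply_symm_apply, add_sub_cancel]
        rfl⟩
  refine ⟨e, ?_, ψ, t₀, fun v => rfl⟩
  change proj Λ ((t₀ + ψ 0 : AddSubgroup.torsionBy (CTorus Λ) 2)) = _
  rw [map_zero, add_zero]
  rfl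

section

variable [DiscreteTopology Λ]

theorem countable_halfLattice : (halfLattice Λ.toAddSubgroup).Countable := by
  have h1 : Countable Λ.toAddSubgroup := countable_of_Lindelof_of_discrete
  have h2 : (Λ.toAddSubgroup : Set (Fin 2 → ℂ)).Countable := h1.to_set
  refine h2.preimage_of_injOn (f := fun z => z + z) fun z _ w _ h => ?_
  simp only at h
  rw [← half_add_self z, h, half_add_self]

instance : SimplyConnectedSpace ((halfLattice Λ.toAddSubgroup)ᶜ : Set (Fin 2 → ℂ)) :=
  isSimplyConnected_compl_of_countable
    (by rw [Module.finrank_pi_fintype]; simp) countable_halfLattice isClosed_halfLattice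

variable {S : Set (SingularKummer Λ)} (hS : S ⊆ (holStructure Λ).singularLocus)

include hS in
theorem pathConnectedSpace_regularLocus :
    PathConnectedSpace ((holStructure Λ).blowup S).regularLocus :=
  pathConnectedSpace_of_isGoodNhd (exists_isGoodNhd hS)

/-- Translation by a difference `2 (c - c₀)` for blown up centres `c` and `c₀` gives the trivial
loop. -/
theorem translationHom_eq_one_of_mem {c₀ : Fin 2 → ℂ} (hc₀ : c₀ ∈ halfLattice Λ.toAddSubgroup)
    (hc₀S : ofPoint Λ c₀ ∈ S) {l : Λ.toAddSubgroup}
    (hl : ofPoint Λ (c₀ + (2 : ℂ)⁻¹ • (l : Fin 2 → ℂ)) ∈ S)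
    (z : ((halfLattice Λ.toAddSubgroup)ᶜ : Set (Fin 2 → ℂ))) :
    translationHom (toBlowup_eq_iff hS) z (.ofAdd l) = 1 := by
  have hsum : c₀ + (2 : ℂ)⁻¹ • (l : Fin 2 → ℂ) + (c₀ + (2 : ℂ)⁻¹ • (l : Fin 2 → ℂ)) =
      c₀ + c₀ + l := by
    rw [add_add_add_comm, half_add_half]
  have hc : c₀ + (2 : ℂ)⁻¹ • (l : Fin 2 → ℂ) ∈ halfLattice Λ.toAddSubgroup := by
    have h1 := add_mem hc₀ l.2
    rwa [← hsum] at h1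
  obtain ⟨V, hV, w, w', δ, hw, hδ⟩ := exists_reflection_path hS hc hl
  obtain ⟨V', hV', v, v', ε, hv, hε⟩ := exists_reflection_path hS hc₀ hc₀S
  refine translationHom_eq_one (toBlowup_eq_iff hS) hc hc₀ hV δ hw hδ hV' ε hv hε z ?_
  rw [hsum, add_sub_cancel_left]

variable {p : SingularKummer Λ} {e : (Fin 4 → ZMod 2) ≃ (holStructure Λ).singularLocus}

/-- The fundamental group at the image of a point of `ℂ²`. -/
theorem nonempty_fundamentalGroup_mulEquiv (hp : p ∈ S) (he : IsGroupIdentification Λ p e)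
    (z : ((halfLattice Λ.toAddSubgroup)ᶜ : Set (Fin 2 → ℂ))) :
    Nonempty (FundamentalGroup ((holStructure Λ).blowup S).regularLocus (toBlowup hS z) ≃*
      Multiplicative ((Fin 4 → ZMod 2) ⧸
        AddSubgroup.closure {v : Fin 4 → ZMod 2 | (e v : SingularKummer Λ) ∈ S})) := by
  obtain ⟨he0, ψ, ⟨t₀, ht₀⟩, hψ⟩ := he
  obtain ⟨c₀, rfl⟩ := QuotientAddGroup.mk_surjective t₀
  have hc₀ := mk_mem_torsionBy_iff.1 ht₀
  have hc₀p : ofPoint Λ c₀ = p := by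
    rw [← he0, hψ, map_zero, add_zero]
    rfl
  have heψ : ∀ l, (e (ψ.symm (halfHom Λ l)) : SingularKummer Λ) =
      ofPoint Λ (c₀ + (2 : ℂ)⁻¹ • (l : Fin 2 → ℂ)) := fun l => by
    rw [hψ, AddEquiv.apply_symm_apply]
    rfl
  set C := AddSubgroup.closure {v : Fin 4 → ZMod 2 | (e v : SingularKummer Λ) ∈ S} with hC
  let θ : Λ.toAddSubgroup →+ (Fin 4 → ZMod 2) ⧸ C :=
    (QuotientAddGroup.mk' C).comp (ψ.symm.toAddMonoidHom.comp (halfHom Λ))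
  have hθ : ∀ l, θ l = 0 ↔ ψ.symm (halfHom Λ l) ∈ C := fun l => QuotientAddGroup.eq_zero_iff _
  have hθs : Function.Surjective θ :=
    (QuotientAddGroup.mk'_surjective C).comp (ψ.symm.surjective.comp halfHom_surjective)
  let Φ := translationHom (toBlowup_eq_iff hS) z
  have hΦs : Function.Surjective Φ := by
    obtain ⟨V, hV, w, w', δ, hw, hδ⟩ := exists_reflection_path hS hc₀ (hc₀p ▸ hp)
    exact translationHom_surjective (toBlowup_eq_iff hS) (exists_isGoodNhd hS) hc₀ hV δ hw hδ z
  refine MonoidHom.exists_mulEquiv_of_surjective (f := Φ) (g := AddMonoidHom.toMultiplicative θ)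
    hΦs hθs fun l => ?_
  change translationHom _ z (.ofAdd l.toAdd) = 1 ↔ θ l.toAdd = 0
  generalize l.toAdd = l
  constructor
  · intro h
    refine mem_of_imageClass_eq_refl (L := θ.ker) (isQuotientMap_ofPoint (Λ := Λ))
      (fun _ _ => ofPoint_eq_iff) (fun l => ?_) hc₀
      (Blowup.continuous_base.comp continuous_subtype_val) (base_toBlowup hS) (fun P => ?_)
      (PathConnectedSpace.somePath z (translateCompl l z))
      (map_translateCompl (toBlowup_eq_iff hS) l z)
      h rfl
    · change θ (l + l) = 0
      rw [hθ, halfHom_add_self, map_zero]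
      exact zero_mem _
    · obtain ⟨v, hv⟩ := ofPoint_surjective P.1.1.base
      refine ⟨v, fun hvΛ => ?_, hv⟩
      change θ _ = 0
      rw [hθ]
      refine AddSubgroup.subset_closure ?_
      change (e _ : SingularKummer Λ) ∈ S
      have h1 : c₀ + (2 : ℂ)⁻¹ • (v + v - (c₀ + c₀)) = v := by
        rw [smul_sub, half_add_self, half_add_self, add_sub_cancel]
      rw [heψ]
      change ofPoint Λ (c₀ + (2 : ℂ)⁻¹ • (v + v - (c₀ + c₀))) ∈ S
      rw [h1, hv]
      refine (mem_regularLocus_blowup hS).1 P.2 ?_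
      rw [← hv]
      refine ofPoint_mem_singularLocus ?_
      have := add_mem hvΛ hc₀
      rwa [sub_add_cancel] at this
  · rw [hθ]
    suffices key : ∀ v ∈ C, ∀ l, ψ.symm (halfHom Λ l) = v →
        translationHom (toBlowup_eq_iff hS) z (.ofAdd l) = 1 from fun h => key _ h l rfl
    have hmem : ∀ v, (e v : SingularKummer Λ) ∈ S → ∀ l, ψ.symm (halfHom Λ l) = v →
        translationHom (toBlowup_eq_iff hS) z (.ofAdd l) = 1 := by
      rintro _ hv l rfl
      rw [heψ] at hv
      exact translationHom_eq_one_of_mem hS hc₀ (hc₀p ▸ hp) hv z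
    intro v hv
    induction hv using AddSubgroup.closure_induction with
    | mem v hv => exact hmem v hv
    | zero => exact hmem 0 (he0 ▸ hp)
    | add v w _ _ hv hw =>
      intro l hl
      obtain ⟨m, hm⟩ := halfHom_surjective (Λ := Λ) (ψ v)
      have h1 := hv m (by rw [hm, AddEquiv.symm_apply_apply])
      have h2 := hw (l - m) (by rw [map_sub, map_sub, hl, hm, AddEquiv.symm_apply_apply,
        add_sub_cancel_left])
      rw [← add_sub_cancel m l, ofAdd_add, map_mul, h1, h2, one_mul]
    | neg v _ hv =>
      intro l hl
      have h1 := hv (-l) (by rw [map_neg, map_neg, hl, neg_neg])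
      rw [ofAdd_neg, map_inv, inv_eq_one] at h1
      exact h1

end

end SingularKummer

end

end

theorem mainTheorem3 (Λ : Submodule ℤ (Fin 2 → ℂ)) [DiscreteTopology Λ] [IsZLattice ℝ Λ]
    (S : Set (SingularKummer Λ))
    (hS : S ⊆ (SingularKummer.holStructure Λ).singularLocus)
    (p : SingularKummer Λ) (hp : p ∈ S) :
    (∃ e, SingularKummer.IsGroupIdentification Λ p e) ∧
    PathConnectedSpace ((SingularKummer.holStructure Λ).blowup S).regularLocus ∧
    ∀ e, SingularKummer.IsGroupIdentification Λ p e →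
      ∀ x₀ : ((SingularKummer.holStructure Λ).blowup S).regularLocus,
        Nonempty (FundamentalGroup ((SingularKummer.holStructure Λ).blowup S).regularLocus x₀ ≃*
          Multiplicative ((Fin 4 → ZMod 2) ⧸
            AddSubgroup.closure {v : Fin 4 → ZMod 2 | (e v : SingularKummer Λ) ∈ S})) := by
  have hpc := SingularKummer.pathConnectedSpace_regularLocus hS
  refine ⟨SingularKummer.exists_isGroupIdentification (hS hp), hpc, fun e he x₀ => ?_⟩
  obtain ⟨z⟩ : Nonempty ((halfLattice Λ.toAddSubgroup)ᶜ : Set (Fin 2 → ℂ)) :=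
    PathConnectedSpace.nonempty
  obtain ⟨φ⟩ := SingularKummer.nonempty_fundamentalGroup_mulEquiv hS hp he z
  exact ⟨(FundamentalGroup.fundamentalGroupMulEquivOfPathConnected x₀ _).trans φ⟩
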